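/- Let $(M^n,g')$ be a compact smooth Riemannian manifold (without boundary), $I\subset\mathbb R$ an open interval, $h\in C^2(I)$ with $h>0$ and $h'>0$, and let $\bar M=I\times_h M$ carry the warped product metric $\bar g=dt^2+h(t)^2g'$. Let $1\le k\le n$, and let $\psi=\psi(t,u,\nu)>0$ be a positive $C^1$ function on the unit tangent bundle of $\bar M$ (also written $\psi(V,\nu)$, with $V=h\,\partial_t$ the position vector field at the point $(t,u)$). Let $a,b\in I$. (On the compact interval $[a,b]$ the function $h$ is automatically bounded above and below by positive constants.) Then there are constants $C$ and $\tau_0>0$, depending only on $a$, $b$ and the data $(M,g'),n,k,I,h,\psi$, with the following property. Let $z\in C^3(M)$ satisfy $a\le z\le b$ (for instance $a=\min z$, $b=\max z$), let $\Sigma=\{(z(u),u): u\in M\}$ be its graph, $\nu$ the inward unit normal of $\Sigma$ (the unit normal with $\langle\nu,\partial_t\rangle<0$), and $\kappa=(\kappa_1,\dots,\kappa_n)$ the principal curvatures of $\Sigma$, i.e. the eigenvalues, with respect to the induced metric, of the second fundamental form $\langle\bar\nabla_XY,\nu\rangle$, where $\bar\nabla$ is the Levi-Civita connection of $\bar g$.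 Suppose that at every point of $\Sigma$ $$\sigma_k(\kappa)=\psi(V,\nu)\qquad\text{and}\qquad \frac{\partial}{\partial t}\big(h(t)^k\,\psi(V,\nu)\big)\le 0,$$ where $\sigma_k$ is the $k$-th elementary symmetric function and $\partial/\partial t$ is taken at fixed $u$ and with the components of $\nu$ in the orthonormal frame $\partial_t,\ h^{-1}e_1,\dots,h^{-1}e_n$ fixed ($e_i$ a $g'$-orthonormal basis of $T_uM$; equivalently, with $\nu$ parallel along the $t$-line). Then $$|\nabla z|\le C\quad\text{on } M,$$ where $\nabla z$ and its norm are taken with respect to $g'$, and the support function $\tau=-\langle V,\nu\rangle$ satisfies $$\tau\ge\tau_0>0 \quad\text{on }\Sigma.$$ -/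

import Mathlib

open Bundle Set
open scoped Manifold ContDiff

/-- The elementary symmetric function `σ_k(κ) = ∑_{i₁ < ⋯ < i_k} κ_{i₁} ⋯ κ_{i_k}`. -/
def sigmaK {n : ℕ} (k : ℕ) (κ : Fin n → ℝ) : ℝ :=
  ∑ s ∈ Finset.powersetCard k (Finset.univ : Finset (Fin n)), ∏ i ∈ s, κ i

/-- `M` is an `n`-manifold without boundary modelled on `ℝⁿ`; this is the type of its smooth
Riemannian metrics `g'`. -/
abbrev SmoothMetric (n : ℕ) (M : Type*) [TopologicalSpace M]
    [ChartedSpace (EuclideanSpace ℝ (Fin n)) M]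
    [IsManifold 𝓘(ℝ, EuclideanSpace ℝ (Fin n)) ∞ M] : Type _ :=
  ContMDiffRiemannianMetric 𝓘(ℝ, EuclideanSpace ℝ (Fin n)) ∞ (EuclideanSpace ℝ (Fin n))
    (fun x : M => TangentSpace 𝓘(ℝ, EuclideanSpace ℝ (Fin n)) x)

section Warped

variable {n : ℕ} {M : Type*} [TopologicalSpace M]
  [ChartedSpace (EuclideanSpace ℝ (Fin n)) M]
  [IsManifold 𝓘(ℝ, EuclideanSpace ℝ (Fin n)) ∞ M]

/-- The warped product metric `dt² + h(t)² g'` on `T_{(t,u)}(I × M) = ℝ × T_u M`. A tangent vector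
`a ∂_t + v`, `v ∈ T_u M`, is written as the pair `(a, v)`. -/
noncomputable def warpedInner (g : SmoothMetric n M) (h : ℝ → ℝ) (t : ℝ) (u : M)
    (a b : ℝ × TangentSpace 𝓘(ℝ, EuclideanSpace ℝ (Fin n)) u) : ℝ :=
  a.1 * b.1 + h t ^ 2 * g.inner u a.2 b.2

/-- The differential `dX(v) = (dz(v), v)` of the graph map `X(u) = (z(u), u)`. -/
noncomputable def graphTangent (z : M → ℝ) (u : M)
    (v : TangentSpace 𝓘(ℝ, EuclideanSpace ℝ (Fin n)) u) :
    ℝ × TangentSpace 𝓘(ℝ, EuclideanSpace ℝ (Fin n)) u :=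
  ((mfderiv 𝓘(ℝ, EuclideanSpace ℝ (Fin n)) 𝓘(ℝ, ℝ) z u v : ℝ), v)

/-- `w` is the gradient of `z` at `u` with respect to the metric `g'` of `M`. -/
def IsGradient (g : SmoothMetric n M) (z : M → ℝ) (u : M)
    (w : TangentSpace 𝓘(ℝ, EuclideanSpace ℝ (Fin n)) u) : Prop :=
  ∀ v : TangentSpace 𝓘(ℝ, EuclideanSpace ℝ (Fin n)) u,
    g.inner u w v = (mfderiv 𝓘(ℝ, EuclideanSpace ℝ (Fin n)) 𝓘(ℝ, ℝ) z u v : ℝ)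

/-- `ν` is the inward unit normal of the graph of `z` at `(z(u), u)`: a unit vector orthogonal to
the graph with `⟨ν, ∂_t⟩ < 0`. -/
def IsInwardUnitNormal (g : SmoothMetric n M) (h : ℝ → ℝ) (z : M → ℝ) (u : M)
    (ν : ℝ × TangentSpace 𝓘(ℝ, EuclideanSpace ℝ (Fin n)) u) : Prop :=
  warpedInner g h (z u) u ν ν = 1 ∧
  (∀ v : TangentSpace 𝓘(ℝ, EuclideanSpace ℝ (Fin n)) u,
    warpedInner g h (z u) u ν (graphTangent z u v) = 0) ∧
  warpedInner g h (z u) u ν (1, 0) < 0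

/-- The support function `τ = -⟨V, ν⟩`, where `V = h ∂_t`. -/
noncomputable def supportFunction (g : SmoothMetric n M) (h : ℝ → ℝ) (z : M → ℝ) (u : M)
    (ν : ℝ × TangentSpace 𝓘(ℝ, EuclideanSpace ℝ (Fin n)) u) : ℝ :=
  -warpedInner g h (z u) u (h (z u), 0) ν

/-- The warped product metric in the coordinates `(t, x)` of `ℝ × ℝⁿ`, where `x` are the
coordinates on `M` given by the chart at `c`. -/
noncomputable def coordMetric (g : SmoothMetric n M) (h : ℝ → ℝ) (c : M)
    (y a b : ℝ × EuclideanSpace ℝ (Fin n)) : ℝ :=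
  warpedInner g h y.1 ((extChartAt 𝓘(ℝ, EuclideanSpace ℝ (Fin n)) c).symm y.2)
    (a.1, mfderiv 𝓘(ℝ, EuclideanSpace ℝ (Fin n)) 𝓘(ℝ, EuclideanSpace ℝ (Fin n))
      (extChartAt 𝓘(ℝ, EuclideanSpace ℝ (Fin n)) c).symm y.2 a.2)
    (b.1, mfderiv 𝓘(ℝ, EuclideanSpace ℝ (Fin n)) 𝓘(ℝ, EuclideanSpace ℝ (Fin n))
      (extChartAt 𝓘(ℝ, EuclideanSpace ℝ (Fin n)) c).symm y.2 b.2)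

/-- Christoffel symbols of the first kind of a metric `G` on a domain of a vector space, i.e.
`⟨∇_a b, w⟩ = (a⟨b, w⟩ + b⟨a, w⟩ - w⟨a, b⟩) / 2` for constant vector fields `a`, `b`, `w`, where
`∇` is the Levi-Civita connection of `G`. -/
noncomputable def christoffel {F : Type*} [NormedAddCommGroup F] [NormedSpace ℝ F]
    (G : F → F → F → ℝ) (y a b w : F) : ℝ :=
  (fderiv ℝ (fun y' => G y' b w) y a + fderiv ℝ (fun y' => G y' a w) y b
    - fderiv ℝ (fun y' => G y' a b) y w) / 2

/-- The graph map `X` in coordinates: `x ↦ (z(x), x)`. -/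
noncomputable def coordGraph (z : M → ℝ) (c : M) (x : EuclideanSpace ℝ (Fin n)) :
    ℝ × EuclideanSpace ℝ (Fin n) :=
  (z ((extChartAt 𝓘(ℝ, EuclideanSpace ℝ (Fin n)) c).symm x), x)

/-- The second fundamental form `B(v, w) = ⟨∇̄_{dX(v)} dX(w), ν⟩` of the graph of `z` at
`(z(p), p)`, with respect to the normal `ν` there, computed in the coordinates of the chart at `c`
(whose domain has to contain `p`): with `X` the coordinate expression of the graph map, it is
`⟨D²X(v, w), ν⟩ + ⟨Γ(DX(v), DX(w)), ν⟩`. -/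
noncomputable def secondFundamentalForm (g : SmoothMetric n M) (h : ℝ → ℝ) (z : M → ℝ) (c p : M)
    (ν : ℝ × TangentSpace 𝓘(ℝ, EuclideanSpace ℝ (Fin n)) p)
    (v w : TangentSpace 𝓘(ℝ, EuclideanSpace ℝ (Fin n)) p) : ℝ :=
  let φ := extChartAt 𝓘(ℝ, EuclideanSpace ℝ (Fin n)) c
  let dφ : TangentSpace 𝓘(ℝ, EuclideanSpace ℝ (Fin n)) p → EuclideanSpace ℝ (Fin n) :=
    fun a => mfderiv 𝓘(ℝ, EuclideanSpace ℝ (Fin n)) 𝓘(ℝ, EuclideanSpace ℝ (Fin n)) φ p a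
  let X := coordGraph z c
  let ν' : ℝ × EuclideanSpace ℝ (Fin n) := (ν.1, dφ ν.2)
  coordMetric g h c (X (φ p))
      (fderiv ℝ (fun x => fderiv ℝ X x (dφ w)) (φ p) (dφ v)) ν'
    + christoffel (coordMetric g h c) (X (φ p))
      (fderiv ℝ X (φ p) (dφ v)) (fderiv ℝ X (φ p) (dφ w)) ν'

/-- `κ = (κ₁, …, κ_n)` are the principal curvatures of the graph of `z` at `(z(p), p)` with respect
to the normal `ν`: some basis of the tangent space is orthonormal for the induced metric and
diagonalizes the second fundamental form, with diagonal entries `κ_i`. As the second fundamental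
form is a tensor, it does not matter in which of the charts around `p` it is computed. -/
def IsPrincipalCurvatures (g : SmoothMetric n M) (h : ℝ → ℝ) (z : M → ℝ) (p : M)
    (ν : ℝ × TangentSpace 𝓘(ℝ, EuclideanSpace ℝ (Fin n)) p) (κ : Fin n → ℝ) : Prop :=
  ∃ b : Fin n → TangentSpace 𝓘(ℝ, EuclideanSpace ℝ (Fin n)) p,
    (∀ i j, warpedInner g h (z p) p (graphTangent z p (b i)) (graphTangent z p (b j))
      = if i = j then 1 else 0) ∧
    ∀ c : M, p ∈ (chartAt (EuclideanSpace ℝ (Fin n)) c).source →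
      ∀ i j, secondFundamentalForm g h z c p ν (b i) (b j) = if i = j then κ i else 0

/-- The unit tangent bundle of the warped product `I × M`, as a subset of `ℝ × ℝ × TM`: the triple
`(t, a, (u, v))` stands for the tangent vector `a ∂_t + v` at the point `(t, u)`. -/
def unitBundle (g : SmoothMetric n M) (h : ℝ → ℝ) (I : Set ℝ) :
    Set (ℝ × ℝ × TangentBundle 𝓘(ℝ, EuclideanSpace ℝ (Fin n)) M) :=
  {q | q.1 ∈ I ∧ warpedInner g h q.1 q.2.2.proj (q.2.1, q.2.2.snd) (q.2.1, q.2.2.snd) = 1}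

/-- `ψ(t, u, ν)`, a function of a point `(t, u)` and a tangent vector `ν` there, is `C¹` on the unit
tangent bundle of `I × M`. -/
def IsC1OnUnitBundle (g : SmoothMetric n M) (h : ℝ → ℝ) (I : Set ℝ)
    (ψ : ℝ → (u : M) → ℝ × TangentSpace 𝓘(ℝ, EuclideanSpace ℝ (Fin n)) u → ℝ) : Prop :=
  ContMDiffOn
    (𝓘(ℝ, ℝ).prod (𝓘(ℝ, ℝ).prod (𝓘(ℝ, EuclideanSpace ℝ (Fin n)).tangent))) 𝓘(ℝ, ℝ) 1
    (fun q : ℝ × ℝ × TangentBundle 𝓘(ℝ, EuclideanSpace ℝ (Fin n)) M =>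
      ψ q.1 q.2.2.proj (q.2.1, q.2.2.snd))
    (unitBundle g h I)

/-- The parallel transport of a vector `ν = a ∂_t + v` from `(s, u)` to `(t, u)` along the line
`I × {u}`: its components in the parallel orthonormal frame `∂_t, e_i / h(t)` are kept fixed. -/
noncomputable def transport (h : ℝ → ℝ) (s t : ℝ) {u : M}
    (ν : ℝ × TangentSpace 𝓘(ℝ, EuclideanSpace ℝ (Fin n)) u) :
    ℝ × TangentSpace 𝓘(ℝ, EuclideanSpace ℝ (Fin n)) u :=
  (ν.1, (h s / h t) • ν.2)

/-- The derivative `∂/∂t (h(t)^k ψ(V, ν))` at the point `(s, u)` and the unit vector `ν` there;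
`ν` is held fixed in the parallel frame along the `t`-line. -/
noncomputable def dtWeighted (h : ℝ → ℝ) (k : ℕ)
    (ψ : ℝ → (u : M) → ℝ × TangentSpace 𝓘(ℝ, EuclideanSpace ℝ (Fin n)) u → ℝ)
    (s : ℝ) (u : M) (ν : ℝ × TangentSpace 𝓘(ℝ, EuclideanSpace ℝ (Fin n)) u) : ℝ :=
  deriv (fun t => h t ^ k * ψ t u (transport h s t ν)) s

end Warped

/-!
The proof is a maximum principle argument in the function `v = s ∘ z`, where `s' = 1 / h`. Put
`ω = √(1 + |∇v|²)`, with gradient and norm taken for `g'`. Then the inward unit normal is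
`ν = (-1 / ω, ∇v / (h ω))`, the support function is `τ = h / ω` and `|∇z| = h |∇v|`, so that both
estimates follow from an upper bound for `ω`, i.e. a positive lower bound for `-ν.1`. In terms of
`v` the numbers `h ω κ_i` are the eigenvalues of `h' (g' + dv ⊗ dv) - ∇²v` with respect to
`g' + dv ⊗ dv`, and the curvature equation says that `σ_k` of these eigenvalues is `ω^k h^k ψ`
(`IsSolution.chart_normal`).

The principal curvatures of a solution lie in the Gårding cone `σ_1, …, σ_k > 0`
(`IsSolution.sigmaK_pos`): the set of points where they do is open, and it is closed because
`σ_k > 0` and because `σ_k^j ≤ σ_j^k` holds on the cone (`esym_pow_le_pow`, from Newton's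
inequalities for real-rooted polynomials). If its complement were nonempty, then `z` restricted to
it would have a maximum; there all `κ_i` are positive, as `h' > 0` and `∇²z ≤ 0`, a contradiction.

At a local maximum of `log ω - N v` which is not critical for `v`, the first derivative test shows
that `∇v / |∇v|` is an eigenvector of `∇²v` with eigenvalue `N ω²`. In a frame which starts with
this vector and diagonalizes `∇²v`, the second derivative tests are weighted with the derivatives
of `σ_k` and added, and the equation differentiated in the direction of `∇v` is used to remove the
third derivatives of `v` (`sq_le_of_max`). In that equation the `t`-derivative of `h^k ψ` has a
favourable sign, which leaves an error of order `1 + N` (`exists_hasDerivAt_weighted_le`); the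
remaining good term is quadratic in `N`, and `σ_{k-1}` is bounded below by Newton's inequalities.
The outcome is that `N²` is at most a linear function of `N`, with coefficients that depend on the
data only (`IsSolution.sq_le_of_isLocalMax`). The third derivatives of `z` enter only at the maximum
point itself, so that no more than `z ∈ C³` is used. To keep the computation elementary, it takes
place in a chart composed with a quadratic map (`normalMap`), in which the first derivatives of the
metric vanish at the point under consideration.

For `N` large the maximum points of `log ω - N v` are therefore critical points of `v`, uniformly
over all solutions by compactness of `M` (`exists_forall_isLocalMax`). There `ω = 1`, and comparing
values at a maximum point and at an arbitrary point gives `ω ≤ exp (N osc v)`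
(`IsSolution.exp_le_normal`).
-/

/-! ### Elementary symmetric functions and the Gårding cone -/

open Polynomial in
/-- The derivative of a real-rooted polynomial is real-rooted, by Rolle's theorem. -/
theorem splits_derivative_real {p : ℝ[X]} (hp : p.Splits) : (derivative p).Splits := by
  rcases Nat.eq_zero_or_pos p.natDegree with h0 | h0
  · rw [natDegree_eq_zero.1 h0 |>.choose_spec.symm]; simp
  rw [splits_iff_card_roots] at hp ⊢
  have h1 := card_roots_le_derivative p
  have h2 := card_roots' (derivative p)
  have h3 := natDegree_derivative_lt h0.ne'
  omega

open Polynomial in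
theorem splits_iterate_derivative_real {p : ℝ[X]} (hp : p.Splits) (j : ℕ) :
    (derivative^[j] p).Splits := by
  induction j with
  | zero => simpa
  | succ j ih => rw [Function.iterate_succ_apply']; exact splits_derivative_real ih

open Polynomial in
/-- Newton's inequality for the lowest coefficients of a real-rooted polynomial. The other
coefficients reduce to this case by differentiation. -/
theorem newton_zero {p : ℝ[X]} (hp : p.Splits) :
    2 * (p.coeff 0 * p.coeff 2) ≤ p.coeff 1 ^ 2 := by
  obtain ⟨m, hm⟩ := splits_iff_exists_multiset.1 hp
  have key : ∀ m : Multiset ℝ, ∀ q : ℝ[X], q = (m.map fun a => X - C a).prod →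
      2 * (q.coeff 0 * q.coeff 2) ≤ q.coeff 1 ^ 2 := by
    intro m
    induction m using Multiset.induction_on with
    | empty => rintro q rfl; simp [coeff_one]
    | cons a m ih =>
      rintro q rfl
      have := ih _ rfl
      set r := (m.map fun a => X - C a).prod
      rw [Multiset.map_cons, Multiset.prod_cons]
      have e0 : ((X - C a) * r).coeff 0 = - a * r.coeff 0 := by simp [sub_mul]
      have e1 : ((X - C a) * r).coeff 1 = r.coeff 0 - a * r.coeff 1 := by
        simp [sub_mul, coeff_X_mul]
      have e2 : ((X - C a) * r).coeff 2 = r.coeff 1 - a * r.coeff 2 := by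
        simp [sub_mul, coeff_X_mul]
      rw [e0, e1, e2]
      nlinarith [mul_le_mul_of_nonneg_left this (sq_nonneg a), sq_nonneg (r.coeff 0)]
  have := key m _ rfl
  rw [hm]
  simp only [coeff_C_mul]
  nlinarith [mul_le_mul_of_nonneg_left this (sq_nonneg p.leadingCoeff)]

open Polynomial in
/-- Newton's inequality, in the weak form without binomial weights, for a real-rooted polynomial. -/
theorem newton_splits {p : ℝ[X]} (hp : p.Splits) (j : ℕ) :
    p.coeff j * p.coeff (j + 2) ≤ p.coeff (j + 1) ^ 2 := by
  rcases le_or_gt (p.coeff j * p.coeff (j + 2)) 0 with h0 | h0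
  · exact h0.trans (sq_nonneg _)
  have h := newton_zero (splits_iterate_derivative_real hp j)
  simp only [coeff_iterate_derivative, nsmul_eq_mul] at h
  have a0 : ((0 + j).descFactorial j : ℝ) = j.factorial := by
    rw [zero_add, Nat.descFactorial_self]
  have a1 : ((1 + j).descFactorial j : ℝ) = (j + 1) * j.factorial := by
    have := Nat.factorial_mul_descFactorial (Nat.le_add_left j 1)
    rw [Nat.add_sub_cancel] at this
    rw [← Nat.cast_succ, ← Nat.cast_mul, ← Nat.factorial_succ]
    rw [add_comm 1 j] at this ⊢
    simpa using congrArg (Nat.cast : ℕ → ℝ) this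
  have a2 : 2 * ((2 + j).descFactorial j : ℝ) = (j + 2) * ((j + 1) * j.factorial) := by
    have := Nat.factorial_mul_descFactorial (Nat.le_add_left j 2)
    rw [Nat.add_sub_cancel] at this
    have h2 := congrArg (Nat.cast : ℕ → ℝ) this
    rw [add_comm 2 j, Nat.factorial_succ, Nat.factorial_succ] at h2
    rw [add_comm 2 j]
    push_cast [Nat.factorial] at h2
    linarith
  have hf : (0:ℝ) < j.factorial := by positivity
  rw [a0, a1, zero_add, add_comm 1 j, add_comm 2 j] at h
  rw [add_comm 2 j] at a2
  have h' : (j.factorial:ℝ)^2 * ((j+1) * ((j + 2) * (p.coeff j * p.coeff (j + 2)))) ≤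
      (j.factorial:ℝ)^2 * ((j + 1) * ((j+1) * p.coeff (j + 1) ^ 2)) := by
    have e : (j.factorial:ℝ)^2 * ((j+1) * ((j + 2) * (p.coeff j * p.coeff (j + 2)))) =
        j.factorial * p.coeff j * (((j + 2) * ((j + 1) * j.factorial)) * p.coeff (j + 2)) := by
      ring
    rw [e, ← a2]
    linarith [h]
  have hj : (0:ℝ) < j + 1 := by positivity
  have h2 := le_of_mul_le_mul_left (le_of_mul_le_mul_left h' (by positivity)) hj
  nlinarith

/-- The elementary symmetric function of degree `j` in the variables `a i`, `i ∈ s`, as a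
coefficient of `∏ (1 + a i X)`. -/
noncomputable def esym {ι : Type*} (s : Finset ι) (a : ι → ℝ) (j : ℕ) : ℝ :=
  (∏ i ∈ s, (1 + Polynomial.C (a i) * Polynomial.X)).coeff j

section esym

variable {ι : Type*} (s : Finset ι) (a : ι → ℝ)

open Polynomial in
theorem esym_newton (j : ℕ) : esym s a j * esym s a (j + 2) ≤ esym s a (j + 1) ^ 2 := by
  apply newton_splits
  refine Splits.prod fun i _ => Splits.of_natDegree_le_one ?_
  compute_degree

open Polynomial in
theorem esym_zero : esym s a 0 = 1 := by
  simp [esym, coeff_zero_eq_eval_zero, eval_prod]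

open Polynomial in
theorem esym_succ_of_mem [DecidableEq ι] {i : ι} (hi : i ∈ s) (j : ℕ) :
    esym s a (j + 1) = esym (s.erase i) a (j + 1) + a i * esym (s.erase i) a j := by
  rw [esym, ← Finset.mul_prod_erase s _ hi, add_mul, one_mul, coeff_add, mul_assoc, coeff_C_mul,
    coeff_X_mul]
  rfl

open Polynomial in
/-- Euler's identity for the homogeneous polynomial `σ_{j+1}`; its derivative in the direction
`i` is `esym (s.erase i) a j`. -/
theorem esym_sum_mul [DecidableEq ι] (j : ℕ) :
    ∑ i ∈ s, a i * esym (s.erase i) a j = (j + 1) * esym s a (j + 1) := by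
  have := congrArg (fun p => coeff p j) (derivative_prod_finset (s := s)
    (f := fun i => 1 + C (a i) * X))
  simp only [coeff_derivative, finsetSum_coeff] at this
  rw [mul_comm, esym, this]
  refine Finset.sum_congr rfl fun i _ => ?_
  rw [mul_comm (a i), esym, ← coeff_mul_C]
  simp

theorem esym_sum [DecidableEq ι] (j : ℕ) :
    ∑ i ∈ s, esym (s.erase i) a j = (s.card - j) * esym s a j := by
  cases j with
  | zero => simp [esym_zero]
  | succ j =>
    have h : ∀ i ∈ s, esym (s.erase i) a (j + 1) = esym s a (j + 1) - a i * esym (s.erase i) a j :=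
      fun i hi => by rw [esym_succ_of_mem s a hi]; ring
    rw [Finset.sum_congr rfl h, Finset.sum_sub_distrib, esym_sum_mul]
    simp; ring

open Polynomial in
theorem esym_eq_sum (k : ℕ) :
    esym s a k = ∑ t ∈ Finset.powersetCard k s, ∏ i ∈ t, a i := by
  rw [esym, Finset.prod_one_add, finsetSum_coeff, ← Finset.sum_filter_add_sum_filter_not
    _ (fun t => t.card = k), ← add_zero (∑ t ∈ Finset.powersetCard k _, _)]
  congr 1
  · refine Finset.sum_congr ?_ fun t ht => ?_
    · ext t; simp [Finset.mem_powersetCard]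
    · rw [Finset.mem_powersetCard] at ht
      rw [Finset.prod_mul_distrib, Finset.prod_const, ht.2, ← map_prod, coeff_C_mul]
      simp
  · refine Finset.sum_eq_zero fun t ht => ?_
    rw [Finset.mem_filter] at ht
    rw [Finset.prod_mul_distrib, Finset.prod_const, ← map_prod, coeff_C_mul, coeff_X_pow,
      if_neg (Ne.symm ht.2), mul_zero]

theorem esym_univ_eq_sigmaK {n : ℕ} (κ : Fin n → ℝ) (k : ℕ) :
    esym Finset.univ κ k = sigmaK k κ :=
  esym_eq_sum _ _ _

theorem esym_smul (c : ℝ) (k : ℕ) : esym s (fun i => c * a i) k = c ^ k * esym s a k := by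
  rw [esym_eq_sum, esym_eq_sum, Finset.mul_sum]
  refine Finset.sum_congr rfl fun t ht => ?_
  rw [Finset.prod_mul_distrib, Finset.prod_const, (Finset.mem_powersetCard.1 ht).2]

theorem esym_pos_of_pos (ha : ∀ i ∈ s, 0 < a i) {k : ℕ} (hk : k ≤ s.card) : 0 < esym s a k := by
  rw [esym_eq_sum]
  refine Finset.sum_pos (fun t ht => Finset.prod_pos fun i hi =>
    ha i ((Finset.mem_powersetCard.1 ht).1 hi)) (Finset.powersetCard_nonempty.2 hk)

variable {s a}

/-- Membership in the Gårding cone passes to the variables with one of them removed. -/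
theorem esym_erase_pos [DecidableEq ι] {i : ι} (hi : i ∈ s) {k : ℕ}
    (hk : ∀ j ≤ k + 1, 0 < esym s a j) : ∀ j ≤ k, 0 < esym (s.erase i) a j := by
  intro j
  induction j with
  | zero => intro _; rw [esym_zero]; exact one_pos
  | succ j ih =>
    intro hj
    have hb := ih (by omega)
    have e1 := esym_succ_of_mem s a hi j
    have e2 := esym_succ_of_mem s a hi (j + 1)
    have p1 := hk (j + 1) (by omega)
    have p2 := hk (j + 2) (by omega)
    have nw := esym_newton (s.erase i) a j
    by_contra hneg
    push Not at hneg
    set b0 := esym (s.erase i) a j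
    set b1 := esym (s.erase i) a (j + 1)
    set b2 := esym (s.erase i) a (j + 2)
    have hx : 0 < a i * b0 := by linarith
    -- both recursions force `b0 b2 > b1 ^ 2`, against Newton's inequality
    have h3 : b2 > - (a i * b1) := by linarith
    nlinarith [mul_lt_mul_of_pos_left h3 hb]

/-- The step from `j` to `j + 1` in Maclaurin's inequality on the Gårding cone, without binomial
weights. -/
theorem esym_pow_le {k : ℕ} (hk : ∀ j ≤ k, 0 < esym s a j) :
    ∀ j < k, esym s a (j + 1) ^ j ≤ esym s a j ^ (j + 1) := by
  intro j
  induction j with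
  | zero => intro _; simp [esym_zero]
  | succ j ih =>
    intro hj
    have h0 := hk j (by omega)
    have h1 := hk (j + 1) (by omega)
    have h2 := hk (j + 2) (by omega)
    have i1 := ih (by omega)
    have nw := esym_newton s a j
    have := pow_le_pow_left₀ (by positivity) nw (j + 1)
    rw [mul_pow] at this
    -- `b1 ^ j * b2 ^ (j+1) ≤ b0 ^ (j+1) * b2 ^ (j+1) ≤ b1 ^ (2 (j+1))`
    have h3 : esym s a (j+1) ^ j * esym s a (j + 2) ^ (j+1) ≤
        esym s a (j+1) ^ j * esym s a (j+1) ^ (j + 2) := by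
      calc _ ≤ esym s a j ^ (j+1) * esym s a (j + 2) ^ (j+1) := by gcongr
        _ ≤ _ := this
        _ = _ := by rw [← pow_mul, ← pow_add]; congr 1; ring
    exact le_of_mul_le_mul_left h3 (by positivity)

/-- A weak form of Maclaurin's inequality on the Gårding cone. -/
theorem esym_pow_le_pow {k : ℕ} (hk : ∀ j ≤ k, 0 < esym s a j) {j : ℕ} (hj : j ≤ k) :
    esym s a k ^ j ≤ esym s a j ^ k := by
  induction k, hj using Nat.le_induction with
  | base => exact le_rfl
  | succ k hjk ih =>
    rcases Nat.eq_zero_or_pos k with rfl | hk0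
    · obtain rfl : j = 0 := by omega
      simp [esym_zero]
    have i1 := ih fun j hj => hk j (by omega)
    have i2 := esym_pow_le hk k (by omega)
    have h1 := hk (k + 1) le_rfl
    have h2 := hk j (by omega)
    have h3 := hk k (by omega)
    refine le_of_pow_le_pow_left₀ hk0.ne' (by positivity) ?_
    calc (esym s a (k + 1) ^ j) ^ k = (esym s a (k + 1) ^ k) ^ j := by rw [pow_right_comm]
      _ ≤ (esym s a k ^ (k + 1)) ^ j := by gcongr
      _ = (esym s a k ^ j) ^ (k + 1) := by rw [pow_right_comm]
      _ ≤ (esym s a j ^ k) ^ (k + 1) := by gcongr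
      _ = _ := by rw [pow_right_comm]

end esym

/-! ### Elementary symmetric functions of the eigenvalues of a matrix -/

/-- The `k`-th elementary symmetric function of the eigenvalues of a matrix `A`, as a coefficient
of `det (1 + X A)`. -/
noncomputable def matSigma {ι : Type*} [Fintype ι] [DecidableEq ι] (A : Matrix ι ι ℝ) (k : ℕ) : ℝ :=
  (Matrix.det (1 + (Polynomial.X : Polynomial ℝ) • A.map Polynomial.C)).coeff k

section matSigma

variable {ι : Type*} [Fintype ι] [DecidableEq ι]

theorem matSigma_eq_sum_minors (A : Matrix ι ι ℝ) (k : ℕ) :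
    matSigma A k = ∑ s ∈ Finset.univ.powersetCard k,
      (A.submatrix (Subtype.val : s → ι) (Subtype.val : s → ι)).det :=
  Matrix.coeff_det_one_add_X_smul_eq_sum_minors A k

theorem matSigma_diagonal (d : ι → ℝ) (k : ℕ) :
    matSigma (Matrix.diagonal d) k = esym Finset.univ d k := by
  rw [matSigma, esym, Matrix.diagonal_map (map_zero _), ← Matrix.diagonal_one,
    ← Matrix.diagonal_smul, Matrix.diagonal_add, Matrix.det_diagonal]
  congr 1
  refine Finset.prod_congr rfl fun i _ => ?_
  simp [Polynomial.X_mul_C]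

theorem matSigma_conj {P Q : Matrix ι ι ℝ} (h : P * Q = 1) (A : Matrix ι ι ℝ) (k : ℕ) :
    matSigma (P * A * Q) k = matSigma A k := by
  have h1 : P.map Polynomial.C * Q.map Polynomial.C = 1 := by
    rw [← Matrix.map_mul, h, Matrix.map_one _ (map_zero _) (map_one _)]
  have h2 : (1 : Matrix ι ι (Polynomial ℝ)) + (Polynomial.X : Polynomial ℝ) •
      (P * A * Q).map Polynomial.C = P.map Polynomial.C *
        (1 + (Polynomial.X : Polynomial ℝ) • A.map Polynomial.C) * Q.map Polynomial.C := by
    rw [Matrix.mul_add, Matrix.add_mul, mul_one, h1, Matrix.map_mul, Matrix.map_mul,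
      Matrix.mul_smul, Matrix.smul_mul]
  rw [matSigma, h2, Matrix.det_mul, Matrix.det_mul, mul_right_comm, ← Matrix.det_mul, h1,
    Matrix.det_one, one_mul, matSigma]

theorem continuousAt_matSigma {X : Type*} [TopologicalSpace X] {A : X → Matrix ι ι ℝ} {x : X}
    (hA : ContinuousAt A x) (k : ℕ) : ContinuousAt (fun y => matSigma (A y) k) x := by
  simp only [matSigma_eq_sum_minors]
  refine tendsto_finsetSum _ fun s _ => ?_
  have : Continuous fun B : Matrix ι ι ℝ =>
      (B.submatrix (Subtype.val : s → ι) (Subtype.val : s → ι)).det := by fun_prop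
  exact this.continuousAt.comp hA

/-- If `g` is congruent to `α` times the identity and `B` to a diagonal matrix by the same `R`, the
eigenvalues of `g⁻¹ B` are those of the diagonal matrix divided by `α`. -/
theorem matSigma_inv_mul {R g B : Matrix ι ι ℝ} {α : ℝ} (hα : α ≠ 0) {d : ι → ℝ}
    (hg : R.transpose * g * R = α • 1) (hB : R.transpose * B * R = Matrix.diagonal d) (k : ℕ) :
    matSigma (g⁻¹ * B) k = esym Finset.univ (fun i => α⁻¹ * d i) k := by
  have h1 : (α⁻¹ • (R.transpose * g)) * R = 1 := by
    rw [Matrix.smul_mul, hg, smul_smul, inv_mul_cancel₀ hα, one_smul]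
  have h2 : R * (α⁻¹ • (R.transpose * g)) = 1 := mul_eq_one_comm.1 h1
  have h3 : (α⁻¹ • (R * R.transpose)) * g = 1 := by
    rw [Matrix.smul_mul, Matrix.mul_assoc, ← Matrix.mul_smul, h2]
  have h4 : R.transpose * (g * R * (α⁻¹ • 1)) = 1 := by
    rw [← Matrix.mul_assoc, ← Matrix.mul_assoc, hg, Matrix.smul_mul, one_mul, smul_smul,
      mul_inv_cancel₀ hα, one_smul]
  have h5 : (g * R * (α⁻¹ • 1)) * R.transpose = 1 := mul_eq_one_comm.1 h4
  rw [Matrix.inv_eq_left_inv h3]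
  have h6 : (α⁻¹ • (R * R.transpose)) * B =
      R * Matrix.diagonal (fun i => α⁻¹ * d i) * (α⁻¹ • (R.transpose * g)) := by
    have : Matrix.diagonal (fun i => α⁻¹ * d i) = α⁻¹ • (R.transpose * B * R) := by
      rw [hB, ← Matrix.diagonal_smul]; rfl
    rw [this]
    calc (α⁻¹ • (R * R.transpose)) * B = α⁻¹ • (R * R.transpose * B) * 1 := by
          rw [Matrix.smul_mul, mul_one]
      _ = α⁻¹ • (R * R.transpose * B) * (R * (α⁻¹ • (R.transpose * g))) := by rw [h2]
      _ = _ := by simp only [Matrix.smul_mul, Matrix.mul_smul, Matrix.mul_assoc]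
  rw [h6, matSigma_conj h2, matSigma_diagonal]

theorem hasDerivAt_det_diagonal {A : ℝ → Matrix ι ι ℝ} {A' : Matrix ι ι ℝ} {s₀ : ℝ} {d : ι → ℝ}
    (hA : ∀ i j, HasDerivAt (fun s => A s i j) (A' i j) s₀) (h0 : A s₀ = Matrix.diagonal d) :
    HasDerivAt (fun s => (A s).det) (∑ i, A' i i * ∏ j ∈ Finset.univ.erase i, d j) s₀ := by
  simp only [Matrix.det_apply']
  have h1 : ∀ σ : Equiv.Perm ι, HasDerivAt (fun s => ∏ i, A s (σ i) i)
      (∑ i, (∏ j ∈ Finset.univ.erase i, A s₀ (σ j) j) • A' (σ i) i) s₀ := fun σ => by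
    exact HasDerivAt.fun_finsetProd (u := Finset.univ) (f := fun i s => A s (σ i) i)
      fun i _ => hA (σ i) i
  have h2 := HasDerivAt.fun_sum (u := (Finset.univ : Finset (Equiv.Perm ι))) fun σ _ =>
    (h1 σ).const_mul ((Equiv.Perm.sign σ : ℤ) : ℝ)
  refine h2.congr_deriv ?_
  rw [Finset.sum_eq_single (1 : Equiv.Perm ι)]
  · simp [h0, mul_comm]
  · intro σ _ hσ
    rw [Finset.sum_eq_zero, mul_zero]
    intro i _
    -- a nontrivial permutation moves some `j ≠ i`
    obtain ⟨j, hj, hji⟩ : ∃ j, σ j ≠ j ∧ j ≠ i := by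
      by_contra hcon
      push Not at hcon
      refine hσ (Equiv.ext fun j => ?_)
      by_contra hj
      obtain rfl := hcon j hj
      have h3 := hcon (σ j) fun h => hj (σ.injective h)
      exact hj h3
    rw [Finset.prod_eq_zero (Finset.mem_erase.2 ⟨hji, Finset.mem_univ j⟩), zero_smul]
    rw [h0, Matrix.diagonal_apply_ne _ hj]
  · simp

theorem hasDerivAt_matSigma_diagonal {A : ℝ → Matrix ι ι ℝ} {A' : Matrix ι ι ℝ} {s₀ : ℝ}
    {d : ι → ℝ} (hA : ∀ i j, HasDerivAt (fun s => A s i j) (A' i j) s₀)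
    (h0 : A s₀ = Matrix.diagonal d) (k : ℕ) :
    HasDerivAt (fun s => matSigma (A s) (k + 1))
      (∑ i, esym (Finset.univ.erase i) d k * A' i i) s₀ := by
  simp only [matSigma_eq_sum_minors]
  have h1 : ∀ t : Finset ι, HasDerivAt
      (fun s => ((A s).submatrix (Subtype.val : t → ι) (Subtype.val : t → ι)).det)
      (∑ i ∈ t, A' i i * ∏ j ∈ t.erase i, d j) s₀ := fun t => by
    refine (hasDerivAt_det_diagonal (A' := A'.submatrix Subtype.val Subtype.val)
      (d := fun i : t => d i) (fun i j => hA i j) ?_).congr_deriv ?_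
    · rw [h0]; exact Matrix.submatrix_diagonal _ _ Subtype.val_injective
    · rw [← Finset.sum_coe_sort t]
      refine Finset.sum_congr rfl fun i _ => ?_
      rw [Matrix.submatrix_apply]
      congr 1
      refine Finset.prod_bij (fun j _ => (j : ι)) ?_ ?_ ?_ ?_
      · intro j hj
        exact Finset.mem_erase.2 ⟨fun h => (Finset.mem_erase.1 hj).1 (Subtype.ext h), j.2⟩
      · intro a _ b _ h; exact Subtype.ext h
      · intro b hb; rw [Finset.mem_erase] at hb
        exact ⟨⟨b, hb.2⟩, Finset.mem_erase.2 ⟨fun h => hb.1 (congrArg Subtype.val h),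
          Finset.mem_univ _⟩, rfl⟩
      · intros; rfl
  refine (HasDerivAt.fun_sum fun t _ => h1 t).congr_deriv ?_
  rw [Finset.sum_comm' (t' := Finset.univ)
    (s' := fun i => (Finset.powersetCard (k + 1) Finset.univ).filter (i ∈ ·)) (by simp)]
  refine Finset.sum_congr rfl fun i _ => ?_
  rw [← Finset.mul_sum, mul_comm, esym_eq_sum]
  congr 1
  refine Finset.sum_nbij' (fun t => t.erase i) (fun t => insert i t) ?_ ?_ ?_ ?_ ?_
  · intro t ht
    simp only [Finset.mem_filter, Finset.mem_powersetCard] at ht ⊢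
    exact ⟨Finset.erase_subset_erase _ ht.1.1, by rw [Finset.card_erase_of_mem ht.2, ht.1.2]; rfl⟩
  · intro t ht
    simp only [Finset.mem_filter, Finset.mem_powersetCard] at ht ⊢
    have : i ∉ t := fun h => by simpa using ht.1 h
    exact ⟨⟨Finset.subset_univ _, by rw [Finset.card_insert_of_notMem this, ht.2]⟩, by simp⟩
  · intro t ht
    exact Finset.insert_erase (Finset.mem_filter.1 ht).2
  · intro t ht
    have : i ∉ t := fun h => by simpa using (Finset.mem_powersetCard.1 ht).1 h
    exact Finset.erase_insert this
  · intros; rfl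

theorem differentiableAt_det {A : ℝ → Matrix ι ι ℝ} {s₀ : ℝ}
    (hA : ∀ i j, DifferentiableAt ℝ (fun s => A s i j) s₀) :
    DifferentiableAt ℝ (fun s => (A s).det) s₀ := by
  simp only [Matrix.det_apply']
  refine DifferentiableAt.fun_sum fun σ _ => DifferentiableAt.const_mul ?_ _
  exact DifferentiableAt.fun_finsetProd fun i _ => hA _ _

theorem differentiableAt_inv_apply {A : ℝ → Matrix ι ι ℝ} {s₀ : ℝ}
    (hA : ∀ i j, DifferentiableAt ℝ (fun s => A s i j) s₀) (h0 : (A s₀).det ≠ 0) (i j : ι) :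
    DifferentiableAt ℝ (fun s => (A s)⁻¹ i j) s₀ := by
  simp only [Matrix.inv_def, Ring.inverse_eq_inv', Matrix.smul_apply, smul_eq_mul,
    Matrix.adjugate_apply]
  refine ((differentiableAt_det hA).fun_inv h0).mul (differentiableAt_det fun a b => ?_)
  by_cases h : a = j
  · subst h; simp
  · simp [Matrix.updateRow_ne h, hA]

/-- The derivative of `σ_{k+1}` of `g⁻¹ B` at a parameter where `g` and `B` are diagonal. -/
theorem hasDerivAt_matSigma_inv_mul {g B : ℝ → Matrix ι ι ℝ} {g' B' : Matrix ι ι ℝ} {s₀ : ℝ}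
    {γ a : ι → ℝ} (hg : ∀ i j, HasDerivAt (fun s => g s i j) (g' i j) s₀)
    (hB : ∀ i j, HasDerivAt (fun s => B s i j) (B' i j) s₀)
    (hγ : ∀ i, γ i ≠ 0) (hg0 : g s₀ = Matrix.diagonal γ)
    (hB0 : B s₀ = Matrix.diagonal fun i => γ i * a i) (k : ℕ) :
    HasDerivAt (fun s => matSigma ((g s)⁻¹ * B s) (k + 1))
      (∑ i, esym (Finset.univ.erase i) a k * ((B' i i - a i * g' i i) / γ i)) s₀ := by
  have hdet : (g s₀).det ≠ 0 := by
    rw [hg0, Matrix.det_diagonal]; exact Finset.prod_ne_zero_iff.2 fun i _ => hγ i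
  have hC : ∀ i j, DifferentiableAt ℝ (fun s => ((g s)⁻¹ * B s) i j) s₀ := fun i j => by
    simp only [Matrix.mul_apply]
    refine DifferentiableAt.fun_sum fun l _ => DifferentiableAt.mul ?_ (hB l j).differentiableAt
    exact differentiableAt_inv_apply (fun i j => (hg i j).differentiableAt) hdet i l
  have hC0 : (g s₀)⁻¹ * B s₀ = Matrix.diagonal a := by
    have : B s₀ = g s₀ * Matrix.diagonal a := by rw [hg0, hB0, Matrix.diagonal_mul_diagonal]
    rw [this, ← Matrix.mul_assoc, Matrix.nonsing_inv_mul _ (Ne.isUnit hdet), one_mul]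
  set C' : Matrix ι ι ℝ := fun i j => deriv (fun s => ((g s)⁻¹ * B s) i j) s₀ with hC'
  have hCd : ∀ i j, HasDerivAt (fun s => ((g s)⁻¹ * B s) i j) (C' i j) s₀ :=
    fun i j => (hC i j).hasDerivAt
  refine (hasDerivAt_matSigma_diagonal hCd hC0 k).congr_deriv ?_
  refine Finset.sum_congr rfl fun i _ => ?_
  congr 1
  rw [eq_div_iff (hγ i)]
  have hev : ∀ᶠ s in nhds s₀, (g s).det ≠ 0 :=
    (differentiableAt_det fun i j => (hg i j).differentiableAt).continuousAt.eventually_ne hdet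
  have h1 : HasDerivAt (fun s => ∑ l, g s i l * ((g s)⁻¹ * B s) l i)
      (∑ l, (g' i l * ((g s₀)⁻¹ * B s₀) l i + g s₀ i l * C' l i)) s₀ :=
    HasDerivAt.fun_sum fun l _ => (hg i l).mul (hCd l i)
  have h2 : (fun s => ∑ l, g s i l * ((g s)⁻¹ * B s) l i) =ᶠ[nhds s₀] fun s => B s i i := by
    filter_upwards [hev] with s hs
    rw [← Matrix.mul_apply, ← Matrix.mul_assoc, Matrix.mul_nonsing_inv _ (Ne.isUnit hs), one_mul]
  have h3 := (h1.congr_of_eventuallyEq h2.symm).unique (hB i i)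
  rw [hC0, hg0, Finset.sum_add_distrib] at h3
  simp [Matrix.diagonal_apply] at h3
  linarith

end matSigma

/-! ### The algebraic inequality at a maximum point -/

section algebra

variable {ι : Type*} {s : Finset ι} {a : ι → ℝ}

/-- Lower bound for `σ_m` on the Gårding cone when `σ_{m+1} ≥ c w^{m+1}`. -/
theorem le_esym_of_le_esym_succ {m : ℕ} (ha : ∀ j ≤ m + 1, 0 < esym s a j) {c w : ℝ}
    (hc : 0 < c) (hc1 : c ≤ 1) (hw : 0 < w) (h : c * w ^ (m + 1) ≤ esym s a (m + 1)) :
    c * w ^ m ≤ esym s a m := by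
  have h0 := ha m (by omega)
  refine le_of_pow_le_pow_left₀ (n := m + 1) (by omega) h0.le ?_
  calc (c * w ^ m) ^ (m + 1) = c ^ (m + 1) * (w ^ m) ^ (m + 1) := mul_pow _ _ _
    _ ≤ c ^ m * (w ^ m) ^ (m + 1) := by
        gcongr ?_ * _
        exact pow_le_pow_of_le_one hc.le hc1 (by omega)
    _ = (c * w ^ (m + 1)) ^ m := by rw [mul_pow, pow_right_comm]
    _ ≤ esym s a (m + 1) ^ m := by gcongr
    _ ≤ _ := esym_pow_le ha m (by omega)

/-- On the Gårding cone, if `a i ≤ 0` then `∂σ_{m+1}/∂a_i` dominates `σ_m`. -/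
theorem esym_le_esym_erase [DecidableEq ι] {m : ℕ} (ha : ∀ j ≤ m + 1, 0 < esym s a j) {i : ι}
    (hi : i ∈ s) (hai : a i ≤ 0) : esym s a m ≤ esym (s.erase i) a m := by
  cases m with
  | zero => simp [esym_zero]
  | succ m =>
    rw [esym_succ_of_mem s a hi]
    have := esym_erase_pos hi (k := m) (fun j hj => ha j (by omega)) m le_rfl
    nlinarith

/-- The maximum principle in algebraic form. The second derivative test for `log w - N v`, with
`w² = 1 + p²`, is weighted with the derivatives `F i` of `σ_{m+1}` and compared with the equation
differentiated along the gradient. The third derivatives `T i` cancel, and the quadratic term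
`N² w² F i₀` has to be bounded by terms linear in `N`. Here `L i` are the second derivatives of `v`,
`γ i` the eigenvalues of the induced metric, `R i` and `K i` come from the curvature of the base,
and `H`, `p * J` are the derivative of the warping function and its derivative along the gradient
of `v`. -/
theorem sq_le_of_max [DecidableEq ι] {m : ℕ} (ha : ∀ j ≤ m + 1, 0 < esym s a j) {i₀ : ι}
    (hi₀ : i₀ ∈ s) {N p H J E w c CJ CH CK CE : ℝ} {T L R K γ g' B' : ι → ℝ}
    (hN : 0 ≤ N) (hp : 0 ≤ p) (hw : 0 < w) (hw2 : w ^ 2 = 1 + p ^ 2)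
    (hc : 0 < c) (hc1 : c ≤ 1)
    (hγ₀ : γ i₀ = w ^ 2) (hγ : ∀ i ∈ s, i ≠ i₀ → γ i = 1)
    (hL : ∀ i ∈ s, L i = γ i * (H - a i)) (hL₀ : L i₀ = N * w ^ 2) (ha₀ : a i₀ ≤ 0)
    (hg₀ : g' i₀ = 2 * p * L i₀) (hg : ∀ i ∈ s, i ≠ i₀ → g' i = 0)
    (hB : ∀ i ∈ s, B' i = p * J * γ i + H * g' i - (T i - p * K i))
    (hmax₀ : (p * T i₀ + L i₀ ^ 2 - p ^ 2 * R i₀ / 2) / w ^ 2 - 2 * (p * L i₀ / w ^ 2) ^ 2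
      - N * L i₀ ≤ 0)
    (hmax : ∀ i ∈ s, i ≠ i₀ → (p * T i - p ^ 2 * R i / 2) / w ^ 2 - N * L i ≤ 0)
    (heq : ∑ i ∈ s, esym (s.erase i) a m * ((B' i - a i * g' i) / γ i) =
      (m + 1) * N * p * esym s a (m + 1) + E)
    (hE : E ≤ CE * (1 + N) * w ^ (m + 1)) (hS : c * w ^ (m + 1) ≤ esym s a (m + 1))
    (hJ : |J| ≤ CJ) (hH : |H| ≤ CH) (hR : ∀ i ∈ s, |R i| ≤ CK) (hK : ∀ i ∈ s, |K i| ≤ CK)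
    (hCE : 0 ≤ CE) :
    N ^ 2 ≤ s.card * (CJ + 2 * CK + N * CH) + CE * (1 + N) / c := by
  have hF : ∀ i ∈ s, 0 < esym (s.erase i) a m := fun i hi => esym_erase_pos hi ha m le_rfl
  have hF₀ := esym_le_esym_erase ha hi₀ ha₀
  have hS0 := ha (m + 1) le_rfl
  have hm0 := ha m (by omega)
  set F : ι → ℝ := fun i => esym (s.erase i) a m
  have hW : 0 < w ^ 2 := by positivity
  have hCK : 0 ≤ CK := (abs_nonneg _).trans (hR i₀ hi₀)
  have hCJ : 0 ≤ CJ := (abs_nonneg _).trans hJ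
  have hCH : 0 ≤ CH := (abs_nonneg _).trans hH
  -- The second derivative test in the direction `i`, with the third derivative `T i` eliminated by
  -- means of `B' i`. The direction of the gradient contributes `N² w²`.
  have key : ∀ i ∈ s, F i * ((N * w ^ 2) * a i - w ^ 2 * (2 * CK + CJ + N * CH)
      + if i = i₀ then N ^ 2 * w ^ 2 else 0) ≤ p * (F i * ((B' i - a i * g' i) / γ i)) := by
    intro i hi
    have hJ1 := abs_le.1 hJ
    have hH1 := abs_le.1 hH
    have hR1 := abs_le.1 (hR i hi)
    have hK1 := abs_le.1 (hK i hi)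
    rw [mul_left_comm p]
    refine mul_le_mul_of_nonneg_left ?_ (hF i hi).le
    have hp2 : 0 ≤ p ^ 2 := sq_nonneg p
    have hpw2 : p ^ 2 ≤ w ^ 2 := by linarith
    have b1 : - (w ^ 2 * CJ) ≤ p ^ 2 * J := by
      have h1 := mul_le_mul_of_nonneg_left hJ1.1 hp2
      have h2 := mul_le_mul_of_nonneg_right hpw2 hCJ
      linarith
    have b2 : N * w ^ 2 * H ≤ N * w ^ 2 * CH :=
      mul_le_mul_of_nonneg_left hH1.2 (by positivity)
    have b3 : p ^ 2 * R i / 2 - p ^ 2 * K i ≤ w ^ 2 * (2 * CK) := by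
      have h1 := mul_le_mul_of_nonneg_left hR1.2 hp2
      have h2 := mul_le_mul_of_nonneg_left hK1.1 hp2
      have h3 := mul_le_mul_of_nonneg_right hpw2 hCK
      have h4 := mul_nonneg hp2 hCK
      linarith
    by_cases h : i = i₀
    · subst h
      have hai : a i = H - N := by
        have := hL i hi
        rw [hL₀, hγ₀] at this
        have := mul_left_cancel₀ hW.ne' ((mul_comm _ _).trans this)
        linarith
      have b4 : (p ^ 2 * R i / 2 - p ^ 2 * K i) / w ^ 2 ≤ w ^ 2 * (2 * CK) := by
        rw [div_le_iff₀ hW]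
        have : w ^ 2 * (2 * CK) ≤ w ^ 2 * (2 * CK) * w ^ 2 :=
          le_mul_of_one_le_right (by positivity) (by linarith)
        linarith
      have e1 : p * ((B' i - a i * g' i) / γ i) =
          p ^ 2 * J + 2 * p ^ 2 * N ^ 2 - p * T i / w ^ 2 + p ^ 2 * K i / w ^ 2 := by
        rw [hB i hi, hg₀, hγ₀, hL₀, hai]; field_simp; ring
      have e2 : (p * T i + L i ^ 2 - p ^ 2 * R i / 2) / w ^ 2 - 2 * (p * L i / w ^ 2) ^ 2
          - N * L i = p * T i / w ^ 2 - p ^ 2 * R i / 2 / w ^ 2 - 2 * p ^ 2 * N ^ 2 := by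
        rw [hL₀]; field_simp; ring
      rw [e2] at hmax₀
      rw [e1, if_pos rfl, hai]
      have e3 : (p ^ 2 * R i / 2 - p ^ 2 * K i) / w ^ 2 =
        p ^ 2 * R i / 2 / w ^ 2 - p ^ 2 * K i / w ^ 2 := sub_div _ _ _
      rw [e3] at b4
      linarith
    · have e1 : p * ((B' i - a i * g' i) / γ i) = p ^ 2 * J - p * T i + p ^ 2 * K i := by
        rw [hB i hi, hg i hi h, hγ i hi h]; ring
      have e2 := hmax i hi h
      rw [hL i hi, hγ i hi h, sub_nonpos, div_le_iff₀ hW] at e2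
      rw [e1, if_neg h]
      linarith
  have hsum := Finset.sum_le_sum key
  rw [← Finset.mul_sum, heq] at hsum
  have e4 : ∑ i ∈ s, F i * ((N * w ^ 2) * a i - w ^ 2 * (2 * CK + CJ + N * CH)
      + if i = i₀ then N ^ 2 * w ^ 2 else 0) = N * w ^ 2 * ((m + 1) * esym s a (m + 1))
      - w ^ 2 * (2 * CK + CJ + N * CH) * ((s.card - m) * esym s a m) + F i₀ * (N ^ 2 * w ^ 2) := by
    have h1 : ∀ i ∈ s, F i * ((N * w ^ 2) * a i - w ^ 2 * (2 * CK + CJ + N * CH)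
        + if i = i₀ then N ^ 2 * w ^ 2 else 0) = N * w ^ 2 * (a i * F i)
        - w ^ 2 * (2 * CK + CJ + N * CH) * F i + if i = i₀ then F i * (N ^ 2 * w ^ 2) else 0 := by
      intro i _; split_ifs <;> ring
    rw [Finset.sum_congr rfl h1, Finset.sum_add_distrib, Finset.sum_sub_distrib,
      Finset.sum_ite_eq' s i₀, if_pos hi₀, ← Finset.mul_sum, ← Finset.mul_sum, esym_sum_mul,
      esym_sum]
  rw [e4] at hsum
  -- Here `F i₀` dominates `σ_m`, so that all other terms can be divided by it.
  have hq := le_esym_of_le_esym_succ ha hc hc1 hw hS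
  have hpw : p ≤ w := le_of_sq_le_sq (by linarith) hw.le
  have h5 : p * E ≤ w ^ 2 * (CE * (1 + N) / c) * F i₀ := by
    have h6 : p * E ≤ w * (CE * (1 + N) * w ^ (m + 1)) :=
      (mul_le_mul_of_nonneg_left hE hp).trans (mul_le_mul_of_nonneg_right hpw (by positivity))
    have h7 : CE * (1 + N) / c * (c * w ^ m) ≤ CE * (1 + N) / c * F i₀ :=
      mul_le_mul_of_nonneg_left (hq.trans hF₀) (by positivity)
    have h8 : CE * (1 + N) / c * (c * w ^ m) = CE * (1 + N) * w ^ m := by field_simp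
    rw [h8] at h7
    calc p * E ≤ w ^ 2 * (CE * (1 + N) * w ^ m) := h6.trans_eq (by ring)
      _ ≤ w ^ 2 * (CE * (1 + N) / c * F i₀) := mul_le_mul_of_nonneg_left h7 hW.le
      _ = _ := by ring
  have h9 : ((s.card : ℝ) - m) * esym s a m ≤ s.card * F i₀ := by
    have h1 : ((s.card : ℝ) - m) * esym s a m ≤ s.card * esym s a m :=
      mul_le_mul_of_nonneg_right (sub_le_self _ (by positivity)) hm0.le
    exact h1.trans (mul_le_mul_of_nonneg_left hF₀ (by positivity))
  have h10 : w ^ 2 * (2 * CK + CJ + N * CH) * ((s.card - m) * esym s a m) ≤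
      w ^ 2 * (2 * CK + CJ + N * CH) * (s.card * F i₀) :=
    mul_le_mul_of_nonneg_left h9 (by positivity)
  have h11 : p * ((m + 1) * N * p * esym s a (m + 1)) ≤
      N * w ^ 2 * ((m + 1) * esym s a (m + 1)) := by
    have : 0 ≤ N * ((m + 1) * esym s a (m + 1)) := by positivity
    rw [hw2]
    have h2 : p ^ 2 ≤ 1 + p ^ 2 := by linarith
    calc p * ((m + 1) * N * p * esym s a (m + 1)) =
        p ^ 2 * (N * ((m + 1) * esym s a (m + 1))) := by ring
      _ ≤ (1 + p ^ 2) * (N * ((m + 1) * esym s a (m + 1))) := mul_le_mul_of_nonneg_right h2 this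
      _ = _ := by ring
  have h12 : (w ^ 2 * F i₀) * N ^ 2 ≤ (w ^ 2 * F i₀) *
      (s.card * (CJ + 2 * CK + N * CH) + CE * (1 + N) / c) := by
    rw [mul_add p] at hsum
    have aux : ∀ {x y y' z z' u t : ℝ}, x - y + t ≤ u + z → u ≤ x → y ≤ y' → z ≤ z' →
      t ≤ y' + z' := by intros; linarith
    calc (w ^ 2 * F i₀) * N ^ 2 = F i₀ * (N ^ 2 * w ^ 2) := by ring
      _ ≤ _ := aux hsum h11 h10 h5
      _ = _ := by ring
  exact le_of_mul_le_mul_left h12 (mul_pos hW (hF i₀ hi₀))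

end algebra

/-! ### Coordinate Riemannian geometry -/

section coordinates

set_option maxSynthPendingDepth 3

open scoped Topology

variable {E : Type*} [NormedAddCommGroup E] [NormedSpace ℝ E]

theorem isInvertible_of_posDef [FiniteDimensional ℝ E] {g : E →L[ℝ] E →L[ℝ] ℝ}
    (hg : ∀ a, a ≠ 0 → 0 < g a a) : g.IsInvertible := by
  have hinj : Function.Injective (g : E →ₗ[ℝ] E →L[ℝ] ℝ) := by
    rw [injective_iff_map_eq_zero]
    intro a ha
    by_contra h
    have h1 := hg a h
    have h2 : g a = 0 := ha
    rw [h2] at h1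
    simp at h1
  have hdim : Module.finrank ℝ E = Module.finrank ℝ (E →L[ℝ] ℝ) := by
    rw [← LinearEquiv.finrank_eq (LinearMap.toContinuousLinearMap (𝕜 := ℝ) (E := E) (F' := ℝ))]
    exact (Subspace.dual_finrank_eq (K := ℝ) (V := E)).symm
  let e := LinearEquiv.ofInjectiveOfFinrankEq (g : E →ₗ[ℝ] E →L[ℝ] ℝ) hinj hdim
  exact ⟨e.toContinuousLinearEquiv, by ext; rfl⟩

theorem apply_inverse_of_posDef [FiniteDimensional ℝ E] {g : E →L[ℝ] E →L[ℝ] ℝ}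
    (hg : ∀ a, a ≠ 0 → 0 < g a a) (φ : E →L[ℝ] ℝ) : g (g.inverse φ) = φ := by
  obtain ⟨e, rfl⟩ := isInvertible_of_posDef hg
  simp

theorem eq_of_posDef {g : E →L[ℝ] E →L[ℝ] ℝ}
    (hg : ∀ a, a ≠ 0 → 0 < g a a) {a b : E} (h : g a = g b) : a = b := by
  by_contra hab
  have h1 := hg (a - b) (sub_ne_zero.2 hab)
  have h2 : g (a - b) = 0 := by rw [map_sub, h, sub_self]
  rw [h2] at h1
  simp at h1

/-- Christoffel symbols of the first kind of the metric `G`, through the derivative of `G` as a map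
into the space of bilinear forms. -/
noncomputable def chr (G : E → E →L[ℝ] E →L[ℝ] ℝ) (y a b w : E) : ℝ :=
  (fderiv ℝ G y a b w + fderiv ℝ G y b a w - fderiv ℝ G y w a b) / 2

/-- The gradient of `v` with respect to the metric `G`. -/
noncomputable def gradE (G : E → E →L[ℝ] E →L[ℝ] ℝ) (v : E → ℝ) (y : E) : E :=
  (G y).inverse (fderiv ℝ v y)

/-- The covariant Hessian of `v` with respect to the metric `G`. -/
noncomputable def hessE (G : E → E →L[ℝ] E →L[ℝ] ℝ) (v : E → ℝ) (y a b : E) : ℝ :=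
  fderiv ℝ (fderiv ℝ v) y a b - chr G y a b (gradE G v y)

theorem apply_gradE [FiniteDimensional ℝ E] {G : E → E →L[ℝ] E →L[ℝ] ℝ} {y : E}
    (hpos : ∀ a, a ≠ 0 → 0 < G y a a) (v : E → ℝ) : G y (gradE G v y) = fderiv ℝ v y :=
  apply_inverse_of_posDef hpos _

theorem fderiv_symm_apply {G : E → E →L[ℝ] E →L[ℝ] ℝ} {y : E} (hG : DifferentiableAt ℝ G y)
    (hs : ∀ᶠ x in 𝓝 y, ∀ a b, G x a b = G x b a) (c a b : E) :
    fderiv ℝ G y c a b = fderiv ℝ G y c b a := by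
  have h1 := (hG.hasFDerivAt.clm_apply (hasFDerivAt_const a y)).clm_apply (hasFDerivAt_const b y)
  have h2 := (hG.hasFDerivAt.clm_apply (hasFDerivAt_const b y)).clm_apply (hasFDerivAt_const a y)
  have h3 := (h2.congr_of_eventuallyEq (hs.mono fun x hx => hx a b)).unique h1
  simpa using (congrArg (fun L : E →L[ℝ] ℝ => L c) h3).symm

theorem contDiffAt_gradE [FiniteDimensional ℝ E] {G : E → E →L[ℝ] E →L[ℝ] ℝ} {v : E → ℝ} {y : E}
    {n : WithTop ℕ∞} (hG : ContDiffAt ℝ n G y) (hpos : ∀ a, a ≠ 0 → 0 < G y a a)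
    (hv : ContDiffAt ℝ n (fderiv ℝ v) y) : ContDiffAt ℝ n (gradE G v) y := by
  have h1 : ContDiffAt ℝ n (fun x => (G x).inverse) y :=
    (isInvertible_of_posDef hpos).contDiffAt_map_inverse.comp y hG
  exact h1.clm_apply hv

/-- Cauchy-Schwarz for a positive definite symmetric form. -/
theorem sq_apply_le_of_posDef {g : E →L[ℝ] E →L[ℝ] ℝ}
    (hs : ∀ a b, g a b = g b a) (hg : ∀ a, a ≠ 0 → 0 < g a a) (a b : E) :
    g a b ^ 2 ≤ g a a * g b b := by
  rcases eq_or_ne b 0 with rfl | hb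
  · simp
  have hb := hg b hb
  have h : 0 ≤ g (g b b • a - g a b • b) (g b b • a - g a b • b) := by
    by_cases h0 : g b b • a - g a b • b = 0
    · rw [h0]; simp
    · exact (hg _ h0).le
  simp only [map_sub, map_smul, sub_apply, smul_apply,
    smul_eq_mul, hs b a] at h
  have h2 : 0 ≤ g b b * (g a a * g b b - g a b ^ 2) := by nlinarith
  have h3 := nonneg_of_mul_nonneg_right h2 hb
  linarith

variable {X : Type*} [NormedAddCommGroup X] [NormedSpace ℝ X]

theorem contDiffAt_flip {V : Type*} [NormedAddCommGroup V] [NormedSpace ℝ V] {n : WithTop ℕ∞}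
    {f : X → E →L[ℝ] E →L[ℝ] V} {x : X}
    (hf : ContDiffAt ℝ n f x) : ContDiffAt ℝ n (fun y => (f y).flip) x := by
  let L : (E →L[ℝ] E →L[ℝ] V) →L[ℝ] (E →L[ℝ] E →L[ℝ] V) :=
    (ContinuousLinearMap.flipₗᵢ ℝ E E V).toContinuousLinearEquiv.toContinuousLinearMap
  exact ContDiffAt.continuousLinearMap_comp (E := X) (F := E →L[ℝ] E →L[ℝ] V)
    (G := E →L[ℝ] E →L[ℝ] V) L hf

theorem differentiableAt_flip {f : X → E →L[ℝ] E →L[ℝ] ℝ} {x : X}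
    (hf : DifferentiableAt ℝ f x) : DifferentiableAt ℝ (fun y => (f y).flip) x := by
  let L : (E →L[ℝ] E →L[ℝ] ℝ) →L[ℝ] (E →L[ℝ] E →L[ℝ] ℝ) :=
    (ContinuousLinearMap.flipₗᵢ ℝ E E ℝ).toContinuousLinearEquiv.toContinuousLinearMap
  exact DifferentiableAt.comp (𝕜 := ℝ) (f := f) (E := X) (F := E →L[ℝ] E →L[ℝ] ℝ)
    (G := E →L[ℝ] E →L[ℝ] ℝ) x L.differentiableAt hf

section pullback

/-- The pullback of the metric `G` by a map `θ` with derivative `Θ`. -/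
noncomputable def pullMetric (G : E → E →L[ℝ] E →L[ℝ] ℝ) (θ : E → E) (Θ : E → E →L[ℝ] E) (y : E) :
    E →L[ℝ] E →L[ℝ] ℝ :=
  (G (θ y)).bilinearComp (Θ y) (Θ y)

theorem pullMetric_eq (G : E → E →L[ℝ] E →L[ℝ] ℝ) (θ : E → E) (Θ : E → E →L[ℝ] E) (y : E) :
    pullMetric G θ Θ y = ((G (θ y) ∘L Θ y).flip ∘L Θ y).flip := by
  ext a b; simp [pullMetric]

variable {G : E → E →L[ℝ] E →L[ℝ] ℝ} {θ : E → E} {Θ : E → E →L[ℝ] E} {v : E → ℝ} {y : E}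
  {Θ' : E →L[ℝ] E →L[ℝ] E}

theorem hasFDerivAt_comp_of_differentiableAt {V : Type*} [NormedAddCommGroup V] [NormedSpace ℝ V]
    {f : E → V} (hf : DifferentiableAt ℝ f (θ y)) (hθ : HasFDerivAt θ (Θ y) y) :
    HasFDerivAt (fun x => f (θ x)) (fderiv ℝ f (θ y) ∘L Θ y) y :=
  hf.hasFDerivAt.comp y hθ

theorem fderiv_pullMetric_apply (hG : DifferentiableAt ℝ G (θ y)) (hθ : HasFDerivAt θ (Θ y) y)
    (hΘ : HasFDerivAt Θ Θ' y) (c a b : E) :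
    fderiv ℝ (pullMetric G θ Θ) y c a b = fderiv ℝ G (θ y) (Θ y c) (Θ y a) (Θ y b)
      + G (θ y) (Θ' c a) (Θ y b) + G (θ y) (Θ y a) (Θ' c b) := by
  have h1 := hasFDerivAt_comp_of_differentiableAt (V := E →L[ℝ] E →L[ℝ] ℝ) hG hθ
  have hd : DifferentiableAt ℝ (pullMetric G θ Θ) y := by
    rw [show pullMetric G θ Θ = fun y => _ from funext (pullMetric_eq G θ Θ)]
    exact differentiableAt_flip ((differentiableAt_flip
      (h1.differentiableAt.clm_comp hΘ.differentiableAt)).clm_comp hΘ.differentiableAt)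
  have h2 := (hd.hasFDerivAt.clm_apply (hasFDerivAt_const a y)).clm_apply (hasFDerivAt_const b y)
  have ha : HasFDerivAt (fun x => Θ x a) _ y := hΘ.clm_apply (hasFDerivAt_const a y)
  have hb : HasFDerivAt (fun x => Θ x b) _ y := hΘ.clm_apply (hasFDerivAt_const b y)
  have h3 := (h1.clm_apply ha).clm_apply hb
  have h4 : (fun x => pullMetric G θ Θ x a b) = fun x => G (θ x) (Θ x a) (Θ x b) := by
    ext x; simp [pullMetric]
  rw [h4] at h2
  have h5 := congrArg (fun L : E →L[ℝ] ℝ => L c) (h2.unique h3)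
  simp at h5
  rw [h5]; ring

theorem chr_pullMetric (hG : DifferentiableAt ℝ G (θ y))
    (hs : ∀ a b, G (θ y) a b = G (θ y) b a)
    (hθ : HasFDerivAt θ (Θ y) y) (hΘ : HasFDerivAt Θ Θ' y)
    (hΘs : ∀ a b, Θ' a b = Θ' b a) (a b w : E) :
    chr (pullMetric G θ Θ) y a b w =
      chr G (θ y) (Θ y a) (Θ y b) (Θ y w) + G (θ y) (Θ' a b) (Θ y w) := by
  simp only [chr, fderiv_pullMetric_apply hG hθ hΘ]
  rw [hΘs b a, hΘs w a, hΘs w b, hs (Θ y b) (Θ' a w), hs (Θ y a) (Θ' b w)]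
  ring

theorem posDef_pullMetric (hpos : ∀ a, a ≠ 0 → 0 < G (θ y) a a)
    (hinj : Function.Injective (Θ y)) (a : E) (ha : a ≠ 0) : 0 < pullMetric G θ Θ y a a := by
  have : Θ y a ≠ 0 := fun h => ha (hinj (h.trans (map_zero _).symm))
  simpa [pullMetric] using hpos _ this

theorem fderiv_comp_apply (hv : DifferentiableAt ℝ v (θ y)) (hθ : HasFDerivAt θ (Θ y) y) (a : E) :
    fderiv ℝ (fun y => v (θ y)) y a = fderiv ℝ v (θ y) (Θ y a) := by
  have h : HasFDerivAt (fun y => v (θ y)) _ y := HasFDerivAt.comp y hv.hasFDerivAt hθ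
  rw [h.fderiv]; rfl

/-- The gradient is invariant under a change of coordinates. -/
theorem gradE_pullMetric [FiniteDimensional ℝ E] (hpos : ∀ a, a ≠ 0 → 0 < G (θ y) a a)
    (hv : DifferentiableAt ℝ v (θ y)) (hθ : HasFDerivAt θ (Θ y) y)
    (hinj : Function.Injective (Θ y)) :
    Θ y (gradE (pullMetric G θ Θ) (fun y => v (θ y)) y) = gradE G v (θ y) := by
  refine eq_of_posDef hpos ?_
  rw [apply_gradE hpos]
  have hsurj : Function.Surjective (Θ y) :=
    (LinearMap.injective_iff_surjective (f := (Θ y : E →ₗ[ℝ] E))).1 hinj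
  ext b
  obtain ⟨b, rfl⟩ := hsurj b
  have h := apply_gradE (G := pullMetric G θ Θ) (y := y) (posDef_pullMetric hpos hinj)
    (fun y => v (θ y))
  have h2 := congrArg (fun L : E →L[ℝ] ℝ => L b) h
  simp only [fderiv_comp_apply hv hθ] at h2
  rw [← h2]; simp [pullMetric]

theorem fderiv_gradE_pullMetric [FiniteDimensional ℝ E] (hpos : ∀ a, a ≠ 0 → 0 < G (θ y) a a)
    (hv : DifferentiableAt ℝ v (θ y)) (hθ : HasFDerivAt θ (Θ y) y)
    (hinj : Function.Injective (Θ y)) :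
    fderiv ℝ (fun y => v (θ y)) y (gradE (pullMetric G θ Θ) (fun y => v (θ y)) y) =
      fderiv ℝ v (θ y) (gradE G v (θ y)) := by
  rw [fderiv_comp_apply hv hθ, gradE_pullMetric hpos hv hθ hinj]

/-- The covariant Hessian is a tensor. -/
theorem hessE_pullMetric [FiniteDimensional ℝ E] (hG : DifferentiableAt ℝ G (θ y))
    (hs : ∀ a b, G (θ y) a b = G (θ y) b a) (hpos : ∀ a, a ≠ 0 → 0 < G (θ y) a a)
    (hθ : ∀ᶠ x in 𝓝 y, HasFDerivAt θ (Θ x) x) (hΘ : HasFDerivAt Θ Θ' y)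
    (hΘs : ∀ a b, Θ' a b = Θ' b a) (hinj : Function.Injective (Θ y))
    (hv : ContDiffAt ℝ 2 v (θ y)) (a b : E) :
    hessE (pullMetric G θ Θ) (fun y => v (θ y)) y a b =
      hessE G v (θ y) (Θ y a) (Θ y b) := by
  have hθy := hθ.self_of_nhds
  have hvd : ∀ᶠ x in 𝓝 (θ y), DifferentiableAt ℝ v x :=
    (hv.eventually (by simp)).mono fun x hx => hx.differentiableAt (by simp)
  have h1 : fderiv ℝ (fun y => v (θ y)) =ᶠ[𝓝 y] fun x => fderiv ℝ v (θ x) ∘L Θ x := by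
    filter_upwards [hθ, hθy.continuousAt.eventually hvd] with x hx hvx
    exact (HasFDerivAt.comp x hvx.hasFDerivAt hx).fderiv
  have h2 : HasFDerivAt (fun x => fderiv ℝ v (θ x)) (fderiv ℝ (fderiv ℝ v) (θ y) ∘L Θ y) y :=
    HasFDerivAt.comp y ((hv.fderiv_right (m := 1) le_rfl).differentiableAt one_ne_zero).hasFDerivAt
      hθy
  have h3 := (h2.clm_comp hΘ)
  have h4 := (h3.congr_of_eventuallyEq h1).fderiv
  rw [hessE, hessE, h4, chr_pullMetric hG hs hθy hΘ hΘs,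
    gradE_pullMetric hpos hvd.self_of_nhds hθy hinj, hs, apply_gradE hpos]
  simp
  ring

end pullback

end coordinates

/-! ### Normal coordinates -/

section normalCoordinates

set_option maxSynthPendingDepth 3

open scoped Topology

variable {E : Type*} [NormedAddCommGroup E] [NormedSpace ℝ E]

/-- Christoffel symbols of the first kind as a continuous trilinear map, as a function of the
derivative `D` of the metric. -/
noncomputable def chrL (D : E →L[ℝ] E →L[ℝ] E →L[ℝ] ℝ) : E →L[ℝ] E →L[ℝ] E →L[ℝ] ℝ :=
  (1 / 2 : ℝ) • (D + D.flip -
    (ContinuousLinearMap.flipₗᵢ ℝ E E ℝ).toContinuousLinearEquiv.toContinuousLinearMap ∘L D.flip)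

theorem chrL_apply (D : E →L[ℝ] E →L[ℝ] E →L[ℝ] ℝ) (a b w : E) :
    chrL D a b w = (D a b w + D b a w - D w a b) / 2 := by
  simp [chrL]; ring

/-- Christoffel symbols of the second kind of the metric `G` at `x`. -/
noncomputable def gammaL (G : E → E →L[ℝ] E →L[ℝ] ℝ) (x : E) : E →L[ℝ] E →L[ℝ] E :=
  ContinuousLinearMap.compL ℝ E (E →L[ℝ] ℝ) E (G x).inverse ∘L chrL (fderiv ℝ G x)

/-- Normal coordinates to second order at `x`: in the coordinates `y ↦ normalMap G x y` the metric
`G` has vanishing first derivatives at `y = 0`. -/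
noncomputable def normalMap (G : E → E →L[ℝ] E →L[ℝ] ℝ) (x y : E) : E :=
  x + y - (1 / 2 : ℝ) • gammaL G x y y

/-- The derivative of `normalMap G x`. -/
noncomputable def normalDeriv (G : E → E →L[ℝ] E →L[ℝ] ℝ) (x y : E) : E →L[ℝ] E :=
  ContinuousLinearMap.id ℝ E - gammaL G x y

/-- The metric `G` in the coordinates `normalMap G x`. -/
noncomputable def normalMetric (G : E → E →L[ℝ] E →L[ℝ] ℝ) (x y : E) : E →L[ℝ] E →L[ℝ] ℝ :=
  pullMetric G (normalMap G x) (normalDeriv G x) y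

variable {G : E → E →L[ℝ] E →L[ℝ] ℝ} {x : E}

theorem gammaL_apply (a b : E) : gammaL G x a b = (G x).inverse (chrL (fderiv ℝ G x) a b) := rfl

theorem normalMap_zero : normalMap G x 0 = x := by simp [normalMap]

theorem normalDeriv_zero : normalDeriv G x 0 = ContinuousLinearMap.id ℝ E := by simp [normalDeriv]

theorem normalMetric_zero : normalMetric G x 0 = G x := by
  ext a b; simp [normalMetric, pullMetric, normalMap_zero, normalDeriv_zero]

theorem apply_gammaL [FiniteDimensional ℝ E] (hpos : ∀ a, a ≠ 0 → 0 < G x a a) (a b w : E) :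
    G x (gammaL G x a b) w = chr G x a b w := by
  rw [gammaL_apply, apply_inverse_of_posDef hpos, chrL_apply, chr]

theorem gammaL_symm [FiniteDimensional ℝ E] (hG : DifferentiableAt ℝ G x)
    (hs : ∀ᶠ y in 𝓝 x, ∀ a b, G y a b = G y b a) (a b : E) :
    gammaL G x a b = gammaL G x b a := by
  rw [gammaL_apply, gammaL_apply]
  congr 1
  ext w
  rw [chrL_apply, chrL_apply, fderiv_symm_apply hG hs w a b]
  ring

theorem hasFDerivAt_normalMap (hsymm : ∀ a b, gammaL G x a b = gammaL G x b a) (y : E) :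
    HasFDerivAt (normalMap G x) (normalDeriv G x y) y := by
  have h1 : HasFDerivAt (fun y => gammaL G x y y) _ y :=
    (gammaL G x).hasFDerivAt.clm_apply (hasFDerivAt_id y)
  have h2 := ((hasFDerivAt_id y).const_add x).sub (h1.const_smul (1 / 2 : ℝ))
  refine h2.congr_fderiv ?_
  ext a
  simp [normalDeriv, hsymm a y]
  rw [← two_smul ℝ, smul_smul]; norm_num

theorem hasFDerivAt_normalDeriv (y : E) :
    HasFDerivAt (normalDeriv G x) (-gammaL G x) y :=
  ((gammaL G x).hasFDerivAt.const_sub _)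

/-- The defining property of normal coordinates. -/
theorem fderiv_normalMetric_zero [FiniteDimensional ℝ E] (hG : DifferentiableAt ℝ G x)
    (hs : ∀ᶠ y in 𝓝 x, ∀ a b, G y a b = G y b a)
    (hpos : ∀ a, a ≠ 0 → 0 < G x a a) : fderiv ℝ (normalMetric G x) 0 = 0 := by
  ext c a b
  have h := fderiv_pullMetric_apply (G := G) (θ := normalMap G x) (Θ := normalDeriv G x)
    (Θ' := -gammaL G x) (y := 0) (by rwa [normalMap_zero])
    (hasFDerivAt_normalMap (gammaL_symm hG hs) 0) (hasFDerivAt_normalDeriv 0) c a b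
  change fderiv ℝ (pullMetric G (normalMap G x) (normalDeriv G x)) 0 c a b = 0
  rw [h, normalMap_zero, normalDeriv_zero]
  have hs' := hs.self_of_nhds
  simp only [neg_apply, map_neg, ContinuousLinearMap.id_apply, apply_gammaL hpos, hs' a]
  simp only [chr, fderiv_symm_apply hG hs c b a]
  ring

theorem contDiffAt_chrL {X : Type*} [NormedAddCommGroup X] [NormedSpace ℝ X] {n : WithTop ℕ∞}
    {D : X → E →L[ℝ] E →L[ℝ] E →L[ℝ] ℝ} {x : X} (hD : ContDiffAt ℝ n D x) :
    ContDiffAt ℝ n (fun y => chrL (D y)) x := by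
  have h1 : ContDiffAt ℝ n (fun y => (D y).flip) x := contDiffAt_flip (V := E →L[ℝ] ℝ) hD
  have h2 : ContDiffAt ℝ n (fun y => (ContinuousLinearMap.flipₗᵢ ℝ E E
      ℝ).toContinuousLinearEquiv.toContinuousLinearMap ∘L (D y).flip) x :=
    contDiffAt_const.clm_comp h1
  have h3 : ContDiffAt ℝ n (fun y => D y + (D y).flip) x := hD.add h1
  exact (h3.sub h2).const_smul (1 / 2 : ℝ)

theorem contDiffAt_gammaL [FiniteDimensional ℝ E] (hG : ContDiffAt ℝ ∞ G x)
    (hpos : ∀ a, a ≠ 0 → 0 < G x a a) : ContDiffAt ℝ ∞ (gammaL G) x := by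
  have h1 : ContDiffAt ℝ ∞ (fun y => (G y).inverse) x :=
    (isInvertible_of_posDef hpos).contDiffAt_map_inverse.comp x hG
  have h2 : ContDiffAt ℝ ∞ (fderiv ℝ G) x := hG.fderiv_right (m := ∞) (by simp)
  exact (ContDiffAt.continuousLinearMap_comp
    (ContinuousLinearMap.compL ℝ E (E →L[ℝ] ℝ) E) h1).clm_comp (contDiffAt_chrL h2)

theorem contDiffAt_normalMetric [FiniteDimensional ℝ E] (hG : ContDiffAt ℝ ∞ G x)
    (hpos : ∀ a, a ≠ 0 → 0 < G x a a) :
    ContDiffAt ℝ ∞ (fun q : E × E => normalMetric G q.1 q.2) (x, 0) := by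
  have h1 : ContDiffAt ℝ ∞ (fun q : E × E => gammaL G q.1) (x, 0) :=
    (contDiffAt_gammaL hG hpos).comp (x, (0 : E)) contDiffAt_fst
  have h2 : ContDiffAt ℝ ∞ (fun q : E × E => gammaL G q.1 q.2) (x, 0) :=
    h1.clm_apply contDiffAt_snd
  have h3 : ContDiffAt ℝ ∞ (fun q : E × E => normalDeriv G q.1 q.2) (x, 0) :=
    contDiffAt_const.sub h2
  have h4 : ContDiffAt ℝ ∞ (fun q : E × E => normalMap G q.1 q.2) (x, 0) :=
    (contDiffAt_fst.add contDiffAt_snd).sub ((h2.clm_apply contDiffAt_snd).const_smul _)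
  have h5 : ContDiffAt ℝ ∞ (fun q : E × E => G (normalMap G q.1 q.2)) (x, 0) :=
    ContDiffAt.comp (x, (0 : E)) (by rwa [normalMap_zero]) h4
  have h6 := contDiffAt_flip ((contDiffAt_flip (h5.clm_comp h3)).clm_comp h3)
  exact h6

/-- The second derivatives in the second variable are bounded locally uniformly in the first. -/
theorem exists_bound_fderiv_snd {V : Type*} [NormedAddCommGroup V] [NormedSpace ℝ V]
    {F : E × E → V} (h0 : ContDiffAt ℝ ∞ F (x, 0)) :
    ∃ C, 0 ≤ C ∧ ∀ᶠ y in 𝓝 x, ContDiffAt ℝ 2 (fun z => F (y, z)) 0 ∧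
      ∀ a b, ‖fderiv ℝ (fderiv ℝ (fun z => F (y, z))) 0 a b‖ ≤ C * ‖a‖ * ‖b‖ := by
  have h0' : ContDiffAt ℝ 2 F (x, 0) := contDiffAt_infty.1 h0 2
  have h2 : ContinuousAt (fderiv ℝ (fderiv ℝ F)) (x, 0) :=
    ((h0.fderiv_right (m := ∞) (by simp)).fderiv_right (m := 0) (by simp)).continuousAt
  have hc : ContinuousAt (fun y : E => (y, (0 : E))) x := by fun_prop
  have h3 : ∀ᶠ y in 𝓝 x, ‖fderiv ℝ (fderiv ℝ F) (y, 0)‖ < ‖fderiv ℝ (fderiv ℝ F) (x, 0)‖ + 1 :=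
    (h2.norm.comp (f := fun y : E => (y, (0 : E))) hc).eventually_lt continuousAt_const
      (by simp)
  have h4 : ∀ᶠ y in 𝓝 x, ContDiffAt ℝ 2 F (y, 0) := hc.eventually (h0'.eventually (by simp))
  refine ⟨‖fderiv ℝ (fderiv ℝ F) (x, 0)‖ + 1, by positivity, ?_⟩
  filter_upwards [h3, h4] with y h3 h4
  have hι : ∀ z : E, HasFDerivAt (fun z : E => (y, z)) (ContinuousLinearMap.inr ℝ E E) z :=
    fun z => hasFDerivAt_prodMk_right y z
  refine ⟨h4.comp (0 : E) (contDiffAt_const.prodMk contDiffAt_id), fun a b => ?_⟩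
  have h6 : ∀ᶠ z in 𝓝 (0 : E), ContDiffAt ℝ 2 F (y, z) :=
    (hι 0).continuousAt.eventually (h4.eventually (by simp))
  have h7 : fderiv ℝ (fun z => F (y, z)) =ᶠ[𝓝 0]
      fun z => fderiv ℝ F (y, z) ∘L ContinuousLinearMap.inr ℝ E E := by
    filter_upwards [h6] with z hz
    exact ((hz.differentiableAt (by simp)).hasFDerivAt.comp z (hι z)).fderiv
  have h8 : HasFDerivAt (fun z => fderiv ℝ F (y, z)) _ 0 :=
    ((h4.fderiv_right (m := 1) le_rfl).differentiableAt one_ne_zero).hasFDerivAt.comp 0 (hι 0)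
  have h9 := (h8.clm_comp (hasFDerivAt_const (ContinuousLinearMap.inr ℝ E E) _))
  have h10 := (h9.congr_of_eventuallyEq h7).fderiv
  have h11 : fderiv ℝ (fderiv ℝ (fun z => F (y, z))) 0 a b =
      fderiv ℝ (fderiv ℝ F) (y, 0) (0, a) (0, b) := by
    rw [h10]; simp
  rw [h11]
  refine (ContinuousLinearMap.le_opNorm₂ _ _ _).trans ?_
  rw [Prod.norm_mk, Prod.norm_mk]
  simp only [norm_zero, norm_nonneg, sup_of_le_right]
  gcongr

theorem norm_le_of_posDef [FiniteDimensional ℝ E] {g : E →L[ℝ] E →L[ℝ] ℝ}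
    (hs : ∀ a b, g a b = g b a) (hg : ∀ a, a ≠ 0 → 0 < g a a) {a : E} (ha : g a a = 1) :
    ‖a‖ ≤ ‖g.inverse‖ * (‖g‖ + 1) := by
  have h1 : ‖g a‖ ≤ ‖g‖ + 1 := by
    refine ContinuousLinearMap.opNorm_le_bound _ (by positivity) fun b => ?_
    have h2 := sq_apply_le_of_posDef hs hg a b
    rw [ha, one_mul] at h2
    have h3 : g b b ≤ ‖g‖ * ‖b‖ * ‖b‖ := (le_abs_self _).trans (g.le_opNorm₂ b b)
    rw [Real.norm_eq_abs]
    refine abs_le_of_sq_le_sq ?_ (by positivity)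
    nlinarith [mul_nonneg (norm_nonneg g) (sq_nonneg ‖b‖), sq_nonneg (‖g‖ * ‖b‖), sq_nonneg ‖b‖]
  have h2 : g.inverse (g a) = a := by
    obtain ⟨e, rfl⟩ := isInvertible_of_posDef hg
    simp
  calc ‖a‖ = ‖g.inverse (g a)‖ := by rw [h2]
    _ ≤ ‖g.inverse‖ * ‖g a‖ := g.inverse.le_opNorm _
    _ ≤ _ := by gcongr

/-- Unit vectors of a continuous metric are locally uniformly bounded. -/
theorem exists_bound_norm_of_unit [FiniteDimensional ℝ E] (hG : ContinuousAt G x)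
    (hs : ∀ᶠ y in 𝓝 x, ∀ a b, G y a b = G y b a)
    (hpos : ∀ᶠ y in 𝓝 x, ∀ a, a ≠ 0 → 0 < G y a a) :
    ∃ C, 0 ≤ C ∧ ∀ᶠ y in 𝓝 x, ∀ a, G y a a = 1 → ‖a‖ ≤ C := by
  have h1 : ContinuousAt (fun y => (G y).inverse) x :=
    ((isInvertible_of_posDef hpos.self_of_nhds).contDiffAt_map_inverse (n := 0)).continuousAt.comp
      (f := G) hG
  have h2 : ContinuousAt (fun y => ‖(G y).inverse‖ * (‖G y‖ + 1)) x :=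
    h1.norm.mul (hG.norm.add continuousAt_const)
  refine ⟨‖(G x).inverse‖ * (‖G x‖ + 1) + 1, by positivity, ?_⟩
  filter_upwards [h2.eventually_lt continuousAt_const (lt_add_one _), hs, hpos] with y h3 hs hp a ha
  exact (norm_le_of_posDef hs hp ha).trans h3.le

end normalCoordinates

/-! ### Frames and the second derivative test -/

section frames

open scoped Topology

/-- A symmetric operator has an orthonormal basis of eigenvectors starting with a given unit
eigenvector. -/
theorem exists_orthonormalBasis_eigen {V : Type*} [NormedAddCommGroup V] [InnerProductSpace ℝ V]
    [FiniteDimensional ℝ V] {m : ℕ} (hdim : Module.finrank ℝ V = m + 1) {T : V →ₗ[ℝ] V}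
    (hT : T.IsSymmetric) {e : V} (he : ‖e‖ = 1) {μ : ℝ} (hμ : T e = μ • e) :
    ∃ f : OrthonormalBasis (Fin (m + 1)) ℝ V, f 0 = e ∧
      ∀ i j, i ≠ j → inner ℝ (T (f i)) (f j) = 0 := by
  set K : Submodule ℝ V := (ℝ ∙ e)ᗮ with hK
  have he0 : e ≠ 0 := by rintro rfl; simp at he
  have hKinv : ∀ x ∈ K, T x ∈ K := by
    intro x hx
    rw [hK, Submodule.mem_orthogonal_singleton_iff_inner_right] at hx ⊢
    rw [← hT, hμ, inner_smul_left, hx, mul_zero]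
  have hKdim : Module.finrank ℝ K = m := by
    have : Fact (Module.finrank ℝ V = m + 1) := ⟨hdim⟩
    exact Submodule.finrank_orthogonal_span_singleton he0
  have hTK : (T.restrict hKinv).IsSymmetric := hT.restrict_invariant hKinv
  let b := hTK.eigenvectorBasis hKdim
  have hbe : ∀ i, inner ℝ e (b i : V) = 0 := fun i =>
    Submodule.mem_orthogonal_singleton_iff_inner_right.1 (b i).2
  have hbb : ∀ i j, inner ℝ (b i : V) (b j : V) = if i = j then (1 : ℝ) else 0 := fun i j => by
    have := orthonormal_iff_ite.1 b.orthonormal i j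
    simpa using this
  let f : Fin (m + 1) → V := Fin.cons e fun i => (b i : V)
  have hf : Orthonormal ℝ f := by
    rw [orthonormal_iff_ite]
    intro i j
    refine Fin.cases ?_ (fun i => ?_) i <;> refine Fin.cases ?_ (fun j => ?_) j
    · simp [f, he]
    · simp [f, hbe, (Fin.succ_ne_zero j).symm]
    · simp [f, real_inner_comm, hbe, Fin.succ_ne_zero i]
    · simp [f, hbb]
  have hspan : ⊤ ≤ Submodule.span ℝ (range f) :=
    (hf.linearIndependent.span_eq_top_of_card_eq_finrank (by simp [hdim])).ge
  refine ⟨OrthonormalBasis.mk hf hspan, by simp [f], fun i j hij => ?_⟩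
  rw [OrthonormalBasis.coe_mk]
  revert hij
  refine Fin.cases ?_ (fun i => ?_) i <;> refine Fin.cases ?_ (fun j => ?_) j <;> intro hij
  · exact absurd rfl hij
  · simp [f, hμ, inner_smul_left, hbe]
  · simp only [f, Fin.cons_succ, Fin.cons_zero]
    rw [hT, hμ, inner_smul_right, real_inner_comm, hbe, mul_zero]
  · simp only [f, Fin.cons_succ]
    have h1 := congrArg Subtype.val (hTK.apply_eigenvectorBasis hKdim i)
    have h2 : T (b i : V) = ((hTK.eigenvalues hKdim i : ℝ) • (b i : V)) := h1
    rw [h2, inner_smul_left, hbb, if_neg fun h => hij (by rw [h]), mul_zero]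

/-- Simultaneous diagonalization of a positive definite form `g` and a symmetric form `S`, in a
basis that starts with a given `g`-unit vector `e` satisfying `S e = μ g e`. -/
theorem exists_frame {E : Type*} [NormedAddCommGroup E] [NormedSpace ℝ E] [FiniteDimensional ℝ E]
    {m : ℕ} (hdim : Module.finrank ℝ E = m + 1) {g S : E →L[ℝ] E →L[ℝ] ℝ}
    (hs : ∀ a b, g a b = g b a) (hg : ∀ a, a ≠ 0 → 0 < g a a) (hS : ∀ a b, S a b = S b a)
    {e : E} (he : g e e = 1) {μ : ℝ} (hμ : S e = μ • g e) :
    ∃ f : Module.Basis (Fin (m + 1)) ℝ E, f 0 = e ∧ (∀ i j, g (f i) (f j) = if i = j then 1 else 0) ∧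
      ∀ i j, i ≠ j → S (f i) (f j) = 0 := by
  -- a copy of `E` on which `g` is taken as the inner product
  have main : ∀ {V : Type _} [AddCommGroup V] [Module ℝ V] [FiniteDimensional ℝ V]
      (hdim : Module.finrank ℝ V = m + 1) (g S : V →ₗ[ℝ] V →ₗ[ℝ] ℝ) (T : V →ₗ[ℝ] V)
      (hs : ∀ a b, g a b = g b a) (hg : ∀ a, a ≠ 0 → 0 < g a a) (hS : ∀ a b, S a b = S b a)
      (hT : ∀ a b, g (T a) b = S a b)
      {e : V} (he : g e e = 1) {μ : ℝ} (hμ : T e = μ • e),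
      ∃ f : Module.Basis (Fin (m + 1)) ℝ V, f 0 = e ∧
        (∀ i j, g (f i) (f j) = if i = j then 1 else 0) ∧ ∀ i j, i ≠ j → S (f i) (f j) = 0 := by
    intro V _ _ _ hdim g S T hs hg hS hT e he μ hμ
    let core : InnerProductSpace.Core ℝ V :=
      { inner := fun a b => g a b
        conj_inner_symm := fun a b => by simp [hs a b]
        re_inner_nonneg := fun a => by
          rcases eq_or_ne a 0 with rfl | h
          · simp
          · simpa using (hg a h).le
        add_left := fun a b c => by simp
        smul_left := fun a b r => by simp
        definite := fun a h => by
          by_contra h0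
          exact (hg a h0).ne' h }
    let _ : NormedAddCommGroup V := core.toNormedAddCommGroup
    let _ : InnerProductSpace ℝ V := InnerProductSpace.ofCore core.toCore
    have hin : ∀ a b : V, inner ℝ a b = g a b := fun a b => rfl
    have hTs : T.IsSymmetric := fun a b => by
      rw [hin, hin, hT, hs, hT, hS]
    have hne : ‖e‖ = 1 := by
      rw [norm_eq_sqrt_real_inner, hin, he, Real.sqrt_one]
    obtain ⟨f, hf0, hf1⟩ := exists_orthonormalBasis_eigen hdim hTs hne hμ
    refine ⟨f.toBasis, by simp [hf0], fun i j => ?_, fun i j hij => ?_⟩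
    · have := orthonormal_iff_ite.1 f.orthonormal i j
      rw [hin] at this
      simpa using this
    · have := hf1 i j hij
      rw [hin, hT] at this
      simpa using this
  obtain ⟨f, h0, h1, h2⟩ := main hdim (g.toBilinForm) (S.toBilinForm)
    ((g.inverse ∘L S : E →L[ℝ] E) : E →ₗ[ℝ] E) hs hg hS
    (fun a b => by
      have := apply_inverse_of_posDef hg (S a)
      exact congrArg (fun L : E →L[ℝ] ℝ => L b) this) he (μ := μ) (by
      refine eq_of_posDef hg ?_
      have := apply_inverse_of_posDef hg (S e)
      refine this.trans ?_
      rw [hμ, map_smul])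
  exact ⟨f, h0, h1, h2⟩

end frames

section secondDerivativeTest

open scoped Topology

theorem second_deriv_nonpos_of_isLocalMax {f f1 : ℝ → ℝ} {f2 : ℝ}
    (h1 : ∀ᶠ s in 𝓝 0, HasDerivAt f (f1 s) s) (h2 : HasDerivAt f1 f2 0) (hmax : IsLocalMax f 0) :
    f2 ≤ 0 := by
  by_contra hpos
  push Not at hpos
  have hd : deriv f =ᶠ[𝓝 0] f1 := h1.mono fun s hs => hs.deriv
  have h3 : deriv (deriv f) 0 = f2 := (h2.congr_of_eventuallyEq hd).deriv
  have h4 : deriv f 0 = 0 := hmax.deriv_eq_zero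
  have hmin := isLocalMin_of_deriv_deriv_pos (by rwa [h3]) h4 h1.self_of_nhds.continuousAt
  have hconst : f =ᶠ[𝓝 0] fun _ => f 0 := by
    filter_upwards [hmax, hmin] with s hs1 hs2
    exact le_antisymm hs1 hs2
  have h5 : deriv f =ᶠ[𝓝 0] fun _ => 0 := by
    filter_upwards [hconst.eventuallyEq_nhds] with s hs
    rw [hs.deriv_eq]; simp
  rw [h5.deriv_eq] at h3
  simp at h3
  exact hpos.ne h3

/-- First and second derivative test for `log (1 + x² / r) / 2 - N y` at a maximum where `r = 1` and
`r' = 0`. -/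
theorem log_one_add_sq_div_max {x x1 r r1 y y1 : ℝ → ℝ} {x2 r2 y2 N : ℝ}
    (hx : ∀ᶠ s in 𝓝 0, HasDerivAt x (x1 s) s) (hx1 : HasDerivAt x1 x2 0)
    (hr : ∀ᶠ s in 𝓝 0, HasDerivAt r (r1 s) s) (hr1 : HasDerivAt r1 r2 0)
    (hy : ∀ᶠ s in 𝓝 0, HasDerivAt y (y1 s) s) (hy1 : HasDerivAt y1 y2 0)
    (hr0 : r 0 = 1) (hr10 : r1 0 = 0)
    (hmax : IsLocalMax (fun s => Real.log (1 + x s ^ 2 / r s) / 2 - N * y s) 0) :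
    x 0 * x1 0 / (1 + x 0 ^ 2) - N * y1 0 = 0 ∧
    (x 0 * x2 + x1 0 ^ 2 - x 0 ^ 2 * r2 / 2) / (1 + x 0 ^ 2)
      - 2 * (x 0 * x1 0 / (1 + x 0 ^ 2)) ^ 2 - N * y2 ≤ 0 := by
  have hx0 := hx.self_of_nhds
  have hy0 := hy.self_of_nhds
  have hr00 := hr.self_of_nhds
  have hrpos : ∀ᶠ s in 𝓝 0, 0 < r s :=
    hr00.continuousAt.eventually_const_lt (by rw [hr0]; exact one_pos)
  set q1 : ℝ → ℝ := fun s => ((2 * x s * x1 s * r s - x s ^ 2 * r1 s) / r s ^ 2) /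
    (1 + x s ^ 2 / r s) / 2 - N * y1 s with hq1
  have hu : ∀ᶠ s in 𝓝 0, HasDerivAt (fun s => 1 + x s ^ 2 / r s)
      ((2 * x s * x1 s * r s - x s ^ 2 * r1 s) / r s ^ 2) s := by
    filter_upwards [hx, hr, hrpos] with s hx hr hp
    have h := ((hx.fun_pow 2).fun_div hr hp.ne').const_add 1
    simpa using h
  have hupos : ∀ᶠ s in 𝓝 0, 0 < 1 + x s ^ 2 / r s := by
    filter_upwards [hrpos] with s hp; positivity
  have hq : ∀ᶠ s in 𝓝 0,
      HasDerivAt (fun s => Real.log (1 + x s ^ 2 / r s) / 2 - N * y s) (q1 s) s := by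
    filter_upwards [hu, hupos, hy] with s hu hp hy
    exact ((hu.log hp.ne').div_const 2).sub (hy.const_mul N)
  have hW : (1 + x 0 ^ 2) ≠ 0 := by positivity
  have hq10 : q1 0 = x 0 * x1 0 / (1 + x 0 ^ 2) - N * y1 0 := by
    simp only [hq1, hr0, hr10]; field_simp; ring
  have hnum : HasDerivAt (fun s => 2 * x s * x1 s * r s - x s ^ 2 * r1 s)
      (2 * x1 0 ^ 2 + 2 * x 0 * x2 - x 0 ^ 2 * r2) 0 := by
    refine (((((hx0.const_mul 2).mul hx1).mul hr00).sub ((hx0.fun_pow 2).mul hr1))).congr_deriv ?_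
    simp only [hr0, hr10]; simp; ring
  have hu1 : HasDerivAt (fun s => (2 * x s * x1 s * r s - x s ^ 2 * r1 s) / r s ^ 2)
      (2 * x1 0 ^ 2 + 2 * x 0 * x2 - x 0 ^ 2 * r2) 0 := by
    refine (hnum.fun_div (hr00.fun_pow 2) (by rw [hr0]; norm_num)).congr_deriv ?_
    simp only [hr0, hr10]; simp
  have hq2 : HasDerivAt q1 ((x 0 * x2 + x1 0 ^ 2 - x 0 ^ 2 * r2 / 2) / (1 + x 0 ^ 2)
      - 2 * (x 0 * x1 0 / (1 + x 0 ^ 2)) ^ 2 - N * y2) 0 := by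
    refine (((hu1.fun_div hu.self_of_nhds hupos.self_of_nhds.ne').div_const 2).sub
      (hy1.const_mul N)).congr_deriv ?_
    simp only [hr0, hr10]; field_simp; ring
  refine ⟨?_, second_deriv_nonpos_of_isLocalMax hq hq2 hmax⟩
  rw [← hq10, ← hq.self_of_nhds.deriv]
  exact hmax.deriv_eq_zero

end secondDerivativeTest

/-! ### The maximum point: derivatives along lines -/

section localMax

set_option maxSynthPendingDepth 3

open scoped Topology

variable {E : Type*} [NormedAddCommGroup E] [NormedSpace ℝ E]

/-- The metric `G + dv ⊗ dv` of the graph of `v` in the product `ℝ × E`, in the frame `f`. -/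
noncomputable def gramMat {ι : Type*} (G : E → E →L[ℝ] E →L[ℝ] ℝ) (v : E → ℝ) (f : ι → E) (y : E) :
    Matrix ι ι ℝ :=
  fun i j => G y (f i) (f j) + fderiv ℝ v y (f i) * fderiv ℝ v y (f j)

/-- The matrix of `η (G + dv ⊗ dv) - Hess v` in the frame `f`. Up to a factor, this is the second
fundamental form of the graph in the warped product when `η` is the derivative of the warping
function. -/
noncomputable def shapeMat {ι : Type*} (G : E → E →L[ℝ] E →L[ℝ] ℝ) (v η : E → ℝ) (f : ι → E)
    (y : E) : Matrix ι ι ℝ :=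
  fun i j => η y * gramMat G v f y i j - hessE G v y (f i) (f j)

theorem hasDerivAt_line {V : Type*} [NormedAddCommGroup V] [NormedSpace ℝ V] {f : E → V} {ξ : E}
    {s : ℝ} (hf : DifferentiableAt ℝ f (s • ξ)) :
    HasDerivAt (fun s : ℝ => f (s • ξ)) (fderiv ℝ f (s • ξ) ξ) s := by
  have h1 : HasDerivAt (fun s : ℝ => s • ξ) ξ s := by
    simpa using (hasDerivAt_id s).smul_const ξ
  exact hf.hasFDerivAt.comp_hasDerivAt s h1

theorem hasDerivAt_line_zero {V : Type*} [NormedAddCommGroup V] [NormedSpace ℝ V] {f : E → V}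
    {ξ : E} (hf : DifferentiableAt ℝ f 0) :
    HasDerivAt (fun s : ℝ => f (s • ξ)) (fderiv ℝ f 0 ξ) 0 := by
  have := hasDerivAt_line (ξ := ξ) (s := 0) (f := f) (by rwa [zero_smul])
  rwa [zero_smul] at this

theorem tendsto_line (ξ : E) : Filter.Tendsto (fun s : ℝ => s • ξ) (𝓝 0) (𝓝 (0 : E)) := by
  have : ContinuousAt (fun s : ℝ => s • ξ) 0 := by fun_prop
  simpa [ContinuousAt] using this

theorem fderiv_fderiv_symm {V : Type*} [NormedAddCommGroup V] [NormedSpace ℝ V] {f : E → V} {y : E}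
    (hf : ContDiffAt ℝ 2 f y) (a b : E) :
    fderiv ℝ (fderiv ℝ f) y a b = fderiv ℝ (fderiv ℝ f) y b a :=
  (hf.isSymmSndFDerivAt (by simp)).eq a b

theorem fderiv_fderiv_fderiv_rotate {v : E → ℝ} {y : E} (hv : ContDiffAt ℝ 3 v y) (a b : E) :
    fderiv ℝ (fderiv ℝ (fderiv ℝ v)) y a b b = fderiv ℝ (fderiv ℝ (fderiv ℝ v)) y b b a := by
  have h1 : ContDiffAt ℝ 2 (fderiv ℝ v) y := hv.fderiv_right (m := 2) (by norm_num)
  rw [fderiv_fderiv_symm h1 a b]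
  have h2 : ∀ᶠ x in 𝓝 y, ∀ a b, fderiv ℝ (fderiv ℝ v) x a b = fderiv ℝ (fderiv ℝ v) x b a := by
    filter_upwards [hv.eventually (by simp)] with x hx a b
    exact fderiv_fderiv_symm (hx.of_le (by norm_num)) a b
  exact fderiv_symm_apply ((h1.fderiv_right (m := 1) le_rfl).differentiableAt one_ne_zero) h2 b a b

variable [FiniteDimensional ℝ E]

/-- The derivative of the gradient at a point where the metric is stationary. -/
theorem hasDerivAt_gradE_line {G : E → E →L[ℝ] E →L[ℝ] ℝ} {v : E → ℝ}
    (hG : ContDiffAt ℝ 2 G 0) (hGp : ∀ᶠ y in 𝓝 0, ∀ a, a ≠ 0 → 0 < G y a a)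
    (hG1 : fderiv ℝ G 0 = 0) (hv : ContDiffAt ℝ 3 v 0) {e : E} {μ : ℝ}
    (he : fderiv ℝ (fderiv ℝ v) 0 e = μ • G 0 e) :
    HasDerivAt (fun s : ℝ => gradE G v (s • e)) (μ • e) 0 := by
  have h1 : ContDiffAt ℝ 2 (fderiv ℝ v) 0 := hv.fderiv_right (m := 2) (by norm_num)
  have h2 : DifferentiableAt ℝ (gradE G v) 0 :=
    (contDiffAt_gradE hG hGp.self_of_nhds h1).differentiableAt (by simp)
  have h3 := hasDerivAt_line_zero (ξ := e) h2
  have h4 := hasDerivAt_line_zero (ξ := e) (hG.differentiableAt (by simp))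
  have h5 := hasDerivAt_line_zero (ξ := e) (h1.differentiableAt (by simp))
  have h6 := h4.clm_apply h3
  have h7 : (fun s : ℝ => G (s • e) (gradE G v (s • e))) =ᶠ[𝓝 0] fun s => fderiv ℝ v (s • e) := by
    filter_upwards [(tendsto_line e).eventually hGp] with s hs
    exact apply_gradE hs v
  have h8 := (h6.congr_of_eventuallyEq h7.symm).unique h5
  rw [hG1, he] at h8
  simp only [zero_apply, zero_add, zero_smul] at h8
  have h9 : fderiv ℝ (gradE G v) 0 e = μ • e := by
    refine eq_of_posDef hGp.self_of_nhds ?_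
    rw [h8, map_smul]
  rwa [h9] at h3

/-- Consequences of the maximality of `log ω - N v`, `ω² = 1 + |∇v|²`, along the line in
direction `ξ`. Comparing `|∇v|` with the derivative of `v` along the constant field `e` avoids
derivatives of the inverse metric. -/
theorem line_max {G : E → E →L[ℝ] E →L[ℝ] ℝ} {v : E → ℝ} {N p : ℝ}
    (hG : ContDiffAt ℝ 2 G 0) (hGs : ∀ᶠ y in 𝓝 0, ∀ a b, G y a b = G y b a)
    (hGp : ∀ᶠ y in 𝓝 0, ∀ a, a ≠ 0 → 0 < G y a a)
    (hG1 : fderiv ℝ G 0 = 0) (hv : ContDiffAt ℝ 3 v 0)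
    (hmax : IsLocalMax (fun y => Real.log (1 + fderiv ℝ v y (gradE G v y)) / 2 - N * v y) 0)
    {e : E} (he : G 0 e e = 1) (hgrad : gradE G v 0 = p • e) (ξ : E) :
    p * fderiv ℝ (fderiv ℝ v) 0 ξ e / (1 + p ^ 2) - N * fderiv ℝ v 0 ξ = 0 ∧
    (p * fderiv ℝ (fderiv ℝ (fderiv ℝ v)) 0 ξ ξ e + fderiv ℝ (fderiv ℝ v) 0 ξ e ^ 2
      - p ^ 2 * fderiv ℝ (fderiv ℝ G) 0 ξ ξ e e / 2) / (1 + p ^ 2)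
      - 2 * (p * fderiv ℝ (fderiv ℝ v) 0 ξ e / (1 + p ^ 2)) ^ 2
      - N * fderiv ℝ (fderiv ℝ v) 0 ξ ξ ≤ 0 := by
  have hp0 := hGp.self_of_nhds
  have hdv : fderiv ℝ v 0 = p • G 0 e := by rw [← apply_gradE hp0 v, hgrad, map_smul]
  have hdve : fderiv ℝ v 0 e = p := by rw [hdv]; simp [he]
  have hvn : ∀ᶠ y in 𝓝 (0 : E), ContDiffAt ℝ 3 v y := hv.eventually (by simp)
  have hGn : ∀ᶠ y in 𝓝 (0 : E), ContDiffAt ℝ 2 G y := hG.eventually (by simp)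
  have hl := tendsto_line ξ
  have h1 : ContDiffAt ℝ 2 (fderiv ℝ v) 0 := hv.fderiv_right (m := 2) (by norm_num)
  have h2 : ContDiffAt ℝ 1 (fderiv ℝ (fderiv ℝ v)) 0 := h1.fderiv_right (m := 1) le_rfl
  have h3 : ContDiffAt ℝ 1 (fderiv ℝ G) 0 := hG.fderiv_right (m := 1) le_rfl
  have hx : ∀ᶠ s in 𝓝 (0 : ℝ), HasDerivAt (fun s : ℝ => fderiv ℝ v (s • ξ) e)
      (fderiv ℝ (fderiv ℝ v) (s • ξ) ξ e) s := by
    filter_upwards [hl.eventually hvn] with s hs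
    have hs1 : ContDiffAt ℝ 2 (fderiv ℝ v) (s • ξ) := hs.fderiv_right (m := 2) (by norm_num)
    simpa using (hasDerivAt_line (hs1.differentiableAt (by simp))).clm_apply (hasDerivAt_const s e)
  have hx1 : HasDerivAt (fun s : ℝ => fderiv ℝ (fderiv ℝ v) (s • ξ) ξ e)
      (fderiv ℝ (fderiv ℝ (fderiv ℝ v)) 0 ξ ξ e) 0 := by
    simpa using ((hasDerivAt_line_zero (ξ := ξ) (h2.differentiableAt (by simp))).clm_apply
      (hasDerivAt_const _ ξ)).clm_apply (hasDerivAt_const _ e)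
  have hr : ∀ᶠ s in 𝓝 (0 : ℝ), HasDerivAt (fun s : ℝ => G (s • ξ) e e)
      (fderiv ℝ G (s • ξ) ξ e e) s := by
    filter_upwards [hl.eventually hGn] with s hs
    simpa using ((hasDerivAt_line (hs.differentiableAt (by simp))).clm_apply
      (hasDerivAt_const s e)).clm_apply (hasDerivAt_const s e)
  have hr1 : HasDerivAt (fun s : ℝ => fderiv ℝ G (s • ξ) ξ e e)
      (fderiv ℝ (fderiv ℝ G) 0 ξ ξ e e) 0 := by
    simpa using (((hasDerivAt_line_zero (ξ := ξ) (h3.differentiableAt (by simp))).clm_apply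
      (hasDerivAt_const _ ξ)).clm_apply (hasDerivAt_const _ e)).clm_apply (hasDerivAt_const _ e)
  have hy : ∀ᶠ s in 𝓝 (0 : ℝ), HasDerivAt (fun s : ℝ => v (s • ξ)) (fderiv ℝ v (s • ξ) ξ) s := by
    filter_upwards [hl.eventually hvn] with s hs
    exact hasDerivAt_line (hs.differentiableAt (by simp))
  have hy1 : HasDerivAt (fun s : ℝ => fderiv ℝ v (s • ξ) ξ) (fderiv ℝ (fderiv ℝ v) 0 ξ ξ) 0 := by
    simpa using (hasDerivAt_line_zero (ξ := ξ) (h1.differentiableAt (by simp))).clm_apply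
      (hasDerivAt_const _ ξ)
  have hm : IsLocalMax (fun s : ℝ => Real.log (1 + fderiv ℝ v (s • ξ) e ^ 2 / G (s • ξ) e e) / 2
      - N * v (s • ξ)) 0 := by
    have he0 : e ≠ 0 := by rintro rfl; simp at he
    filter_upwards [hl.eventually hmax, hl.eventually hGs, hl.eventually hGp] with s hs hss hsp
    have h4 := apply_gradE hsp v
    have h5 := sq_apply_le_of_posDef hss hsp (gradE G v (s • ξ)) e
    have h6 := hsp e he0
    rw [h4] at h5
    have h7 : fderiv ℝ v (s • ξ) e ^ 2 / G (s • ξ) e e ≤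
        fderiv ℝ v (s • ξ) (gradE G v (s • ξ)) := (div_le_iff₀ h6).2 h5
    have h8 : Real.log (1 + fderiv ℝ v (s • ξ) e ^ 2 / G (s • ξ) e e) ≤
        Real.log (1 + fderiv ℝ v (s • ξ) (gradE G v (s • ξ))) :=
      Real.log_le_log (by positivity) (by linarith)
    have h9 : fderiv ℝ v 0 (gradE G v 0) = p ^ 2 := by rw [hgrad, map_smul, hdve, smul_eq_mul, sq]
    simp only [zero_smul, hdve, he, div_one]
    rw [h9] at hs
    linarith
  have := log_one_add_sq_div_max hx hx1 hr hr1 hy hy1 (by simpa using he)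
    (by simp [hG1]) hm
  simpa [hdve] using this

end localMax

/-! ### The maximum point: the gradient estimate in normal coordinates -/

section localMax

set_option maxSynthPendingDepth 3

open scoped Topology

variable {E : Type*} [NormedAddCommGroup E] [NormedSpace ℝ E]

/-- The derivative of the covariant Hessian along a line through a point where the metric is
stationary. There the derivative of the Christoffel symbols contains only second derivatives of the
metric. -/
theorem hasDerivAt_hessE_line {G : E → E →L[ℝ] E →L[ℝ] ℝ} {v : E → ℝ}
    (hG : ContDiffAt ℝ 2 G 0) (hG1 : fderiv ℝ G 0 = 0) (hv : ContDiffAt ℝ 3 v 0) {e w' : E}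
    (hgrad : HasDerivAt (fun s : ℝ => gradE G v (s • e)) w' 0) (a b : E) :
    HasDerivAt (fun s : ℝ => hessE G v (s • e) a b)
      (fderiv ℝ (fderiv ℝ (fderiv ℝ v)) 0 e a b -
        (fderiv ℝ (fderiv ℝ G) 0 e a b (gradE G v 0) + fderiv ℝ (fderiv ℝ G) 0 e b a (gradE G v 0)
          - fderiv ℝ (fderiv ℝ G) 0 e (gradE G v 0) a b) / 2) 0 := by
  have h1 : ContDiffAt ℝ 2 (fderiv ℝ v) 0 := hv.fderiv_right (m := 2) (by norm_num)
  have h2 : ContDiffAt ℝ 1 (fderiv ℝ (fderiv ℝ v)) 0 := h1.fderiv_right (m := 1) le_rfl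
  have h3 : ContDiffAt ℝ 1 (fderiv ℝ G) 0 := hG.fderiv_right (m := 1) le_rfl
  have h4 := ((hasDerivAt_line_zero (ξ := e) (h2.differentiableAt (by simp))).clm_apply
      (hasDerivAt_const _ a)).clm_apply (hasDerivAt_const _ b)
  have h5 := hasDerivAt_line_zero (ξ := e) (h3.differentiableAt (by simp))
  have h6 := ((h5.clm_apply (hasDerivAt_const _ a)).clm_apply (hasDerivAt_const _ b)).clm_apply
    hgrad
  have h7 := ((h5.clm_apply (hasDerivAt_const _ b)).clm_apply (hasDerivAt_const _ a)).clm_apply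
    hgrad
  have h8 := ((h5.clm_apply hgrad).clm_apply (hasDerivAt_const _ a)).clm_apply
    (hasDerivAt_const _ b)
  refine (h4.sub (((h6.add h7).sub h8).div_const 2)).congr_deriv ?_
  simp [hG1]

variable [FiniteDimensional ℝ E]

/-- The gradient bound at a maximum point of `log ω - N v`, `ω² = 1 + |∇v|²`, in coordinates in
which the metric is stationary at that point: if `∇v ≠ 0` there, then `N` is bounded. -/
theorem sq_le_of_localMax {d m : ℕ} (hdim : Module.finrank ℝ E = d + 1)
    {G : E → E →L[ℝ] E →L[ℝ] ℝ} {v η Ψ : E → ℝ} {N J c CJ CK CH CE : ℝ}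
    (hG : ContDiffAt ℝ 2 G 0) (hGs : ∀ᶠ y in 𝓝 0, ∀ a b, G y a b = G y b a)
    (hGp : ∀ᶠ y in 𝓝 0, ∀ a, a ≠ 0 → 0 < G y a a)
    (hG1 : fderiv ℝ G 0 = 0) (hv : ContDiffAt ℝ 3 v 0) (hη : HasFDerivAt η (J • fderiv ℝ v 0) 0)
    (hN : 0 ≤ N) (hηN : η 0 ≤ N)
    (hmax : IsLocalMax (fun y => Real.log (1 + fderiv ℝ v y (gradE G v y)) / 2 - N * v y) 0)
    (hne : fderiv ℝ v 0 ≠ 0)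
    (heq : ∀ f : Module.Basis (Fin (d + 1)) ℝ E, ∀ᶠ y in 𝓝 0,
      matSigma ((gramMat G v f y)⁻¹ * shapeMat G v η f y) (m + 1) =
        Real.sqrt (1 + fderiv ℝ v y (gradE G v y)) ^ (m + 1) * Ψ y)
    (hcone : ∀ f : Module.Basis (Fin (d + 1)) ℝ E, ∀ j ≤ m + 1,
      0 < matSigma ((gramMat G v f 0)⁻¹ * shapeMat G v η f 0) j)
    (hΨ : ∀ (e : E) (p w : ℝ), 0 < p → 0 < w → w ^ 2 = 1 + p ^ 2 → G 0 e e = 1 →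
      gradE G v 0 = p • e → fderiv ℝ v 0 e = p → w = Real.sqrt (1 + fderiv ℝ v 0 (gradE G v 0)) →
      HasDerivAt (fun s : ℝ => gradE G v (s • e)) ((N * w ^ 2) • e) 0 →
      HasDerivAt (fun s : ℝ => Real.sqrt (1 + fderiv ℝ v (s • e) (gradE G v (s • e))))
        (N * p * w) 0 →
      ∃ Ψ' : ℝ, HasDerivAt (fun s : ℝ => Ψ (s • e)) Ψ' 0 ∧ Ψ' ≤ CE * (1 + N))
    (hc : 0 < c) (hc1 : c ≤ 1) (hcΨ : c ≤ Ψ 0)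
    (hJ : |J| ≤ CJ) (hH : |η 0| ≤ CH) (hCE : 0 ≤ CE)
    (hK1 : ∀ a b, G 0 a a = 1 → G 0 b b = 1 → |fderiv ℝ (fderiv ℝ G) 0 a a b b| ≤ CK)
    (hK2 : ∀ a b, G 0 a a = 1 → G 0 b b = 1 →
      |fderiv ℝ (fderiv ℝ G) 0 a b b a - fderiv ℝ (fderiv ℝ G) 0 a a b b / 2| ≤ CK) :
    N ^ 2 ≤ ((d + 1 : ℕ) : ℝ) * (CJ + 2 * CK + N * CH) + CE * (1 + N) / c := by
  have hs0 := hGs.self_of_nhds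
  have hp0 := hGp.self_of_nhds
  have h1 : ContDiffAt ℝ 2 (fderiv ℝ v) 0 := hv.fderiv_right (m := 2) (by norm_num)
  -- the unit vector `e` in the direction of the gradient
  set P := gradE G v 0 with hP
  have hGP : G 0 P = fderiv ℝ v 0 := apply_gradE hp0 v
  have hP0 : P ≠ 0 := by
    intro h; rw [h, map_zero] at hGP; exact hne hGP.symm
  have hPP := hp0 P hP0
  set p := Real.sqrt (G 0 P P)
  have hppos : 0 < p := Real.sqrt_pos.2 hPP
  have hpsq : p ^ 2 = G 0 P P := Real.sq_sqrt hPP.le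
  set e := p⁻¹ • P with he
  have hPe : P = p • e := by rw [he, smul_smul, mul_inv_cancel₀ hppos.ne', one_smul]
  have hee : G 0 e e = 1 := by
    rw [he]; simp only [map_smul, smul_apply, smul_eq_mul]
    rw [← hpsq]; field_simp
  have hdv : fderiv ℝ v 0 = p • G 0 e := by rw [← hGP, hPe, map_smul]
  have hdve : fderiv ℝ v 0 e = p := by rw [hdv]; simp [hee]
  set w := Real.sqrt (1 + p ^ 2)
  have hwpos : 0 < w := Real.sqrt_pos.2 (by positivity)
  have hw2 : w ^ 2 = 1 + p ^ 2 := Real.sq_sqrt (by positivity)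
  have hdvP : fderiv ℝ v 0 P = p ^ 2 := by rw [hPe, map_smul, hdve, smul_eq_mul, sq]
  have hline := fun ξ => line_max hG hGs hGp hG1 hv hmax hee hPe ξ
  rw [← hw2] at hline
  -- first order condition
  have hSe : fderiv ℝ (fderiv ℝ v) 0 e = (N * w ^ 2) • G 0 e := by
    ext ξ
    have h2 := (hline ξ).1
    rw [hdv, smul_apply, smul_eq_mul, sub_eq_zero, div_eq_iff (by positivity)] at h2
    rw [fderiv_fderiv_symm (hv.of_le (by norm_num)), smul_apply, smul_eq_mul]
    have h3 : p * fderiv ℝ (fderiv ℝ v) 0 ξ e = p * (N * w ^ 2 * G 0 e ξ) := by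
      rw [h2]; ring
    exact mul_left_cancel₀ hppos.ne' h3
  obtain ⟨f, hf0, hfG, hfS⟩ := exists_frame hdim hs0 hp0
    (fun a b => fderiv_fderiv_symm (hv.of_le (by norm_num)) a b) hee hSe
  have hfG' : ∀ i, G 0 (f i) (f i) = 1 := fun i => by rw [hfG, if_pos rfl]
  have hdvf : ∀ i, fderiv ℝ v 0 (f i) = if i = 0 then p else 0 := fun i => by
    rw [hdv, ← hf0, smul_apply, hfG]
    by_cases h : i = 0
    · simp [h]
    · simp [h, Ne.symm h]
  have hSf : ∀ i, fderiv ℝ (fderiv ℝ v) 0 e (f i) = if i = 0 then N * w ^ 2 else 0 := fun i => by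
    rw [hSe, ← hf0, smul_apply, hfG]
    by_cases h : i = 0
    · simp [h]
    · simp [h, Ne.symm h]
  have hgrad' := hasDerivAt_gradE_line hG hGp hG1 hv hSe
  -- the derivative of `ω` along `e`
  have hl1 := hasDerivAt_line_zero (ξ := e) (h1.differentiableAt (by simp))
  have hsq : HasDerivAt (fun s : ℝ => 1 + fderiv ℝ v (s • e) (gradE G v (s • e)))
      (2 * p * (N * w ^ 2)) 0 := by
    refine ((hl1.clm_apply hgrad').const_add 1).congr_deriv ?_
    rw [zero_smul, ← hP, hSe, hPe]
    simp [hee, hdve]; ring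
  have hsqrt0 : w = Real.sqrt (1 + fderiv ℝ v 0 P) := by rw [hdvP]
  have hωd : HasDerivAt (fun s : ℝ => Real.sqrt (1 + fderiv ℝ v (s • e) (gradE G v (s • e))))
      (N * p * w) 0 := by
    have h2 := hsq.sqrt (by rw [zero_smul, ← hP, hdvP]; positivity)
    rw [zero_smul, ← hP, ← hsqrt0] at h2
    refine h2.congr_deriv ?_
    field_simp
  obtain ⟨Ψ', hΨd, hΨ'⟩ := hΨ e p w hppos hwpos hw2 hee hPe hdve hsqrt0 hgrad' hωd
  -- the matrices of the induced metric and of the second fundamental form along `e`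
  set S : E → E → ℝ := fun a b => fderiv ℝ (fderiv ℝ v) 0 a b with hS
  set D2 := fderiv ℝ (fderiv ℝ G) 0 with hD2
  set D3 := fderiv ℝ (fderiv ℝ (fderiv ℝ v)) 0 with hD3
  set γ : Fin (d + 1) → ℝ := fun i => if i = 0 then w ^ 2 else 1 with hγ
  set L : Fin (d + 1) → ℝ := fun i => S (f i) (f i) with hL
  set a : Fin (d + 1) → ℝ := fun i => η 0 - L i / γ i with ha
  have hγpos : ∀ i, 0 < γ i := fun i => by simp only [hγ]; split_ifs <;> positivity
  have hL0 : L 0 = N * w ^ 2 := by simp only [hL, hS, hf0]; rw [← hf0, hf0, hSe]; simp [hee]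
  have hg0 : gramMat G v f 0 = Matrix.diagonal γ := by
    ext i j
    rw [gramMat, hfG, hdvf, hdvf, Matrix.diagonal_apply]
    by_cases h : i = j
    · subst h
      by_cases h0 : i = 0
      · simp [hγ, h0, hw2]; ring
      · simp [hγ, h0]
    · by_cases h0 : i = 0
      · subst h0; simp [h, Ne.symm h]
      · simp [h, h0]
  have hB0 : shapeMat G v η f 0 = Matrix.diagonal fun i => γ i * a i := by
    ext i j
    rw [shapeMat, hg0, hessE, chr, hG1, Matrix.diagonal_apply, Matrix.diagonal_apply]
    by_cases h : i = j
    · subst h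
      have := (hγpos i).ne'
      simp only [if_true, ha, hL, hS]
      simp
      field_simp
    · simp [h, hfS i j h]
  set g' : Matrix (Fin (d + 1)) (Fin (d + 1)) ℝ := fun i j =>
    S e (f i) * fderiv ℝ v 0 (f j) + fderiv ℝ v 0 (f i) * S e (f j) with hg'
  have hgd : ∀ i j, HasDerivAt (fun s : ℝ => gramMat G v f (s • e) i j) (g' i j) 0 := by
    intro i j
    have h2 := ((hasDerivAt_line_zero (ξ := e) (hG.differentiableAt (by simp))).clm_apply
      (hasDerivAt_const _ (f i))).clm_apply (hasDerivAt_const _ (f j))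
    have h3 := hl1.clm_apply (hasDerivAt_const (0 : ℝ) (f i))
    have h4 := hl1.clm_apply (hasDerivAt_const (0 : ℝ) (f j))
    refine (h2.add (h3.mul h4)).congr_deriv ?_
    simp [hG1, hg', hS]
  set H' : Fin (d + 1) → Fin (d + 1) → ℝ := fun i j => D3 e (f i) (f j) -
        (D2 e (f i) (f j) P + D2 e (f j) (f i) P - D2 e P (f i) (f j)) / 2 with hH'
  have hηd : HasDerivAt (fun s : ℝ => η (s • e)) (J * p) 0 := by
    have h2 := hasDerivAt_line_zero (ξ := e) hη.differentiableAt
    refine h2.congr_deriv ?_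
    rw [hη.fderiv, smul_apply, hdve, smul_eq_mul]
  have hBd : ∀ i j, HasDerivAt (fun s : ℝ => shapeMat G v η f (s • e) i j)
      (J * p * gramMat G v f 0 i j + η 0 * g' i j - H' i j) 0 := by
    intro i j
    have h2 := hasDerivAt_hessE_line hG hG1 hv hgrad' (f i) (f j)
    refine ((hηd.mul (hgd i j)).sub h2).congr_deriv ?_
    simp only [zero_smul, hH', hD2, hD3, hP]
  -- the derivative of the equation along `e`, computed in two ways
  have hσd := hasDerivAt_matSigma_inv_mul (a := a) hgd hBd (fun i => (hγpos i).ne')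
    (by rw [zero_smul, hg0]) (by rw [zero_smul, hB0]) m
  have hrhs := (hωd.fun_pow (m + 1)).mul hΨd
  have hev : (fun s : ℝ => matSigma ((gramMat G v f (s • e))⁻¹ * shapeMat G v η f (s • e)) (m + 1))
      =ᶠ[𝓝 0] fun s => Real.sqrt (1 + fderiv ℝ v (s • e) (gradE G v (s • e))) ^ (m + 1)
        * Ψ (s • e) := (tendsto_line e).eventually (heq f)
  have hder := (hσd.congr_of_eventuallyEq hev.symm).unique hrhs
  have hdet : (gramMat G v f 0).det ≠ 0 := by
    rw [hg0, Matrix.det_diagonal]; exact (Finset.prod_pos fun i _ => hγpos i).ne'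
  have hinv : (gramMat G v f 0)⁻¹ * shapeMat G v η f 0 = Matrix.diagonal a := by
    have : shapeMat G v η f 0 = gramMat G v f 0 * Matrix.diagonal a := by
      rw [hg0, hB0, Matrix.diagonal_mul_diagonal]
    rw [this, ← Matrix.mul_assoc, Matrix.nonsing_inv_mul _ (Ne.isUnit hdet), one_mul]
  have hσ0 : esym Finset.univ a (m + 1) = w ^ (m + 1) * Ψ 0 := by
    have := (heq f).self_of_nhds
    rwa [hinv, matSigma_diagonal, ← hP, ← hsqrt0] at this
  rw [zero_smul, ← hP, ← hsqrt0] at hder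
  have hacone : ∀ j ≤ m + 1, 0 < esym Finset.univ a j := fun j hj => by
    have := hcone f j hj
    rwa [hinv, matSigma_diagonal] at this
  have hfin := sq_le_of_max (s := Finset.univ) (a := a) (i₀ := (0 : Fin (d + 1))) hacone
    (Finset.mem_univ _) (N := N) (p := p) (H := η 0) (J := J) (E := w ^ (m + 1) * Ψ') (w := w)
    (c := c) (CJ := CJ) (CH := CH) (CK := CK) (CE := CE) (T := fun i => D3 (f i) (f i) e) (L := L)
    (R := fun i => D2 (f i) (f i) e e)
    (K := fun i => D2 e (f i) (f i) e - D2 e e (f i) (f i) / 2) (γ := γ)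
    (g' := fun i => g' i i)
    (B' := fun i => J * p * gramMat G v f 0 i i + η 0 * g' i i - H' i i) hN hppos.le hwpos hw2
    hc hc1 (by simp [hγ]) (fun i _ hi => by simp [hγ, hi])
    (fun i _ => by simp only [ha]; have := (hγpos i).ne'; field_simp; ring)
    hL0 (by simp only [ha, hL0, hγ, if_true]; rw [mul_div_cancel_right₀ _ (by positivity)]; linarith)
    (by simp only [hg', hS, hSf, hdvf, hL0, if_true]; ring)
    (fun i _ hi => by simp only [hg', hS, hSf, hdvf, if_neg hi]; ring)
    (fun i _ => ?_) ?_ (fun i _ hi => ?_) ?_ ?_ ?_ hJ hH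
    (fun i _ => hK1 _ _ (hfG' i) hee) (fun i _ => hK2 _ _ hee (hfG' i)) hCE
  · simpa using hfin
  · simp only [hH']
    rw [hg0, Matrix.diagonal_apply_eq, hPe, hD3, fderiv_fderiv_fderiv_rotate hv]
    simp only [map_smul, smul_apply, smul_eq_mul]
    ring
  · have h2 := (hline (f 0)).2
    rw [hf0] at h2 ⊢
    have h3 : fderiv ℝ (fderiv ℝ v) 0 e e = L 0 := by simp only [hL, hS, hf0]
    rw [h3] at h2
    linarith [h2]
  · have h2 := (hline (f i)).2
    have h3 : fderiv ℝ (fderiv ℝ v) 0 (f i) e = 0 := by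
      rw [fderiv_fderiv_symm (hv.of_le (by norm_num)), hSf, if_neg hi]
    rw [h3] at h2
    simp only [mul_zero, zero_div, ne_eq, OfNat.ofNat_ne_zero, not_false_eq_true, zero_pow,
      add_zero, sub_zero] at h2
    exact h2
  · rw [hder, hσ0]
    push_cast
    ring
  · calc w ^ (m + 1) * Ψ' ≤ w ^ (m + 1) * (CE * (1 + N)) := by gcongr
      _ = _ := by ring
  · rw [hσ0, mul_comm c]; gcongr

end localMax

/-! ### The metric in a chart -/

section chart

set_option maxSynthPendingDepth 3

open scoped Topology

variable {n : ℕ} {M : Type*} [TopologicalSpace M]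
  [ChartedSpace (EuclideanSpace ℝ (Fin n)) M]
  [IsManifold (𝓡 n) ∞ M]

/-- The derivative of the inverse of the chart at `c`. -/
noncomputable def chartDeriv (c : M) (x : EuclideanSpace ℝ (Fin n)) :
    EuclideanSpace ℝ (Fin n) →L[ℝ] EuclideanSpace ℝ (Fin n) :=
  mfderiv (𝓡 n) (𝓡 n)
      (extChartAt (𝓡 n) c).symm x

/-- The metric of `M` in the chart at `c`. -/
noncomputable def chartMetric (g : SmoothMetric n M) (c : M) (x : EuclideanSpace ℝ (Fin n)) :
    EuclideanSpace ℝ (Fin n) →L[ℝ] EuclideanSpace ℝ (Fin n) →L[ℝ] ℝ :=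
  ContinuousLinearMap.bilinearComp (σ₁₃ := RingHom.id ℝ) (σ₂₃ := RingHom.id ℝ)
    (show EuclideanSpace ℝ (Fin n) →L[ℝ] EuclideanSpace ℝ (Fin n) →L[ℝ] ℝ from
      g.inner ((extChartAt (𝓡 n) c).symm x))
    (chartDeriv c x) (chartDeriv c x)

theorem mfderiv_extChartAt_chartDeriv {c : M} {x : EuclideanSpace ℝ (Fin n)}
    (hx : x ∈ (extChartAt (𝓡 n) c).target)
    (a : EuclideanSpace ℝ (Fin n)) :
    (mfderiv (𝓡 n) (𝓡 n)
      (extChartAt (𝓡 n) c)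
      ((extChartAt (𝓡 n) c).symm x)
      (chartDeriv c x a) : EuclideanSpace ℝ (Fin n)) = a := by
  have : IsManifold (𝓡 n) 1 M :=
    IsManifold.of_le (n := ∞) (by simp)
  have h := mfderiv_extChartAt_comp_mfderivWithin_extChartAt_symm
    (I := (𝓡 n)) hx
  simp only [modelWithCornersSelf_coe, range_id, mfderivWithin_univ] at h
  exact congrArg (fun L => L a) h

theorem chartDeriv_mfderiv_extChartAt {c : M} {x : EuclideanSpace ℝ (Fin n)}
    (hx : x ∈ (extChartAt (𝓡 n) c).target)
    (a : TangentSpace (𝓡 n)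
      ((extChartAt (𝓡 n) c).symm x)) :
    chartDeriv c x (mfderiv (𝓡 n) (𝓡 n)
      (extChartAt (𝓡 n) c)
      ((extChartAt (𝓡 n) c).symm x) a) = a := by
  have : IsManifold (𝓡 n) 1 M :=
    IsManifold.of_le (n := ∞) (by simp)
  have h := mfderivWithin_extChartAt_symm_comp_mfderiv_extChartAt
    (I := (𝓡 n)) hx
  simp only [modelWithCornersSelf_coe, range_id, mfderivWithin_univ] at h
  exact congrArg (fun L => L a) h

theorem chartMetric_symm (g : SmoothMetric n M) (c : M) (x a b : EuclideanSpace ℝ (Fin n)) :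
    chartMetric g c x a b = chartMetric g c x b a := g.symm _ _ _

theorem chartMetric_pos (g : SmoothMetric n M) {c : M} {x : EuclideanSpace ℝ (Fin n)}
    (hx : x ∈ (extChartAt (𝓡 n) c).target)
    (a : EuclideanSpace ℝ (Fin n)) (ha : a ≠ 0) : 0 < chartMetric g c x a a := by
  refine g.pos _ _ fun h => ha ?_
  exact (mfderiv_extChartAt_chartDeriv hx a).symm.trans
    ((congrArg (mfderiv (𝓡 n) (𝓡 n)
      (extChartAt (𝓡 n) c)
      ((extChartAt (𝓡 n) c).symm x)) h).trans (map_zero _))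

/-- The tangent map of the inverse of the chart at `c` is smooth. -/
theorem contMDiffOn_chartDeriv (c : M) :
    ContMDiffOn 𝓘(ℝ, EuclideanSpace ℝ (Fin n) × EuclideanSpace ℝ (Fin n))
      ((𝓡 n).tangent) ∞
      (fun q : EuclideanSpace ℝ (Fin n) × EuclideanSpace ℝ (Fin n) =>
        (⟨(extChartAt (𝓡 n) c).symm q.1, chartDeriv c q.1 q.2⟩ :
          TangentBundle (𝓡 n) M))
      ((extChartAt (𝓡 n) c).target ×ˢ univ) := by
  have : IsManifold (𝓡 n) 1 M :=
    IsManifold.of_le (n := ∞) (by simp)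
  set e := trivializationAt (EuclideanSpace ℝ (Fin n))
    (TangentSpace (𝓡 n) : M → Type _) c
  have h1 : ContMDiffOn 𝓘(ℝ, EuclideanSpace ℝ (Fin n) × EuclideanSpace ℝ (Fin n))
      ((𝓡 n).prod (𝓡 n)) ∞
      (fun q : EuclideanSpace ℝ (Fin n) × EuclideanSpace ℝ (Fin n) =>
        ((extChartAt (𝓡 n) c).symm q.1, q.2))
      ((extChartAt (𝓡 n) c).target ×ˢ univ) := by
    refine ContMDiffOn.prodMk ?_ contDiff_snd.contMDiff.contMDiffOn
    exact (contMDiffOn_extChartAt_symm (n := ∞) c).comp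
      (contDiff_fst.contMDiff.contMDiffOn) (fun q hq => hq.1)
  have h2 : ContMDiffOn ((𝓡 n).prod (𝓡 n))
      ((𝓡 n).prod (𝓡 n)) ∞
      e.toOpenPartialHomeomorph.symm e.target :=
    Bundle.Trivialization.contMDiffOn_symm e
  have hb : ∀ q ∈ (extChartAt (𝓡 n) c).target ×ˢ
      (univ : Set (EuclideanSpace ℝ (Fin n))),
      (extChartAt (𝓡 n) c).symm q.1 ∈
        (chartAt (EuclideanSpace ℝ (Fin n)) c).source := fun q hq => by
    have := (extChartAt (𝓡 n) c).map_target hq.1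
    rwa [extChartAt_source] at this
  refine (h2.comp h1 fun q hq => ?_).congr fun q hq => ?_
  · exact e.mem_target.2 (hb q hq)
  · have h3 := TangentBundle.symmL_trivializationAt (I := (𝓡 n))
      (hb q hq)
    rw [(extChartAt (𝓡 n) c).right_inv hq.1] at h3
    simp only [modelWithCornersSelf_coe, range_id, mfderivWithin_univ] at h3
    have h4 := e.mk_symm (b := (extChartAt (𝓡 n) c).symm q.1)
      (hb q hq) q.2
    refine Eq.trans ?_ h4
    congr 1
    exact (congrArg (fun L => L q.2) h3).symm.trans (Trivialization.symmL_apply _ (hb q hq) _)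

theorem contDiffOn_chartMetric (g : SmoothMetric n M) (c : M) :
    ContDiffOn ℝ ∞ (chartMetric g c) (extChartAt (𝓡 n) c).target := by
  rw [contDiffOn_clm_apply]
  intro a
  rw [contDiffOn_clm_apply]
  intro b
  have hsec : ∀ a : EuclideanSpace ℝ (Fin n), ContMDiffOn (𝓡 n)
      ((𝓡 n).prod (𝓡 n)) ∞
      (fun x : EuclideanSpace ℝ (Fin n) =>
        (TotalSpace.mk' (EuclideanSpace ℝ (Fin n))
          (E := (TangentSpace (𝓡 n) : M → Type _))
          ((extChartAt (𝓡 n) c).symm x) (chartDeriv c x a)))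
      (extChartAt (𝓡 n) c).target := fun a =>
    (contMDiffOn_chartDeriv c).comp (t := (extChartAt (𝓡 n) c).target
      ×ˢ univ) (f := fun x => (x, a))
      ((contDiff_id.prodMk contDiff_const).contMDiff.contMDiffOn) (fun x hx => ⟨hx, trivial⟩)
  intro x hx
  have h1 : ContMDiffWithinAt (𝓡 n)
      ((𝓡 n).prod 𝓘(ℝ)) ∞
      (fun m ↦ TotalSpace.mk' ℝ (E := Bundle.Trivial M ℝ)
        ((extChartAt (𝓡 n) c).symm m)
        (g.inner ((extChartAt (𝓡 n) c).symm m)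
          (chartDeriv c m a) (chartDeriv c m b)))
      (extChartAt (𝓡 n) c).target x := by
    apply ContMDiffWithinAt.clm_bundle_apply₂ (F₁ := EuclideanSpace ℝ (Fin n))
      (F₂ := EuclideanSpace ℝ (Fin n))
    · exact ContMDiffAt.comp_contMDiffWithinAt x g.contMDiff.contMDiffAt
        (contMDiffOn_extChartAt_symm (n := ∞) c x hx)
    · exact hsec a x hx
    · exact hsec b x hx
  simp only [contMDiffWithinAt_totalSpace] at h1
  exact h1.2.contDiffWithinAt

end chart

/-! ### Graphs in a warped product, in coordinates -/

section warpedCoord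

set_option maxSynthPendingDepth 3

open scoped Topology

variable {E : Type*} [NormedAddCommGroup E] [NormedSpace ℝ E]

/-- The Christoffel symbols of a warped product metric `dt² + h(t)² G`. -/
theorem christoffel_warped {G : E → E →L[ℝ] E →L[ℝ] ℝ} {h : ℝ → ℝ} {t h' : ℝ} {x : E}
    (hh : HasDerivAt h h' t) (hG : DifferentiableAt ℝ G x) (a b w : ℝ × E) :
    christoffel (fun y a b : ℝ × E => a.1 * b.1 + h y.1 ^ 2 * G y.2 a.2 b.2) (t, x) a b w =
      h t * h' * (a.1 * G x b.2 w.2 + b.1 * G x a.2 w.2 - w.1 * G x a.2 b.2)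
        + h t ^ 2 * chr G x a.2 b.2 w.2 := by
  have key : ∀ a b c : ℝ × E,
      fderiv ℝ (fun y : ℝ × E => a.1 * b.1 + h y.1 ^ 2 * G y.2 a.2 b.2) (t, x) c =
        2 * h t * h' * c.1 * G x a.2 b.2 + h t ^ 2 * fderiv ℝ G x c.2 a.2 b.2 := fun a b c => by
    have h1 : HasFDerivAt (fun y : ℝ × E => h y.1) (h' • ContinuousLinearMap.fst ℝ ℝ E) (t, x) :=
      HasDerivAt.comp_hasFDerivAt (t, x) hh hasFDerivAt_fst
    have h2 : HasFDerivAt (fun y : ℝ × E => G y.2)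
        (fderiv ℝ G x ∘L ContinuousLinearMap.snd ℝ ℝ E) (t, x) :=
      HasFDerivAt.comp (𝕜 := ℝ) (G := E →L[ℝ] E →L[ℝ] ℝ) (t, x) (g := G) (f := Prod.snd)
        hG.hasFDerivAt hasFDerivAt_snd
    have h3 := (h2.clm_apply (hasFDerivAt_const a.2 (t, x))).clm_apply
      (hasFDerivAt_const b.2 (t, x))
    have h4 := ((h1.pow 2).mul h3).const_add (a.1 * b.1)
    refine (congrArg (fun L => L c) h4.fderiv).trans ?_
    simp
    ring
  simp only [christoffel, key, chr]
  ring

/-- The second derivative of `v = s ∘ z` with `s' = 1 / h`. -/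
theorem fderiv_fderiv_height {h s : ℝ → ℝ} {z : E → ℝ} {x : E} {h' : ℝ}
    (hs : ∀ᶠ t in 𝓝 (z x), HasDerivAt s (h t)⁻¹ t) (hh : HasDerivAt h h' (z x)) (h0 : h (z x) ≠ 0)
    (hz : ContDiffAt ℝ 2 z x) :
    (∀ᶠ y in 𝓝 x, fderiv ℝ (fun y => s (z y)) y = (h (z y))⁻¹ • fderiv ℝ z y) ∧
    ∀ a b, fderiv ℝ (fderiv ℝ (fun y => s (z y))) x a b =
      (h (z x))⁻¹ * fderiv ℝ (fderiv ℝ z) x a b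
        - h' / h (z x) ^ 2 * (fderiv ℝ z x a * fderiv ℝ z x b) := by
  have h1 : ∀ᶠ y in 𝓝 x, fderiv ℝ (fun y => s (z y)) y = (h (z y))⁻¹ • fderiv ℝ z y := by
    filter_upwards [hz.continuousAt.eventually hs, hz.eventually (by simp)] with y hy hzy
    exact (hy.comp_hasFDerivAt y (hzy.differentiableAt (by simp)).hasFDerivAt).fderiv
  refine ⟨h1, fun a b => ?_⟩
  have h2 : DifferentiableAt ℝ (fderiv ℝ z) x :=
    (hz.fderiv_right (m := 1) le_rfl).differentiableAt one_ne_zero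
  have h3 : HasFDerivAt (fun y => (h (z y))⁻¹) ((-h' / h (z x) ^ 2) • fderiv ℝ z x) x :=
    (hh.fun_inv h0).comp_hasFDerivAt x (hz.differentiableAt (by simp)).hasFDerivAt
  have h4 := (h3.smul h2.hasFDerivAt).congr_of_eventuallyEq h1
  rw [h4.fderiv]
  simp
  ring

/-- The unit normal of the graph `x ↦ (z x, x)` in the warped product `dt² + h² G`, in terms of
the gradient of `v = s ∘ z`, `s' = 1 / h`. -/
theorem normal_eq [FiniteDimensional ℝ E] {G : E → E →L[ℝ] E →L[ℝ] ℝ} {v : E → ℝ} {x ξ : E}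
    {a H : ℝ} (hp : ∀ a, a ≠ 0 → 0 < G x a a) (hH : 0 < H)
    (hunit : a ^ 2 + H ^ 2 * G x ξ ξ = 1)
    (horth : ∀ b, a * (H * fderiv ℝ v x b) + H ^ 2 * G x ξ b = 0) (ha : a < 0) :
    0 ≤ fderiv ℝ v x (gradE G v x) ∧
    a = -(Real.sqrt (1 + fderiv ℝ v x (gradE G v x)))⁻¹ ∧
    ξ = (H * Real.sqrt (1 + fderiv ℝ v x (gradE G v x)))⁻¹ • gradE G v x := by
  have hg : G x (gradE G v x) = fderiv ℝ v x := apply_gradE hp v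
  have h1 : ξ = (-a / H) • gradE G v x := by
    refine eq_of_posDef hp ?_
    ext b
    rw [map_smul, hg, smul_apply, smul_eq_mul]
    have := horth b
    field_simp
    nlinarith
  set P := gradE G v x
  have h2 : fderiv ℝ v x P = G x P P := by rw [hg]
  have h3 : 0 ≤ fderiv ℝ v x P := by
    rw [h2]
    by_cases h0 : P = 0
    · rw [h0]; simp
    · exact (hp P h0).le
  set q := fderiv ℝ v x P
  have h4 : a ^ 2 * (1 + q) = 1 := by
    rw [h1] at hunit
    simp only [map_smul, smul_apply, smul_eq_mul, ← h2] at hunit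
    field_simp at hunit
    linarith
  have hw : 0 < Real.sqrt (1 + q) := Real.sqrt_pos.2 (by linarith)
  have hw2 : Real.sqrt (1 + q) ^ 2 = 1 + q := Real.sq_sqrt (by linarith)
  have h5 : a = -(Real.sqrt (1 + q))⁻¹ := by
    have h6 : (-a * Real.sqrt (1 + q)) ^ 2 = 1 := by rw [mul_pow, neg_sq, hw2, h4]
    have h7 : 0 < -a * Real.sqrt (1 + q) := mul_pos (by linarith) hw
    have h8 : -a * Real.sqrt (1 + q) = 1 := by nlinarith
    rw [← eq_inv_of_mul_eq_one_left h8, neg_neg]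
  refine ⟨h3, h5, ?_⟩
  rw [h1, h5]
  congr 1
  field_simp

/-- The second fundamental form of the graph `x ↦ (z x, x)` in the warped product `dt² + h² G`, in
terms of `v = s ∘ z`, `s' = 1 / h`. -/
theorem warped_second_fundamental [FiniteDimensional ℝ E] {G : E → E →L[ℝ] E →L[ℝ] ℝ}
    {h s : ℝ → ℝ} {z : E → ℝ} {x ξ : E} {h' a : ℝ}
    (hs : ∀ᶠ t in 𝓝 (z x), HasDerivAt s (h t)⁻¹ t) (hh : HasDerivAt h h' (z x)) (h0 : 0 < h (z x))
    (hz : ContDiffAt ℝ 2 z x) (hG : DifferentiableAt ℝ G x)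
    (hGs : ∀ a b, G x a b = G x b a)
    (hp : ∀ a, a ≠ 0 → 0 < G x a a)
    (hξ : ξ = (-a / h (z x)) • gradE G (fun y => s (z y)) x) (b c : E) :
    (fderiv ℝ (fun y => fderiv ℝ (fun y => (z y, y)) y c) x b).1 * a
      + h (z x) ^ 2 * G x (fderiv ℝ (fun y => fderiv ℝ (fun y => (z y, y)) y c) x b).2 ξ
      + christoffel (fun y a b : ℝ × E => a.1 * b.1 + h y.1 ^ 2 * G y.2 a.2 b.2) (z x, x)
        (fderiv ℝ (fun y => (z y, y)) x b) (fderiv ℝ (fun y => (z y, y)) x c) (a, ξ) =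
    -a * h (z x) * (h' * (G x b c + fderiv ℝ (fun y => s (z y)) x b
      * fderiv ℝ (fun y => s (z y)) x c) - hessE G (fun y => s (z y)) x b c) := by
  have h1 : ∀ᶠ y in 𝓝 x, ∀ c, fderiv ℝ (fun y => (z y, y)) y c = (fderiv ℝ z y c, c) := by
    filter_upwards [hz.eventually (by simp)] with y hy c
    exact congrArg (fun L => L c)
      ((hy.differentiableAt (by simp)).hasFDerivAt.prodMk (hasFDerivAt_id y)).fderiv
  have h2 : DifferentiableAt ℝ (fderiv ℝ z) x :=
    (hz.fderiv_right (m := 1) le_rfl).differentiableAt one_ne_zero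
  have h3 : fderiv ℝ (fun y => fderiv ℝ (fun y => (z y, y)) y c) x b =
      (fderiv ℝ (fderiv ℝ z) x b c, 0) := by
    have h4 := (h2.hasFDerivAt.clm_apply (hasFDerivAt_const c x)).prodMk (hasFDerivAt_const c x)
    have h5 := h4.congr_of_eventuallyEq (h1.mono fun y hy => hy c)
    rw [h5.fderiv]
    simp
  obtain ⟨h6, h7⟩ := fderiv_fderiv_height hs hh h0.ne' hz
  rw [h3, christoffel_warped hh hG, h1.self_of_nhds, h1.self_of_nhds, hessE, h7]
  have h8 : ∀ b, G x b ξ = (-a / h (z x)) * ((h (z x))⁻¹ * fderiv ℝ z x b) := fun b => by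
    rw [hGs, hξ, map_smul, apply_gradE hp, h6.self_of_nhds]; simp
  have h9 : chr G x b c ξ = (-a / h (z x)) * chr G x b c (gradE G (fun y => s (z y)) x) := by
    simp only [chr, hξ, map_smul, smul_apply, smul_eq_mul]; ring
  simp only [h8, h9, h6.self_of_nhds, smul_apply, smul_eq_mul, map_zero, zero_apply]
  field_simp
  ring

end warpedCoord

/-! ### Graphs in a chart of the manifold -/

section chartGraph

set_option maxSynthPendingDepth 3

open scoped Topology

variable {n : ℕ} {M : Type*} [TopologicalSpace M]
  [ChartedSpace (EuclideanSpace ℝ (Fin n)) M]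
  [IsManifold (𝓡 n) ∞ M]

/-- The expression of a function `z` on `M` in the chart at `c`. -/
noncomputable def chartFun {V : Type*} (z : M → V) (c : M) (x : EuclideanSpace ℝ (Fin n)) : V :=
  z ((extChartAt (𝓡 n) c).symm x)

theorem contMDiffAt_extChartAt_symm_of_mem {c : M} {x : EuclideanSpace ℝ (Fin n)}
    (hx : x ∈ (extChartAt (𝓡 n) c).target) :
    ContMDiffAt (𝓡 n) (𝓡 n) ∞
      (extChartAt (𝓡 n) c).symm x :=
  (contMDiffOn_extChartAt_symm (n := ∞) c).contMDiffAt
    ((isOpen_extChartAt_target (I := (𝓡 n)) c).mem_nhds hx)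

theorem contDiffAt_chartFun {z : M → ℝ}
    (hz : ContMDiff (𝓡 n) 𝓘(ℝ, ℝ) 3 z) {c : M}
    {x : EuclideanSpace ℝ (Fin n)}
    (hx : x ∈ (extChartAt (𝓡 n) c).target) :
    ContDiffAt ℝ 3 (chartFun z c) x := by
  have h1 := (contMDiffAt_extChartAt_symm_of_mem hx).of_le
    (show (3 : WithTop ℕ∞) ≤ ∞ from WithTop.coe_le_coe.2 le_top)
  exact (hz.contMDiffAt.comp x h1).contDiffAt

theorem mfderiv_chartDeriv {z : M → ℝ}
    (hz : ContMDiff (𝓡 n) 𝓘(ℝ, ℝ) 3 z) {c : M}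
    {x : EuclideanSpace ℝ (Fin n)}
    (hx : x ∈ (extChartAt (𝓡 n) c).target)
    (a : EuclideanSpace ℝ (Fin n)) :
    (mfderiv (𝓡 n) 𝓘(ℝ, ℝ) z
      ((extChartAt (𝓡 n) c).symm x) (chartDeriv c x a) : ℝ) =
    fderiv ℝ (chartFun z c) x a := by
  have h1 := mfderiv_comp x ((hz.contMDiffAt (x := (extChartAt (𝓡 n)
    c).symm x)).mdifferentiableAt (by simp))
    ((contMDiffAt_extChartAt_symm_of_mem hx).mdifferentiableAt (by simp))
  rw [mfderiv_eq_fderiv] at h1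
  exact (congrArg (fun L => L a) h1).symm

/-- The geometry of the graph of `z` in the chart at `c`: the unit normal `ν`, and a frame `β`
orthonormal for the induced metric which diagonalizes the second fundamental form, in terms of
`v = s ∘ z` with `s' = 1 / h`. -/
theorem exists_frame_of_isPrincipalCurvatures {g : SmoothMetric n M} {h s : ℝ → ℝ} {h' : ℝ}
    {z : M → ℝ} {c : M} {x : EuclideanSpace ℝ (Fin n)}
    (hx : x ∈ (extChartAt (𝓡 n) c).target)
    (hz : ContMDiff (𝓡 n) 𝓘(ℝ, ℝ) 3 z)
    (hs : ∀ᶠ t in 𝓝 (chartFun z c x), HasDerivAt s (h t)⁻¹ t)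
    (hh : HasDerivAt h h' (chartFun z c x)) (h0 : 0 < h (chartFun z c x))
    {ν : ℝ × TangentSpace (𝓡 n)
      ((extChartAt (𝓡 n) c).symm x)} {κ : Fin n → ℝ}
    (hν : IsInwardUnitNormal g h z _ ν) (hκ : IsPrincipalCurvatures g h z _ ν κ)
    {v : EuclideanSpace ℝ (Fin n) → ℝ} (hv : v = fun y => s (chartFun z c y)) {w : ℝ}
    (hw : w = Real.sqrt (1 + fderiv ℝ v x (gradE (chartMetric g c) v x))) :
    0 ≤ fderiv ℝ v x (gradE (chartMetric g c) v x) ∧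
    ν = (-w⁻¹, chartDeriv c x ((h (chartFun z c x) * w)⁻¹ • gradE (chartMetric g c) v x)) ∧
    ∃ β : Fin n → EuclideanSpace ℝ (Fin n),
      (∀ i j, h (chartFun z c x) ^ 2 * gramMat (chartMetric g c) v β x i j =
        if i = j then 1 else 0) ∧
      ∀ i j, w⁻¹ * h (chartFun z c x) *
        (h' * gramMat (chartMetric g c) v β x i j - hessE (chartMetric g c) v x (β i) (β j)) =
        if i = j then κ i else 0 := by
  set H := h (chartFun z c x) with hH
  set G := chartMetric g c
  have hζ := (contDiffAt_chartFun hz hx).of_le (show (2 : WithTop ℕ∞) ≤ 3 by norm_num)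
  have hGp : ∀ a, a ≠ 0 → 0 < G x a a := chartMetric_pos g hx
  have hGs : ∀ a b, G x a b = G x b a := chartMetric_symm g c x
  have hGd : DifferentiableAt ℝ G x :=
    ((contDiffOn_chartMetric g c).contDiffAt
      ((isOpen_extChartAt_target (I := (𝓡 n)) c).mem_nhds hx)).differentiableAt (by simp)
  have hdv : fderiv ℝ v x = H⁻¹ • fderiv ℝ (chartFun z c) x := by
    have := (fderiv_fderiv_height hs hh h0.ne' hζ).1.self_of_nhds
    rw [hv]; exact this
  have hdz : ∀ b, fderiv ℝ (chartFun z c) x b = H * fderiv ℝ v x b := fun b => by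
    rw [hdv, smul_apply, smul_eq_mul, mul_inv_cancel_left₀ h0.ne']
  -- tangent vectors at the point, in the chart
  let dφ : TangentSpace (𝓡 n) ((extChartAt (𝓡 n) c).symm x) → EuclideanSpace ℝ (Fin n) :=
    fun u => mfderiv (𝓡 n) (𝓡 n) (extChartAt (𝓡 n) c) ((extChartAt (𝓡 n) c).symm x) u
  have hdφ : ∀ u, chartDeriv c x (dφ u) = u := fun u => chartDeriv_mfderiv_extChartAt hx u
  have hinn : ∀ u w, g.inner ((extChartAt (𝓡 n) c).symm x) u w = G x (dφ u) (dφ w) := fun u w =>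
    (congrArg₂ (fun a b => g.inner ((extChartAt (𝓡 n) c).symm x) a b) (hdφ u) (hdφ w)).symm
  have hmf : ∀ u : TangentSpace (𝓡 n) ((extChartAt (𝓡 n) c).symm x),
      (mfderiv (𝓡 n) 𝓘(ℝ, ℝ) z ((extChartAt (𝓡 n) c).symm x) u : ℝ) =
        H * fderiv ℝ v x (dφ u) := fun u => by
    rw [← hdz, ← mfderiv_chartDeriv hz hx]
    exact (congrArg (mfderiv (𝓡 n) 𝓘(ℝ, ℝ) z ((extChartAt (𝓡 n) c).symm x)) (hdφ u)).symm
  have hwarp : ∀ u w, warpedInner g h (z ((extChartAt (𝓡 n) c).symm x)) ((extChartAt (𝓡 n) c).symm x) u w =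
      u.1 * w.1 + H ^ 2 * G x (dφ u.2) (dφ w.2) := fun u w => by rw [← hinn]; rfl
  obtain ⟨hν1, hν2, hν3⟩ := hν
  rw [hwarp] at hν1 hν3
  have e2 : ∀ b, ν.1 * (H * fderiv ℝ v x b) + H ^ 2 * G x (dφ ν.2) b = 0 := fun b => by
    have h1 := hν2 (chartDeriv c x b)
    rw [hwarp] at h1
    have h2 : dφ (chartDeriv c x b) = b := mfderiv_extChartAt_chartDeriv hx b
    have h3 := hmf (chartDeriv c x b)
    rw [h2] at h3
    rw [← h3, ← h1]
    exact congrArg (fun b' => ν.1 * (graphTangent z ((extChartAt (𝓡 n) c).symm x)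
      (chartDeriv c x b)).1 + H ^ 2 * G x (dφ ν.2) b') h2.symm
  have e3 : ν.1 < 0 := by
    have h1 : dφ 0 = 0 := map_zero _
    simpa [h1] using hν3
  obtain ⟨hq, ha, hξe⟩ := normal_eq hGp h0 (by rw [sq]; exact hν1) e2 e3
  rw [← hw] at ha hξe
  refine ⟨hq, ?_, ?_⟩
  · refine Prod.ext ha ?_
    exact (hdφ ν.2).symm.trans (congrArg (chartDeriv c x) hξe)
  obtain ⟨b, hb1, hb2⟩ := hκ
  refine ⟨fun i => dφ (b i), fun i j => ?_, fun i j => ?_⟩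
  · rw [← hb1 i j, hwarp]
    have h1 : (graphTangent z ((extChartAt (𝓡 n) c).symm x) (b i)).1 * (graphTangent z ((extChartAt (𝓡 n) c).symm x) (b j)).1 =
        (H * fderiv ℝ v x (dφ (b i))) * (H * fderiv ℝ v x (dφ (b j))) :=
      congrArg₂ (fun a b : ℝ => a * b) (hmf (b i)) (hmf (b j))
    rw [h1, gramMat]
    simp only [graphTangent]
    ring
  · have hsrc : (extChartAt (𝓡 n) c).symm x ∈ (chartAt (EuclideanSpace ℝ (Fin n)) c).source := by
      have := (extChartAt (𝓡 n) c).map_target hx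
      rwa [extChartAt_source] at this
    have h2 := hb2 c hsrc i j
    have h3 := warped_second_fundamental (G := G) (s := s) (z := chartFun z c) (x := x)
      (ξ := dφ ν.2) (h' := h') (a := ν.1) hs hh h0 hζ hGd hGs hGp (by
        rw [hξe, ha, ← hv, neg_neg, ← hH, mul_inv_rev, div_eq_mul_inv]) (dφ (b i)) (dφ (b j))
    rw [← hv] at h3
    rw [← h2]
    have hwa : w⁻¹ = -ν.1 := by rw [ha, neg_neg]
    rw [hwa, gramMat]
    refine h3.symm.trans ?_
    have hr : (extChartAt (𝓡 n) c) ((extChartAt (𝓡 n) c).symm x) = x := (extChartAt (𝓡 n) c).right_inv hx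
    unfold secondFundamentalForm
    simp only
    rw [hr]
    rfl

end chartGraph

/-! ### The shape operator in an arbitrary basis -/

section shapeFrame

set_option maxSynthPendingDepth 3

open scoped Topology

variable {E : Type*} [NormedAddCommGroup E] [NormedSpace ℝ E]

theorem toMatrix_transpose_mul_mul {ι κ : Type*} [Fintype ι] [Fintype κ]
    (f : Module.Basis ι ℝ E) (β : κ → E) (B : E →ₗ[ℝ] E →ₗ[ℝ] ℝ) :
    (f.toMatrix β).transpose * Matrix.of (fun i j => B (f i) (f j)) * f.toMatrix β =
      Matrix.of (fun i j => B (β i) (β j)) := by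
  ext k l
  have h : ∀ k, β k = ∑ i, f.toMatrix β i k • f i := fun k => (f.sum_toMatrix_smul_self β k).symm
  rw [Matrix.of_apply, h k, h l]
  simp only [Matrix.mul_apply, Matrix.transpose_apply, Matrix.of_apply, map_sum, map_smul,
    LinearMap.sum_apply, LinearMap.smul_apply, smul_eq_mul, Finset.sum_mul, Finset.mul_sum]
  refine Finset.sum_congr rfl fun i _ => Finset.sum_congr rfl fun j _ => ?_
  ring

/-- The covariant Hessian as a bilinear form. -/
noncomputable def hessB (G : E → E →L[ℝ] E →L[ℝ] ℝ) (v : E → ℝ) (y : E) : E →ₗ[ℝ] E →ₗ[ℝ] ℝ :=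
  LinearMap.mk₂ ℝ (hessE G v y) (by intros; simp [hessE, chr]; ring)
    (by intros; simp [hessE, chr]; ring) (by intros; simp [hessE, chr]; ring)
    (by intros; simp [hessE, chr]; ring)

/-- The graph metric `G + dv ⊗ dv` as a bilinear form. -/
noncomputable def gramB (G : E → E →L[ℝ] E →L[ℝ] ℝ) (v : E → ℝ) (y : E) : E →ₗ[ℝ] E →ₗ[ℝ] ℝ :=
  LinearMap.mk₂ ℝ (fun a b => G y a b + fderiv ℝ v y a * fderiv ℝ v y b)
    (by intros; simp; ring) (by intros; simp; ring) (by intros; simp; ring)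
    (by intros; simp; ring)

/-- The elementary symmetric functions of the shape operator, computed in any basis, from a frame
which diagonalizes it. -/
theorem matSigma_shapeMat {n : ℕ} {G : E → E →L[ℝ] E →L[ℝ] ℝ} {v η : E → ℝ} {x : E}
    {α : ℝ} (hα : α ≠ 0) {d : Fin n → ℝ} {β : Fin n → E}
    (hg : ∀ i j, gramMat G v β x i j = if i = j then α else 0)
    (hB : ∀ i j, shapeMat G v η β x i j = if i = j then d i else 0)
    (f : Module.Basis (Fin n) ℝ E) (k : ℕ) :
    matSigma ((gramMat G v f x)⁻¹ * shapeMat G v η f x) k =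
      esym Finset.univ (fun i => α⁻¹ * d i) k := by
  refine matSigma_inv_mul (R := f.toMatrix β) hα ?_ ?_ k
  · refine (toMatrix_transpose_mul_mul f β (gramB G v x)).trans ?_
    ext i j
    refine (hg i j).trans ?_
    simp [Matrix.smul_apply, Matrix.one_apply]
  · refine (toMatrix_transpose_mul_mul f β (η x • gramB G v x - hessB G v x)).trans ?_
    ext i j
    refine (hB i j).trans ?_
    simp [Matrix.diagonal_apply]

variable [FiniteDimensional ℝ E]

/-- `gramMat` and `shapeMat` are tensors. -/
theorem gramMat_shapeMat_pullMetric {ι : Type*} {G : E → E →L[ℝ] E →L[ℝ] ℝ} {θ : E → E}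
    {Θ : E → E →L[ℝ] E} {v η : E → ℝ} {y : E} {Θ' : E →L[ℝ] E →L[ℝ] E}
    (hG : DifferentiableAt ℝ G (θ y))
    (hs : ∀ a b, G (θ y) a b = G (θ y) b a) (hpos : ∀ a, a ≠ 0 → 0 < G (θ y) a a)
    (hθ : ∀ᶠ x in 𝓝 y, HasFDerivAt θ (Θ x) x) (hΘ : HasFDerivAt Θ Θ' y)
    (hΘs : ∀ a b, Θ' a b = Θ' b a) (hinj : Function.Injective (Θ y))
    (hv : ContDiffAt ℝ 2 v (θ y)) (f : ι → E) :
    gramMat (pullMetric G θ Θ) (fun y => v (θ y)) f y = gramMat G v (fun i => Θ y (f i)) (θ y) ∧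
    shapeMat (pullMetric G θ Θ) (fun y => v (θ y)) (fun y => η (θ y)) f y =
      shapeMat G v η (fun i => Θ y (f i)) (θ y) := by
  have h1 : gramMat (pullMetric G θ Θ) (fun y => v (θ y)) f y =
      gramMat G v (fun i => Θ y (f i)) (θ y) := by
    ext i j
    simp only [gramMat, fderiv_comp_apply (hv.differentiableAt (by simp)) hθ.self_of_nhds]
    simp [pullMetric]
  refine ⟨h1, ?_⟩
  ext i j
  rw [shapeMat, shapeMat, h1, hessE_pullMetric hG hs hpos hθ hΘ hΘs hinj hv]

end shapeFrame

/-! ### Bounds for the prescribed curvature function -/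

section chartPsi

set_option maxSynthPendingDepth 3

open scoped Topology

/-- Derivatives of a `C¹` function on an arbitrary set can be chosen to be bounded on compact
subsets. They need not be unique, nor continuous, as the set may fail to be uniquely
differentiable. -/
theorem exists_bound_of_contDiffOn_one {X Y : Type*} [NormedAddCommGroup X] [NormedSpace ℝ X]
    [NormedAddCommGroup Y] [NormedSpace ℝ Y] {f : X → Y} {S Q : Set X} (hf : ContDiffOn ℝ 1 f S)
    (hQ : IsCompact Q) (hQS : Q ⊆ S) :
    ∃ C, 0 ≤ C ∧ ∀ q ∈ Q, ∃ f' : X →L[ℝ] Y, HasFDerivWithinAt f f' S q ∧ ‖f'‖ ≤ C := by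
  let P : Set X → Prop := fun U => ∃ C, 0 ≤ C ∧
    ∀ q ∈ U ∩ S, ∃ f' : X →L[ℝ] Y, HasFDerivWithinAt f f' S q ∧ ‖f'‖ ≤ C
  obtain ⟨C, hC0, hC⟩ : P Q := by
    refine hQ.induction_on ⟨0, le_rfl, by simp⟩ ?_ ?_ ?_
    · rintro U V hUV ⟨C, hC0, hC⟩
      exact ⟨C, hC0, fun q hq => hC q ⟨hUV hq.1, hq.2⟩⟩
    · rintro U V ⟨C, hC0, hC⟩ ⟨D, hD0, hD⟩
      refine ⟨max C D, hC0.trans (le_max_left _ _), ?_⟩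
      rintro q ⟨hq | hq, hqS⟩
      · obtain ⟨f', h1, h2⟩ := hC q ⟨hq, hqS⟩
        exact ⟨f', h1, h2.trans (le_max_left _ _)⟩
      · obtain ⟨f', h1, h2⟩ := hD q ⟨hq, hqS⟩
        exact ⟨f', h1, h2.trans (le_max_right _ _)⟩
    · intro q hq
      have h1 := hf q (hQS hq)
      rw [show (1 : WithTop ℕ∞) = 0 + 1 by norm_num,
        contDiffWithinAt_succ_iff_hasFDerivWithinAt (by simp)] at h1
      obtain ⟨u, hu, -, f', hf', hc⟩ := h1
      rw [insert_eq_of_mem (hQS hq)] at hu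
      have hc1 : ContinuousWithinAt f' S q :=
        (hc.continuousWithinAt).mono_of_mem_nhdsWithin hu
      have hc2 : ∀ᶠ y in 𝓝[S] q, ‖f' y‖ < ‖f' q‖ + 1 :=
        hc1.norm.eventually (gt_mem_nhds (lt_add_one _))
      have hu2 : ∀ᶠ y in 𝓝[S] q, u ∈ 𝓝[S] y :=
        (eventually_eventually_nhdsWithin (p := fun y => y ∈ u)).2 hu
      have hev : ∀ᶠ y in 𝓝[S] q, ∃ L : X →L[ℝ] Y,
          HasFDerivWithinAt f L S y ∧ ‖L‖ ≤ ‖f' q‖ + 1 := by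
        filter_upwards [hu, hc2, hu2] with y hy1 hy2 hy3
        exact ⟨f' y, (hf' y hy1).mono_of_mem_nhdsWithin hy3, hy2.le⟩
      exact ⟨_, nhdsWithin_mono q hQS hev, ‖f' q‖ + 1, by positivity, fun y hy => hy.1⟩
  exact ⟨C, hC0, fun q hq => hC q ⟨hq, hQS hq⟩⟩

variable {n : ℕ} {M : Type*} [TopologicalSpace M]
  [ChartedSpace (EuclideanSpace ℝ (Fin n)) M]
  [IsManifold (𝓡 n) ∞ M]

/-- The function `ψ` on the unit tangent bundle in the coordinates `(t, a, x, ξ)` given by the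
chart at `c`, for the vector `a ∂_t + ξ` at the point `(t, x)`. -/
noncomputable def chartPsi (ψ : ℝ → (u : M) → ℝ × TangentSpace (𝓡 n) u → ℝ) (c : M)
    (q : ℝ × ℝ × EuclideanSpace ℝ (Fin n) × EuclideanSpace ℝ (Fin n)) : ℝ :=
  ψ q.1 ((extChartAt (𝓡 n) c).symm q.2.2.1) (q.2.1, chartDeriv c q.2.2.1 q.2.2.2)

/-- The unit tangent bundle in the coordinates `(t, a, x, ξ)`. -/
def chartUnitBundle (g : SmoothMetric n M) (h : ℝ → ℝ) (I : Set ℝ) (c : M) :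
    Set (ℝ × ℝ × EuclideanSpace ℝ (Fin n) × EuclideanSpace ℝ (Fin n)) :=
  {q | q.1 ∈ I ∧ q.2.2.1 ∈ (extChartAt (𝓡 n) c).target ∧
    q.2.1 ^ 2 + h q.1 ^ 2 * chartMetric g c q.2.2.1 q.2.2.2 q.2.2.2 = 1}

theorem contDiffOn_chartPsi {g : SmoothMetric n M} {h : ℝ → ℝ} {I : Set ℝ}
    {ψ : ℝ → (u : M) → ℝ × TangentSpace (𝓡 n) u → ℝ} (hψ : IsC1OnUnitBundle g h I ψ) (c : M) :
    ContDiffOn ℝ 1 (chartPsi ψ c) (chartUnitBundle g h I c) := by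
  rw [← contMDiffOn_iff_contDiffOn]
  have h1 : ContMDiffOn 𝓘(ℝ, EuclideanSpace ℝ (Fin n) × EuclideanSpace ℝ (Fin n))
      ((𝓡 n).tangent) 1
      (fun q : EuclideanSpace ℝ (Fin n) × EuclideanSpace ℝ (Fin n) =>
        (⟨(extChartAt (𝓡 n) c).symm q.1, chartDeriv c q.1 q.2⟩ : TangentBundle (𝓡 n) M))
      ((extChartAt (𝓡 n) c).target ×ˢ univ) :=
    (contMDiffOn_chartDeriv c).of_le (WithTop.coe_le_coe.2 le_top)
  have h2 : ContMDiffOn 𝓘(ℝ, ℝ × ℝ × EuclideanSpace ℝ (Fin n) × EuclideanSpace ℝ (Fin n))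
      ((𝓡 n).tangent) 1
      (fun q : ℝ × ℝ × EuclideanSpace ℝ (Fin n) × EuclideanSpace ℝ (Fin n) =>
        (⟨(extChartAt (𝓡 n) c).symm q.2.2.1, chartDeriv c q.2.2.1 q.2.2.2⟩ :
          TangentBundle (𝓡 n) M)) (chartUnitBundle g h I c) :=
    h1.comp (t := (extChartAt (𝓡 n) c).target ×ˢ univ)
      (f := fun q : ℝ × ℝ × EuclideanSpace ℝ (Fin n) × EuclideanSpace ℝ (Fin n) => q.2.2)
      ((contDiff_snd.snd).contMDiff.contMDiffOn) (fun q hq => ⟨hq.2.1, trivial⟩)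
  have h3 : ContMDiffOn 𝓘(ℝ, ℝ × ℝ × EuclideanSpace ℝ (Fin n) × EuclideanSpace ℝ (Fin n))
      (𝓘(ℝ, ℝ).prod (𝓘(ℝ, ℝ).prod ((𝓡 n).tangent))) 1
      (fun q : ℝ × ℝ × EuclideanSpace ℝ (Fin n) × EuclideanSpace ℝ (Fin n) =>
        (q.1, q.2.1, (⟨(extChartAt (𝓡 n) c).symm q.2.2.1, chartDeriv c q.2.2.1 q.2.2.2⟩ :
          TangentBundle (𝓡 n) M))) (chartUnitBundle g h I c) :=
    contDiff_fst.contMDiff.contMDiffOn.prodMk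
      ((contDiff_snd.fst).contMDiff.contMDiffOn.prodMk h2)
  refine hψ.comp h3 fun q hq => ?_
  refine ⟨hq.1, ?_⟩
  rw [← hq.2.2, sq]
  rfl

theorem exists_bound_norm_of_posDef {E : Type*} [NormedAddCommGroup E] [NormedSpace ℝ E]
    [FiniteDimensional ℝ E] {G : E → E →L[ℝ] E →L[ℝ] ℝ} {x : E} (hG : ContinuousAt G x)
    (hs : ∀ᶠ y in 𝓝 x, ∀ a b, G y a b = G y b a)
    (hpos : ∀ᶠ y in 𝓝 x, ∀ a, a ≠ 0 → 0 < G y a a) :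
    ∃ C, 0 ≤ C ∧ ∀ᶠ y in 𝓝 x, ∀ a, ‖a‖ ≤ C * Real.sqrt (G y a a) := by
  obtain ⟨C, hC0, hC⟩ := exists_bound_norm_of_unit hG hs hpos
  refine ⟨C, hC0, ?_⟩
  filter_upwards [hC, hpos] with y hy hp a
  by_cases ha : a = 0
  · rw [ha, norm_zero]; positivity
  · have h1 := hp a ha
    have h2 := Real.sqrt_pos.2 h1
    have h3 := Real.sq_sqrt h1.le
    have h4 := hy ((Real.sqrt (G y a a))⁻¹ • a) (by
      simp only [map_smul, smul_apply, smul_eq_mul]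
      field_simp
      exact h3.symm)
    rw [norm_smul, norm_inv, Real.norm_eq_abs, abs_of_pos h2, inv_mul_le_iff₀ h2] at h4
    linarith

/-- Locally uniform bounds for `ψ` and its derivative on the unit tangent bundle. -/
theorem exists_bounds_chartPsi {g : SmoothMetric n M} {h : ℝ → ℝ} {I K : Set ℝ}
    {ψ : ℝ → (u : M) → ℝ × TangentSpace (𝓡 n) u → ℝ} (hψ : IsC1OnUnitBundle g h I ψ)
    (hψpos : ∀ t ∈ I, ∀ (u : M) (ν : ℝ × TangentSpace (𝓡 n) u),
      warpedInner g h t u ν ν = 1 → 0 < ψ t u ν)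
    (hh : ContinuousOn h I) (hpos : ∀ t ∈ I, 0 < h t) (hK : IsCompact K) (hKI : K ⊆ I)
    {c : M} {x₀ : EuclideanSpace ℝ (Fin n)} (hx₀ : x₀ ∈ (extChartAt (𝓡 n) c).target) :
    ∃ C c₀ : ℝ, 0 ≤ C ∧ 0 < c₀ ∧ ∀ᶠ x in 𝓝 x₀, ∀ t ∈ K, ∀ (a : ℝ) (ξ : EuclideanSpace ℝ (Fin n)),
      a ^ 2 + h t ^ 2 * chartMetric g c x ξ ξ = 1 →
      c₀ ≤ chartPsi ψ c (t, a, x, ξ) ∧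
      ∃ f' : (ℝ × ℝ × EuclideanSpace ℝ (Fin n) × EuclideanSpace ℝ (Fin n)) →L[ℝ] ℝ,
        HasFDerivWithinAt (chartPsi ψ c) f' (chartUnitBundle g h I c) (t, a, x, ξ) ∧ ‖f'‖ ≤ C := by
  have hT : IsOpen (extChartAt (𝓡 n) c).target := isOpen_extChartAt_target c
  have hGc : ContinuousOn (chartMetric g c) (extChartAt (𝓡 n) c).target :=
    (contDiffOn_chartMetric g c).continuousOn
  have hGp : ∀ᶠ y in 𝓝 x₀, ∀ a, a ≠ 0 → 0 < chartMetric g c y a a := by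
    filter_upwards [hT.mem_nhds hx₀] with y hy using chartMetric_pos g hy
  obtain ⟨C₁, hC₁, hb⟩ := exists_bound_norm_of_posDef (hGc.continuousAt (hT.mem_nhds hx₀))
    (Filter.Eventually.of_forall fun y => chartMetric_symm g c y) hGp
  obtain ⟨m, hm, hmK⟩ := hK.exists_forall_le' (hh.mono hKI) (fun t ht => hpos t (hKI ht))
  obtain ⟨r, hr, hball⟩ := Metric.nhds_basis_closedBall.mem_iff.1
    (Filter.inter_mem (Filter.inter_mem (hT.mem_nhds hx₀) hb) hGp)
  let D : Set (ℝ × ℝ × EuclideanSpace ℝ (Fin n) × EuclideanSpace ℝ (Fin n)) :=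
    K ×ˢ Icc (-1) 1 ×ˢ Metric.closedBall x₀ r ×ˢ Metric.closedBall 0 (C₁ * m⁻¹)
  have hD : IsCompact D := hK.prod (isCompact_Icc.prod
    ((isCompact_closedBall _ _).prod (isCompact_closedBall _ _)))
  let F : (ℝ × ℝ × EuclideanSpace ℝ (Fin n) × EuclideanSpace ℝ (Fin n)) → ℝ := fun q =>
    q.2.1 ^ 2 + h q.1 ^ 2 * chartMetric g c q.2.2.1 q.2.2.2 q.2.2.2
  have hF : ContinuousOn F D := by
    have h1 : ContinuousOn (fun q : ℝ × ℝ × EuclideanSpace ℝ (Fin n) × EuclideanSpace ℝ (Fin n) =>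
        h q.1) D := hh.comp continuousOn_fst fun q hq => hKI hq.1
    have h2 : ContinuousOn (fun q : ℝ × ℝ × EuclideanSpace ℝ (Fin n) × EuclideanSpace ℝ (Fin n) =>
        chartMetric g c q.2.2.1) D :=
      ContinuousOn.comp (g := chartMetric g c)
        (f := fun q : ℝ × ℝ × EuclideanSpace ℝ (Fin n) × EuclideanSpace ℝ (Fin n) => q.2.2.1)
        hGc (by fun_prop) fun q hq => (hball hq.2.2.1).1.1
    have h3 : ContinuousOn (fun q : ℝ × ℝ × EuclideanSpace ℝ (Fin n) × EuclideanSpace ℝ (Fin n) =>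
        q.2.2.2) D := by fun_prop
    exact ContinuousOn.add (by fun_prop) ((h1.pow 2).mul ((h2.clm_apply h3).clm_apply h3))
  have hQ : IsCompact (D ∩ F ⁻¹' {1}) := hD.of_isClosed_subset
    (hF.preimage_isClosed_of_isClosed hD.isClosed isClosed_singleton) inter_subset_left
  have hQS : D ∩ F ⁻¹' {1} ⊆ chartUnitBundle g h I c := fun q hq =>
    ⟨hKI hq.1.1, (hball hq.1.2.2.1).1.1, hq.2⟩
  have hreg := contDiffOn_chartPsi hψ c
  obtain ⟨C, hC0, hC⟩ := exists_bound_of_contDiffOn_one hreg hQ hQS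
  obtain ⟨c₀, hc₀, hc⟩ := hQ.exists_forall_le' (hreg.continuousOn.mono hQS) (a := 0) (fun q hq => by
    refine hψpos q.1 (hQS hq).1 _ _ ?_
    rw [← (hQS hq).2.2, sq]
    rfl)
  refine ⟨C, c₀, hC0, hc₀, ?_⟩
  filter_upwards [Metric.closedBall_mem_nhds x₀ hr] with x hx t ht a ξ hu
  have hmt := hmK t ht
  have hGn : 0 ≤ chartMetric g c x ξ ξ := by
    by_cases h0 : ξ = 0
    · rw [h0]; simp
    · exact ((hball hx).2 ξ h0).le
  have hq : (t, a, x, ξ) ∈ D ∩ F ⁻¹' {1} := by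
    refine ⟨⟨ht, ?_, hx, ?_⟩, hu⟩
    · have h1 : 0 ≤ h t ^ 2 * chartMetric g c x ξ ξ := by positivity
      exact abs_le.1 (abs_le_one_iff_mul_self_le_one.2 (by nlinarith))
    · rw [mem_closedBall_zero_iff]
      refine ((hball hx).1.2 ξ).trans (mul_le_mul_of_nonneg_left ?_ hC₁)
      have h2 : (h t * Real.sqrt (chartMetric g c x ξ ξ)) ^ 2 ≤ 1 := by
        rw [mul_pow, Real.sq_sqrt hGn]; nlinarith [sq_nonneg a]
      have h3 : h t * Real.sqrt (chartMetric g c x ξ ξ) ≤ 1 := by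
        nlinarith [mul_nonneg (hm.le.trans hmt) (Real.sqrt_nonneg (chartMetric g c x ξ ξ))]
      rw [← one_div, le_div_iff₀ hm]
      nlinarith [Real.sqrt_nonneg (chartMetric g c x ξ ξ)]
  exact ⟨hc _ hq, hC _ hq⟩

end chartPsi

/-! ### Solutions of the curvature equation -/

section weighted

set_option maxSynthPendingDepth 3

open scoped Topology

/-- If `h^k ψ` is nonincreasing in `t` along vectors which are parallel in the warped product, its
derivative along a curve on which `t` increases is bounded through the remaining components of the
velocity. -/
theorem exists_hasDerivAt_weighted_le {E : Type*} [NormedAddCommGroup E] [NormedSpace ℝ E]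
    {f : ℝ × ℝ × E × E → ℝ} {S : Set (ℝ × ℝ × E × E)} {f' : (ℝ × ℝ × E × E) →L[ℝ] ℝ} {h : ℝ → ℝ}
    {h' t₀ a₀ C : ℝ} {x₀ ξ₀ : E} {k : ℕ} (hf : HasFDerivWithinAt f f' S (t₀, a₀, x₀, ξ₀))
    (hC : ‖f'‖ ≤ C) (hh : HasDerivAt h h' t₀) (h0 : 0 < h t₀)
    (hS : ∀ᶠ t in 𝓝 t₀, (t, a₀, x₀, (h t₀ / h t) • ξ₀) ∈ S)
    (hdt : deriv (fun t => h t ^ k * f (t, a₀, x₀, (h t₀ / h t) • ξ₀)) t₀ ≤ 0)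
    {q : ℝ → ℝ × ℝ × E × E} {t' a' : ℝ} {x' ξ' : E} (hq0 : q 0 = (t₀, a₀, x₀, ξ₀))
    (hq : HasDerivAt q (t', a', x', ξ') 0) (hqS : ∀ᶠ s in 𝓝 0, q s ∈ S) (ht' : 0 ≤ t') :
    ∃ Ψ', HasDerivAt (fun s => h (q s).1 ^ k * f (q s)) Ψ' 0 ∧
      Ψ' ≤ h t₀ ^ k * (C * ‖((0 : ℝ), a', x', ξ' + (t' * (h' / h t₀)) • ξ₀)‖) := by
  -- the derivative along the `t`-line
  have hr : HasDerivAt (fun t => (t, a₀, x₀, (h t₀ / h t) • ξ₀))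
      (1, 0, 0, (-(h' / h t₀)) • ξ₀) t₀ := by
    have h1 : HasDerivAt (fun t => h t₀ / h t) (-(h' / h t₀)) t₀ := by
      have := (hasDerivAt_const t₀ (h t₀)).fun_div hh h0.ne'
      refine this.congr_deriv ?_
      field_simp; ring
    exact (hasDerivAt_id t₀).prodMk ((hasDerivAt_const t₀ a₀).prodMk
      ((hasDerivAt_const t₀ x₀).prodMk (h1.smul_const ξ₀)))
  have hr0 : (t₀, a₀, x₀, (h t₀ / h t₀) • ξ₀) = (t₀, a₀, x₀, ξ₀) := by
    rw [div_self h0.ne', one_smul]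
  have h1 : HasDerivAt (fun t => f (t, a₀, x₀, (h t₀ / h t) • ξ₀))
      (f' (1, 0, 0, (-(h' / h t₀)) • ξ₀)) t₀ :=
    HasFDerivWithinAt.comp_hasDerivAt (l := f) t₀ (by rwa [hr0]) hr hS
  have h2 := ((hh.fun_pow k).mul h1).deriv
  have h3 : HasDerivAt (fun s => f (q s)) (f' (t', a', x', ξ')) 0 :=
    HasFDerivWithinAt.comp_hasDerivAt (l := f) 0 (by rwa [hq0]) hq hqS
  have h4 : HasDerivAt (fun s => (q s).1) t' 0 := hq.fst
  have hh' : HasDerivAt h h' (q 0).1 := by rwa [hq0]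
  have h5 : HasDerivAt (fun s => h (q s).1) (h' * t') 0 := hh'.comp 0 h4
  refine ⟨_, (h5.fun_pow k).mul h3, ?_⟩
  have h6 : (t', a', x', ξ') = t' • ((1 : ℝ), (0 : ℝ), (0 : E), (-(h' / h t₀)) • ξ₀) +
      ((0 : ℝ), a', x', ξ' + (t' * (h' / h t₀)) • ξ₀) := by
    ext <;> simp [smul_smul]
  have h7 := (le_abs_self _).trans ((f'.le_opNorm ((0 : ℝ), a', x', ξ' + (t' * (h' / h t₀)) • ξ₀)).trans
    (mul_le_mul_of_nonneg_right hC (norm_nonneg _)))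
  have h8 : f' (t', a', x', ξ') = t' * f' ((1 : ℝ), (0 : ℝ), (0 : E), (-(h' / h t₀)) • ξ₀) +
      f' ((0 : ℝ), a', x', ξ' + (t' * (h' / h t₀)) • ξ₀) := by
    rw [h6, map_add, map_smul, smul_eq_mul]
  rw [h8, hq0]
  replace h2 := h2.symm.trans_le hdt
  simp only [hr0] at h2
  have h9 := mul_le_mul_of_nonneg_left h7 (pow_nonneg h0.le k)
  have h10 := mul_nonpos_of_nonneg_of_nonpos ht' h2
  simp only at h10 ⊢
  nlinarith

end weighted

section solution

set_option maxSynthPendingDepth 3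

open scoped Topology

variable {n : ℕ} {M : Type*} [TopologicalSpace M]
  [ChartedSpace (EuclideanSpace ℝ (Fin n)) M]
  [IsManifold (𝓡 n) ∞ M]

/-- The graph of `z`, of height in `K`, with inward unit normal `ν` and principal curvatures `κ`,
solves `σ_k(κ) = ψ(V, ν)`, and `h^k ψ` is nonincreasing in `t` at `ν`. -/
structure IsSolution (g : SmoothMetric n M) (h : ℝ → ℝ) (k : ℕ)
    (ψ : ℝ → (u : M) → ℝ × TangentSpace (𝓡 n) u → ℝ) (K : Set ℝ) (z : M → ℝ)
    (ν : (u : M) → ℝ × TangentSpace (𝓡 n) u) (κ : M → Fin n → ℝ) : Prop where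
  contMDiff : ContMDiff (𝓡 n) 𝓘(ℝ, ℝ) 3 z
  mem : ∀ u, z u ∈ K
  normal : ∀ u, IsInwardUnitNormal g h z u (ν u)
  curvatures : ∀ u, IsPrincipalCurvatures g h z u (ν u) (κ u)
  equation : ∀ u, sigmaK k (κ u) = ψ (z u) u (ν u)
  dt_nonpos : ∀ u, dtWeighted h k ψ (z u) u (ν u) ≤ 0

variable {g : SmoothMetric n M} {h s : ℝ → ℝ} {k : ℕ} {I K : Set ℝ}
  {ψ : ℝ → (u : M) → ℝ × TangentSpace (𝓡 n) u → ℝ} {z : M → ℝ}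
  {ν : (u : M) → ℝ × TangentSpace (𝓡 n) u} {κ : M → Fin n → ℝ}

/-- The length element `√(1 + |∇v|²)` of the graph of `v = s ∘ z`, in the chart at `c`. -/
noncomputable def chartLength (g : SmoothMetric n M) (s : ℝ → ℝ) (z : M → ℝ) (c : M)
    (x : EuclideanSpace ℝ (Fin n)) : ℝ :=
  Real.sqrt (1 + fderiv ℝ (fun y => s (chartFun z c y)) x
    (gradE (chartMetric g c) (fun y => s (chartFun z c y)) x))

/-- The unit normal and the shape operator of a solution in terms of `v = s ∘ z`: the eigenvalues of
`h' (g' + dv ⊗ dv) - ∇²v` with respect to `g' + dv ⊗ dv` are `h ω κ_i`. -/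
theorem IsSolution.chart_normal (H : IsSolution g h k ψ K z ν κ) (hI : IsOpen I) (hKI : K ⊆ I)
    (hreg : ContDiffOn ℝ 2 h I) (hpos : ∀ t ∈ I, 0 < h t) (hs : ∀ t ∈ I, HasDerivAt s (h t)⁻¹ t)
    {c : M} {x : EuclideanSpace ℝ (Fin n)} (hx : x ∈ (extChartAt (𝓡 n) c).target) :
    0 ≤ fderiv ℝ (fun y => s (chartFun z c y)) x
      (gradE (chartMetric g c) (fun y => s (chartFun z c y)) x) ∧
    ν ((extChartAt (𝓡 n) c).symm x) = (-(chartLength g s z c x)⁻¹,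
      chartDeriv c x ((h (chartFun z c x) * chartLength g s z c x)⁻¹ •
        gradE (chartMetric g c) (fun y => s (chartFun z c y)) x)) ∧
    ∀ (f : Module.Basis (Fin n) ℝ (EuclideanSpace ℝ (Fin n))) (j : ℕ),
      matSigma ((gramMat (chartMetric g c) (fun y => s (chartFun z c y)) f x)⁻¹ *
        shapeMat (chartMetric g c) (fun y => s (chartFun z c y))
          (fun y => deriv h (chartFun z c y)) f x) j =
        (h (chartFun z c x) * chartLength g s z c x) ^ j *
          sigmaK j (κ ((extChartAt (𝓡 n) c).symm x)) := by
  have hzI : chartFun z c x ∈ I := hKI (H.mem _)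
  have h0 := hpos _ hzI
  have hs' : ∀ᶠ t in 𝓝 (chartFun z c x), HasDerivAt s (h t)⁻¹ t := by
    filter_upwards [hI.mem_nhds hzI] with t ht using hs t ht
  have hh : HasDerivAt h (deriv h (chartFun z c x)) (chartFun z c x) :=
    ((hreg.contDiffAt (hI.mem_nhds hzI)).differentiableAt (by simp)).hasDerivAt
  obtain ⟨h1, h2, β, h3, h4⟩ := exists_frame_of_isPrincipalCurvatures hx H.contMDiff hs' hh h0
    (H.normal _) (H.curvatures _) rfl (w := chartLength g s z c x) rfl
  refine ⟨h1, h2, fun f j => ?_⟩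
  have hw : 0 < chartLength g s z c x := Real.sqrt_pos.2 (by linarith)
  have hα : ((h (chartFun z c x) ^ 2)⁻¹ : ℝ) ≠ 0 := by positivity
  rw [matSigma_shapeMat (β := β) hα (d := fun i => chartLength g s z c x / h (chartFun z c x) *
    κ ((extChartAt (𝓡 n) c).symm x) i) ?_ ?_ f j]
  · rw [← esym_univ_eq_sigmaK, ← esym_smul]
    congr 1
    ext i
    field_simp
  · intro i j
    have := h3 i j
    split_ifs at this ⊢
    · field_simp; linarith
    · exact (mul_eq_zero.1 this).resolve_left (by positivity)
  · intro i j
    have := h4 i j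
    rw [shapeMat]
    split_ifs at this ⊢
    · rw [← this]; field_simp
    · have h5 : (chartLength g s z c x)⁻¹ * h (chartFun z c x) ≠ 0 := by positivity
      exact (mul_eq_zero.1 this).resolve_left h5

end solution

/-! ### The Gauss lift in a chart -/

section state

set_option maxSynthPendingDepth 3

open scoped Topology

variable {n : ℕ} {M : Type*} [TopologicalSpace M]
  [ChartedSpace (EuclideanSpace ℝ (Fin n)) M]
  [IsManifold (𝓡 n) ∞ M] {g : SmoothMetric n M} {h s : ℝ → ℝ} {k : ℕ} {I K : Set ℝ}
  {ψ : ℝ → (u : M) → ℝ × TangentSpace (𝓡 n) u → ℝ} {z : M → ℝ}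
  {ν : (u : M) → ℝ × TangentSpace (𝓡 n) u} {κ : M → Fin n → ℝ}

/-- The Gauss lift of the graph of `z` to the unit tangent bundle, in the chart at `c`: the point
of the graph over `x` and its inward unit normal, in the coordinates `(t, a, x, ξ)`. -/
noncomputable def chartLift (g : SmoothMetric n M) (h s : ℝ → ℝ) (z : M → ℝ) (c : M)
    (x : EuclideanSpace ℝ (Fin n)) :
    ℝ × ℝ × EuclideanSpace ℝ (Fin n) × EuclideanSpace ℝ (Fin n) :=
  (chartFun z c x, -(chartLength g s z c x)⁻¹, x, (h (chartFun z c x) * chartLength g s z c x)⁻¹ •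
    gradE (chartMetric g c) (fun y => s (chartFun z c y)) x)

theorem IsSolution.chartLift_mem (H : IsSolution g h k ψ K z ν κ) (hI : IsOpen I) (hKI : K ⊆ I)
    (hreg : ContDiffOn ℝ 2 h I) (hpos : ∀ t ∈ I, 0 < h t) (hs : ∀ t ∈ I, HasDerivAt s (h t)⁻¹ t)
    {c : M} {x : EuclideanSpace ℝ (Fin n)} (hx : x ∈ (extChartAt (𝓡 n) c).target) :
    chartLift g h s z c x ∈ chartUnitBundle g h I c := by
  obtain ⟨-, h1, -⟩ := H.chart_normal hI hKI hreg hpos hs hx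
  have h2 := (H.normal ((extChartAt (𝓡 n) c).symm x)).1
  rw [h1] at h2
  refine ⟨hKI (H.mem _), hx, ?_⟩
  rw [sq]
  exact h2

/-- The curvature equation in the chart. -/
theorem IsSolution.chartPsi_chartLift (H : IsSolution g h k ψ K z ν κ) (hI : IsOpen I)
    (hKI : K ⊆ I)
    (hreg : ContDiffOn ℝ 2 h I) (hpos : ∀ t ∈ I, 0 < h t) (hs : ∀ t ∈ I, HasDerivAt s (h t)⁻¹ t)
    {c : M} {x : EuclideanSpace ℝ (Fin n)} (hx : x ∈ (extChartAt (𝓡 n) c).target) :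
    sigmaK k (κ ((extChartAt (𝓡 n) c).symm x)) = chartPsi ψ c (chartLift g h s z c x) := by
  obtain ⟨-, h1, -⟩ := H.chart_normal hI hKI hreg hpos hs hx
  rw [H.equation, h1]
  rfl

/-- Parallel transport along the `t`-line keeps the normal in the unit tangent bundle. -/
theorem IsSolution.eventually_mem (H : IsSolution g h k ψ K z ν κ) (hI : IsOpen I) (hKI : K ⊆ I)
    (hreg : ContDiffOn ℝ 2 h I) (hpos : ∀ t ∈ I, 0 < h t) (hs : ∀ t ∈ I, HasDerivAt s (h t)⁻¹ t)
    {c : M} {x : EuclideanSpace ℝ (Fin n)} (hx : x ∈ (extChartAt (𝓡 n) c).target) :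
    ∀ᶠ t in 𝓝 (chartLift g h s z c x).1, (t, (chartLift g h s z c x).2.1, x,
      (h (chartLift g h s z c x).1 / h t) • (chartLift g h s z c x).2.2.2) ∈
        chartUnitBundle g h I c := by
  obtain ⟨h1, -, h2⟩ := H.chartLift_mem hI hKI hreg hpos hs hx
  filter_upwards [hI.mem_nhds h1] with t ht
  refine ⟨ht, hx, ?_⟩
  have h3 := hpos t ht
  rw [← h2]
  simp only [map_smul, smul_apply, smul_eq_mul]
  field_simp
  rfl

/-- The monotonicity of `h^k ψ` in the chart. -/
theorem IsSolution.deriv_nonpos (H : IsSolution g h k ψ K z ν κ) (hI : IsOpen I) (hKI : K ⊆ I)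
    (hreg : ContDiffOn ℝ 2 h I) (hpos : ∀ t ∈ I, 0 < h t) (hs : ∀ t ∈ I, HasDerivAt s (h t)⁻¹ t)
    {c : M} {x : EuclideanSpace ℝ (Fin n)} (hx : x ∈ (extChartAt (𝓡 n) c).target) :
    deriv (fun t => h t ^ k * chartPsi ψ c (t, (chartLift g h s z c x).2.1, x,
      (h (chartLift g h s z c x).1 / h t) • (chartLift g h s z c x).2.2.2))
      (chartLift g h s z c x).1 ≤ 0 := by
  obtain ⟨-, h1, -⟩ := H.chart_normal hI hKI hreg hpos hs hx
  have h2 := H.dt_nonpos ((extChartAt (𝓡 n) c).symm x)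
  rw [dtWeighted, h1] at h2
  refine le_of_eq_of_le ?_ h2
  refine congrArg (fun F => deriv F (chartLift g h s z c x).1) (funext fun t => ?_)
  unfold chartPsi
  rw [map_smul]
  rfl

end state

/-! ### The Gauss lift along the gradient direction -/

section curve

set_option maxSynthPendingDepth 3

open scoped Topology

variable {E : Type*} [NormedAddCommGroup E] [NormedSpace ℝ E]

/-- The derivative of the Gauss lift along a line in normal coordinates, in the direction `e` of the
gradient, at a point which is critical for `log ω - N v`. -/
theorem hasDerivAt_lift_line {G : E → E →L[ℝ] E →L[ℝ] ℝ} {x e : E}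
    (hΓ : ∀ a b, gammaL G x a b = gammaL G x b a) {V : ℝ → E} {W T h : ℝ → ℝ}
    {N p w H t₀ h' : ℝ} (hw : 0 < w) (hwp : w ^ 2 = 1 + p ^ 2) (hH : 0 < H) (hHt : h t₀ = H)
    (hh : HasDerivAt h h' t₀)
    (hV0 : V 0 = p • e) (hV : HasDerivAt V ((N * w ^ 2) • e) 0) (hW0 : W 0 = w)
    (hW : HasDerivAt W (N * p * w) 0) (hT0 : T 0 = t₀) (hT : HasDerivAt T (H * p) 0) :
    ∃ ξ' : E, HasDerivAt (fun s : ℝ => (T s, -(W s)⁻¹, normalMap G x (s • e),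
        (h (T s) * W s)⁻¹ • normalDeriv G x (s • e) (V s))) (H * p, N * p / w, e, ξ') 0 ∧
      ξ' + (H * p * (h' / H)) • ((H * w)⁻¹ • (p • e)) =
        (N / (H * w)) • e - (p / (H * w)) • gammaL G x e e := by
  have h1 : HasDerivAt (fun s : ℝ => normalMap G x (s • e)) e 0 := by
    have := hasDerivAt_line_zero (ξ := e) (hasFDerivAt_normalMap hΓ 0).differentiableAt
    rw [(hasFDerivAt_normalMap hΓ 0).fderiv, normalDeriv_zero] at this
    exact this
  have h2 : HasDerivAt (fun s : ℝ => normalDeriv G x (s • e)) (-gammaL G x e) 0 := by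
    have := hasDerivAt_line_zero (V := E →L[ℝ] E) (f := normalDeriv G x) (ξ := e)
      (hasFDerivAt_normalDeriv 0).differentiableAt
    rw [(hasFDerivAt_normalDeriv (G := G) (x := x) 0).fderiv] at this
    exact this
  have h3 : HasDerivAt (fun s => h (T s)) (h' * (H * p)) 0 :=
    HasDerivAt.comp (0 : ℝ) (by rwa [hT0]) hT
  have h4 : h (T 0) * W 0 ≠ 0 := by rw [hT0, hHt, hW0]; positivity
  have h5 := (h3.mul hW).fun_inv h4
  have h6 := h5.smul (h2.clm_apply hV)
  have h7 : HasDerivAt (fun s => -(W s)⁻¹) (N * p / w) 0 := by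
    refine (hW.fun_inv (by rw [hW0]; exact hw.ne')).neg.congr_deriv ?_
    rw [hW0]; field_simp
  refine ⟨_, hT.prodMk (h7.prodMk (h1.prodMk h6)), ?_⟩
  simp only [zero_smul, normalDeriv_zero, hT0, hHt, hW0, hV0, Pi.mul_apply]
  simp only [ContinuousLinearMap.id_apply, neg_apply, map_smul]
  have h8 : N / (H * w) = (H * w)⁻¹ * (N * w ^ 2) + (-(h' * (H * p) * w + H * (N * p * w))
      / (H * w) ^ 2) * p + H * p * (h' / H) * ((H * w)⁻¹ * p) := by
    field_simp
    linear_combination (-N) * hwp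
  rw [h8]
  module

/-- The components of the velocity of the Gauss lift other than the one along the parallel `t`-line
are of order `1 + N`, however large the gradient `p` is. -/
theorem norm_lift_line_le {e γ : E} {N p w H m C₁ Cγ : ℝ} (hN : 0 ≤ N) (hw : 0 < w) (hp : 0 ≤ p)
    (hwp : w ^ 2 = 1 + p ^ 2) (hm : 0 < m) (hmH : m ≤ H) (he : ‖e‖ ≤ C₁) (hγ : ‖γ‖ ≤ Cγ) :
    ‖((0 : ℝ), N * p / w, e, (N / (H * w)) • e - (p / (H * w)) • γ)‖ ≤
      (1 + C₁ + (C₁ + Cγ) / m) * (1 + N) := by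
  have hC₁ := (norm_nonneg e).trans he
  have hCγ := (norm_nonneg γ).trans hγ
  have hH := hm.trans_le hmH
  have hpw : p ≤ w := by nlinarith
  have hw1 : 1 ≤ w := by nlinarith
  have h1 : N * p / w ≤ N := by
    rw [div_le_iff₀ hw]; exact mul_le_mul_of_nonneg_left hpw hN
  have h2 : N / (H * w) ≤ N / m := div_le_div_of_nonneg_left hN hm (by nlinarith)
  have h3 : p / (H * w) ≤ 1 / m := by
    rw [div_le_div_iff₀ (by positivity) hm]; nlinarith
  have h4 : ‖(N / (H * w)) • e - (p / (H * w)) • γ‖ ≤ (N * C₁ + Cγ) / m := by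
    refine (norm_sub_le _ _).trans ?_
    rw [norm_smul, norm_smul, Real.norm_of_nonneg (by positivity),
      Real.norm_of_nonneg (by positivity)]
    have h5 := mul_le_mul h2 he (norm_nonneg _) (by positivity)
    have h6 := mul_le_mul h3 hγ (norm_nonneg _) (by positivity)
    calc _ ≤ N / m * C₁ + 1 / m * Cγ := add_le_add h5 h6
      _ = _ := by ring
  have h5 : (N * C₁ + Cγ) / m ≤ (C₁ + Cγ) / m * (1 + N) := by
    rw [div_mul_eq_mul_div]
    exact div_le_div_of_nonneg_right (by nlinarith [mul_nonneg hN hCγ]) hm.le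
  have h6 : 0 ≤ (C₁ + Cγ) / m := by positivity
  have h7 : (C₁ + Cγ) / m ≤ (C₁ + Cγ) / m * (1 + N) := by nlinarith [mul_nonneg h6 hN]
  have h8 : 0 ≤ C₁ * N := mul_nonneg hC₁ hN
  rw [Prod.norm_def, Prod.norm_def, Prod.norm_def]
  simp only [norm_zero]
  refine max_le ?_ (max_le ?_ (max_le ?_ ?_))
  · positivity
  · rw [Real.norm_of_nonneg (by positivity)]; nlinarith
  · nlinarith
  · nlinarith

end curve

/-! ### The gradient estimate at a maximum point on the manifold -/

section localEstimate

set_option maxSynthPendingDepth 3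

open scoped Topology

theorem eventually_injective_normalDeriv {E : Type*} [NormedAddCommGroup E] [NormedSpace ℝ E]
    (G : E → E →L[ℝ] E →L[ℝ] ℝ) (x : E) :
    ∀ᶠ y in 𝓝 0, Function.Injective (normalDeriv G x y) := by
  have h1 : ContinuousAt (fun y => ‖gammaL G x y‖) 0 := (gammaL G x).continuous.norm.continuousAt
  have h2 : ∀ᶠ y in 𝓝 (0 : E), ‖gammaL G x y‖ < 1 :=
    h1.eventually (gt_mem_nhds (by simp))
  filter_upwards [h2] with y hy
  rw [injective_iff_map_eq_zero]
  intro a ha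
  by_contra h0
  have h3 : a = gammaL G x y a := by
    rw [normalDeriv] at ha
    simpa [sub_eq_zero] using ha
  have h4 := (gammaL G x y).le_opNorm a
  rw [← h3] at h4
  nlinarith [norm_pos_iff.2 h0]

variable {d m : ℕ} {M : Type*} [TopologicalSpace M]
  [ChartedSpace (EuclideanSpace ℝ (Fin (d + 1))) M]
  [IsManifold (𝓡 (d + 1)) ∞ M] {g : SmoothMetric (d + 1) M} {h s : ℝ → ℝ} {I K : Set ℝ}
  {ψ : ℝ → (u : M) → ℝ × TangentSpace (𝓡 (d + 1)) u → ℝ} {z : M → ℝ}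
  {ν : (u : M) → ℝ × TangentSpace (𝓡 (d + 1)) u} {κ : M → Fin (d + 1) → ℝ}

set_option maxHeartbeats 1000000 in
/-- At a local maximum of `log ω - N v` which is not critical for `v`, the constant `N` is bounded
in terms of local bounds on the data. -/
theorem IsSolution.sq_le_of_isLocalMax (H : IsSolution g h (m + 1) ψ K z ν κ) (hI : IsOpen I)
    (hKI : K ⊆ I) (hreg : ContDiffOn ℝ 2 h I) (hpos : ∀ t ∈ I, 0 < h t)
    (hs : ∀ t ∈ I, HasDerivAt s (h t)⁻¹ t) (hs3 : ContDiffOn ℝ 3 s I)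
    (hcone : ∀ u, ∀ j ≤ m + 1, 0 < sigmaK j (κ u))
    {c : M} {x : EuclideanSpace ℝ (Fin (d + 1))} (hx : x ∈ (extChartAt (𝓡 (d + 1)) c).target)
    {N C C₁ Cγ C₂ c₀ h₁ h₂ CH CJ : ℝ} (hh₀ : 0 < h₁) (hh₁ : ∀ t ∈ K, h₁ ≤ h t)
    (hh₂ : ∀ t ∈ K, h t ≤ h₂) (hCH : ∀ t ∈ K, |deriv h t| ≤ CH)
    (hCJ : ∀ t ∈ K, |deriv (deriv h) t * h t| ≤ CJ) (hC₁ : 0 ≤ C₁)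
    (hb : ∀ a, chartMetric g c x a a = 1 → ‖a‖ ≤ C₁) (hγ : ‖gammaL (chartMetric g c) x‖ ≤ Cγ)
    (hG2 : ContDiffAt ℝ 2 (fun y => normalMetric (chartMetric g c) x y) 0) (hC₂ : 0 ≤ C₂)
    (hD2 : ∀ a b, ‖fderiv ℝ (fderiv ℝ (fun y => normalMetric (chartMetric g c) x y)) 0 a b‖ ≤
      C₂ * ‖a‖ * ‖b‖) (hC : 0 ≤ C) (hc₀ : 0 < c₀)
    (hψ : ∀ t ∈ K, ∀ (a : ℝ) (ξ : EuclideanSpace ℝ (Fin (d + 1))),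
      a ^ 2 + h t ^ 2 * chartMetric g c x ξ ξ = 1 →
      c₀ ≤ chartPsi ψ c (t, a, x, ξ) ∧
      ∃ f' : (ℝ × ℝ × EuclideanSpace ℝ (Fin (d + 1)) × EuclideanSpace ℝ (Fin (d + 1))) →L[ℝ] ℝ,
        HasFDerivWithinAt (chartPsi ψ c) f' (chartUnitBundle g h I c) (t, a, x, ξ) ∧ ‖f'‖ ≤ C)
    (hN : CH ≤ N)
    (hmax : IsLocalMax (fun u => -Real.log (-(ν u).1) - N * s (z u))
      ((extChartAt (𝓡 (d + 1)) c).symm x))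
    (hne : fderiv ℝ (fun y => s (chartFun z c y)) x ≠ 0) :
    N ^ 2 ≤ ((d + 1 : ℕ) : ℝ) * (CJ + 2 * (2 * (C₂ * C₁ ^ 4)) + N * CH) +
      h₂ ^ (m + 1) * (C * (1 + C₁ + (C₁ + Cγ * C₁ * C₁) / h₁)) * (1 + N) /
        min 1 (h₁ ^ (m + 1) * c₀) := by
  set G := chartMetric g c
  set v : EuclideanSpace ℝ (Fin (d + 1)) → ℝ := fun y => s (chartFun z c y)
  set θ := normalMap G x
  set Θ := normalDeriv G x
  have hT : IsOpen (extChartAt (𝓡 (d + 1)) c).target := isOpen_extChartAt_target c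
  have hGd : ∀ y ∈ (extChartAt (𝓡 (d + 1)) c).target, ContDiffAt ℝ ∞ G y := fun y hy =>
    (contDiffOn_chartMetric g c).contDiffAt (hT.mem_nhds hy)
  have hGd1 : ∀ y ∈ (extChartAt (𝓡 (d + 1)) c).target, DifferentiableAt ℝ G y := fun y hy =>
    (hGd y hy).differentiableAt (by simp)
  have hGs : ∀ y a b, G y a b = G y b a := chartMetric_symm g c
  have hGp : ∀ y ∈ (extChartAt (𝓡 (d + 1)) c).target, ∀ a, a ≠ 0 → 0 < G y a a := fun y hy =>
    chartMetric_pos g hy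
  have hzK : ∀ y : EuclideanSpace ℝ (Fin (d + 1)), chartFun z c y ∈ K := fun y => H.mem _
  have hζd : ∀ y ∈ (extChartAt (𝓡 (d + 1)) c).target, ContDiffAt ℝ 3 (chartFun z c) y :=
    fun y hy => contDiffAt_chartFun H.contMDiff hy
  have hvd : ∀ y ∈ (extChartAt (𝓡 (d + 1)) c).target, ContDiffAt ℝ 3 v y := fun y hy =>
    (hs3.contDiffAt (hI.mem_nhds (hKI (hzK y)))).comp y (hζd y hy)
  have hsym : ∀ a b, gammaL G x a b = gammaL G x b a :=
    gammaL_symm (hGd1 x hx) (Filter.Eventually.of_forall fun y => hGs y)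
  have hθd : ∀ y, HasFDerivAt θ (Θ y) y := hasFDerivAt_normalMap hsym
  have hΘd : ∀ y, HasFDerivAt Θ (-gammaL G x) y := hasFDerivAt_normalDeriv
  have hΘs : ∀ a b, (-gammaL G x) a b = (-gammaL G x) b a := fun a b => by
    simp only [neg_apply, hsym a b]
  have hθ0 : θ 0 = x := normalMap_zero
  have hΘ0 : Θ 0 = ContinuousLinearMap.id ℝ _ := normalDeriv_zero
  have hθT : ∀ᶠ y in 𝓝 0, θ y ∈ (extChartAt (𝓡 (d + 1)) c).target :=
    (hθd 0).continuousAt.eventually (by rw [hθ0]; exact hT.mem_nhds hx)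
  have hinj := eventually_injective_normalDeriv G x
  have hgood := hθT.and hinj
  have hG0 : normalMetric G x 0 = G x := normalMetric_zero
  -- the gradient in normal coordinates
  have hgrad : ∀ y, θ y ∈ (extChartAt (𝓡 (d + 1)) c).target → Function.Injective (Θ y) →
      Θ y (gradE (normalMetric G x) (fun y => v (θ y)) y) = gradE G v (θ y) := fun y hy hi =>
    gradE_pullMetric (hGp _ hy) ((hvd _ hy).differentiableAt (by simp)) (hθd y) hi
  have hW : ∀ y, θ y ∈ (extChartAt (𝓡 (d + 1)) c).target → Function.Injective (Θ y) →
      Real.sqrt (1 + fderiv ℝ (fun y => v (θ y)) y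
        (gradE (normalMetric G x) (fun y => v (θ y)) y)) = chartLength g s z c (θ y) :=
      fun y hy hi => by
    have := fderiv_gradE_pullMetric (Θ := Θ) (hGp _ hy)
      ((hvd _ hy).differentiableAt (by simp)) (hθd y) hi
    exact congrArg (fun r => Real.sqrt (1 + r)) this
  have hmat : ∀ y, θ y ∈ (extChartAt (𝓡 (d + 1)) c).target → Function.Injective (Θ y) →
      ∀ (f : Module.Basis (Fin (d + 1)) ℝ (EuclideanSpace ℝ (Fin (d + 1)))) (j : ℕ),
      matSigma ((gramMat (normalMetric G x) (fun y => v (θ y)) f y)⁻¹ *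
        shapeMat (normalMetric G x) (fun y => v (θ y)) (fun y => deriv h (chartFun z c (θ y))) f y)
        j = (h (chartFun z c (θ y)) * chartLength g s z c (θ y)) ^ j *
          sigmaK j (κ ((extChartAt (𝓡 (d + 1)) c).symm (θ y))) := fun y hy hi f j => by
    obtain ⟨h1, h2⟩ := gramMat_shapeMat_pullMetric (η := fun y => deriv h (chartFun z c y))
      (hGd1 _ hy) (hGs _) (hGp _ hy)
      (Filter.Eventually.of_forall hθd) (hΘd y) hΘs hi ((hvd _ hy).of_le (by norm_num)) (f : _ → _)
    have h3 := (H.chart_normal hI hKI hreg hpos hs hy).2.2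
      (f.map (LinearEquiv.ofInjectiveEndo (Θ y : _ →ₗ[ℝ] _) hi)) j
    refine Eq.trans ?_ h3
    exact congrArg₂ (fun A B => matSigma (A⁻¹ * B) j) h1 h2
  have hN0 : 0 ≤ N := (abs_nonneg _).trans ((hCH _ (hzK x)).trans hN)
  have hunit := (H.chartLift_mem hI hKI hreg hpos hs hx).2.2
  have hψx := hψ _ (hzK x) _ _ hunit
  have hhx : 0 < h (chartFun z c x) := hpos _ (hKI (hzK x))
  have hdζ : ∀ a, fderiv ℝ (chartFun z c) x a = h (chartFun z c x) * fderiv ℝ v x a := fun a => by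
    have h1 := ((hs _ (hKI (hzK x))).comp_hasFDerivAt x
      ((hζd x hx).differentiableAt (by simp)).hasFDerivAt).fderiv
    have h2 : fderiv ℝ v x = (h (chartFun z c x))⁻¹ • fderiv ℝ (chartFun z c) x := h1
    rw [h2, smul_apply, smul_eq_mul, mul_inv_cancel_left₀ hhx.ne']
  have hdv0 : fderiv ℝ (fun y => v (θ y)) 0 = fderiv ℝ v x := by
    have h1 := HasFDerivAt.comp (0 : EuclideanSpace ℝ (Fin (d + 1)))
      (by rw [hθ0]; exact ((hvd x hx).differentiableAt (by simp)).hasFDerivAt) (hθd 0)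
    rw [hΘ0, ContinuousLinearMap.comp_id] at h1
    exact h1.fderiv
  have hDG : ∀ a b a' b', G x a a = 1 → G x b b = 1 → G x a' a' = 1 → G x b' b' = 1 →
      |fderiv ℝ (fderiv ℝ (fun y => normalMetric G x y)) 0 a b a' b'| ≤ C₂ * C₁ ^ 4 :=
      fun a b a' b' ha hb' ha' hb'' => by
    have h1 := (ContinuousLinearMap.le_opNorm₂
      (fderiv ℝ (fderiv ℝ (fun y => normalMetric G x y)) 0 a b) a' b')
    rw [Real.norm_eq_abs] at h1
    have h2 := hD2 a b
    calc _ ≤ C₂ * ‖a‖ * ‖b‖ * ‖a'‖ * ‖b'‖ := h1.trans (by gcongr)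
      _ ≤ C₂ * C₁ * C₁ * C₁ * C₁ := by
        gcongr <;> exact hb _ ‹_›
      _ = C₂ * C₁ ^ 4 := by ring
  refine sq_le_of_localMax (m := m) (G := normalMetric G x) (v := fun y => v (θ y))
    (η := fun y => deriv h (chartFun z c (θ y)))
    (Ψ := fun y => h (chartFun z c (θ y)) ^ (m + 1) * chartPsi ψ c (chartLift g h s z c (θ y)))
    (J := deriv (deriv h) (chartFun z c x) * h (chartFun z c x))
    (c := min 1 (h₁ ^ (m + 1) * c₀)) (CJ := CJ) (CK := 2 * (C₂ * C₁ ^ 4)) (CH := CH)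
    (by simp) hG2 ?_ ?_ ?_ ?_ ?_ hN0 ?_ ?_ ?_ ?_ ?_ ?_ ?_ ?_ ?_ ?_ ?_ ?_ ?_ ?_
  · exact Filter.Eventually.of_forall fun y a b => hGs (θ y) (Θ y a) (Θ y b)
  · filter_upwards [hgood] with y hy a ha
    exact posDef_pullMetric (hGp _ hy.1) hy.2 a ha
  · exact fderiv_normalMetric_zero (hGd1 x hx) (Filter.Eventually.of_forall fun y => hGs y)
      (hGp x hx)
  · have h1 : ContDiffAt ℝ 3 θ 0 := by
      have : ContDiff ℝ 3 (fun y => x + y - (1 / 2 : ℝ) • gammaL G x y y) := by fun_prop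
      exact this.contDiffAt
    exact ContDiffAt.comp (g := v) (f := θ) 0 (by rw [hθ0]; exact hvd x hx) h1
  · -- the derivative of `h'` along the graph, where `dz = h dv`
    have h1 : DifferentiableAt ℝ (fun t => fderiv ℝ h t 1) (chartFun z c x) :=
      (((hreg.contDiffAt (hI.mem_nhds (hKI (hzK x)))).fderiv_right (m := 1)
        le_rfl).differentiableAt one_ne_zero).clm_apply (differentiableAt_const 1)
    have h2 : HasDerivAt (deriv h) (deriv (deriv h) (chartFun z c x)) (chartFun z c x) :=
      h1.hasDerivAt
    have h3 := h2.comp_hasFDerivAt x ((hζd x hx).differentiableAt (by simp)).hasFDerivAt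
    rw [← hθ0] at h3
    refine (h3.comp (0 : EuclideanSpace ℝ (Fin (d + 1))) (hθd 0)).congr_fderiv ?_
    rw [hΘ0, hθ0, hdv0]
    ext a
    simp only [ContinuousLinearMap.comp_id, smul_apply, smul_eq_mul, hdζ a]
    ring
  · simp only [hθ0]
    exact (le_abs_self _).trans ((hCH _ (hzK x)).trans hN)
  · -- the maximum point in normal coordinates, where `-ν.1 = 1 / ω`
    have h1 : ContinuousAt (fun y => (extChartAt (𝓡 (d + 1)) c).symm (θ y)) 0 :=
      ContinuousAt.comp (g := (extChartAt (𝓡 (d + 1)) c).symm)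
        (by rw [hθ0]; exact (contMDiffAt_extChartAt_symm_of_mem hx).continuousAt)
        (hθd 0).continuousAt
    have h2 : ∀ᶠ y in 𝓝 0, Real.log (1 + fderiv ℝ (fun y => v (θ y)) y
        (gradE (normalMetric G x) (fun y => v (θ y)) y)) / 2 - N * v (θ y) =
        -Real.log (-(ν ((extChartAt (𝓡 (d + 1)) c).symm (θ y))).1) -
          N * s (z ((extChartAt (𝓡 (d + 1)) c).symm (θ y))) := by
      filter_upwards [hgood] with y hy
      obtain ⟨h3, h4, -⟩ := H.chart_normal hI hKI hreg hpos hs hy.1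
      have h5 := fderiv_gradE_pullMetric (Θ := Θ) (hGp _ hy.1)
        ((hvd _ hy.1).differentiableAt (by simp)) (hθd y) hy.2
      rw [h4]
      simp only [neg_neg, Real.log_inv]
      rw [← hW y hy.1 hy.2, Real.log_sqrt]
      · rfl
      · have h6 : fderiv ℝ (fun y => v (θ y)) y
          (gradE (normalMetric G x) (fun y => v (θ y)) y) = fderiv ℝ v (θ y) (gradE G v (θ y)) := h5
        rw [h6]
        linarith
    have hmax' : IsLocalMax (fun u => -Real.log (-(ν u).1) - N * s (z u))
      ((extChartAt (𝓡 (d + 1)) c).symm (θ 0)) := by rw [hθ0]; exact hmax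
    have h3 := h1.eventually hmax'
    filter_upwards [h2, h3] with y hy1 hy2
    rw [hy1, h2.self_of_nhds]
    exact hy2
  · rw [hdv0]; exact hne
  · -- the curvature equation
    intro f
    filter_upwards [hgood] with y hy
    rw [hmat y hy.1 hy.2, hW y hy.1 hy.2, H.chartPsi_chartLift hI hKI hreg hpos hs hy.1]
    ring
  · intro f j hj
    have hi0 : Function.Injective (Θ 0) := hinj.self_of_nhds
    have hx0 : θ 0 ∈ (extChartAt (𝓡 (d + 1)) c).target := by rwa [hθ0]
    rw [hmat 0 hx0 hi0]
    have h1 : 0 < h (chartFun z c (θ 0)) := hpos _ (hKI (hzK _))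
    have h2 : 0 < chartLength g s z c (θ 0) :=
      Real.sqrt_pos.2 (by linarith [(H.chart_normal hI hKI hreg hpos hs hx0).1])
    exact mul_pos (by positivity) (hcone _ j hj)
  · -- the derivative of `h^k ψ` along the gradient direction
    intro e p w hp hw hw2 hee hgr hdve hwW hgd hWd
    rw [hG0] at hee
    have hx0 : θ 0 ∈ (extChartAt (𝓡 (d + 1)) c).target := by rwa [hθ0]
    have hgx : gradE G v x = p • e := by
      have := hgrad 0 hx0 hinj.self_of_nhds
      rw [hθ0, hΘ0, hgr] at this
      exact this.symm
    have hwx : chartLength g s z c x = w := by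
      have := hW 0 hx0 hinj.self_of_nhds
      rw [hθ0] at this
      rw [← this, hwW]
    have hTd : HasDerivAt (fun r : ℝ => chartFun z c (θ (r • e))) (h (chartFun z c x) * p) 0 := by
      have h1 : HasFDerivAt (fun y => chartFun z c (θ y)) (fderiv ℝ (chartFun z c) x) 0 := by
        have h2 := HasFDerivAt.comp (0 : EuclideanSpace ℝ (Fin (d + 1)))
          (by rw [hθ0]; exact ((hζd x hx).differentiableAt (by simp)).hasFDerivAt) (hθd 0)
        rwa [hΘ0, ContinuousLinearMap.comp_id] at h2
      have h2 := hasDerivAt_line_zero (ξ := e) h1.differentiableAt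
      rwa [h1.fderiv, hdζ, ← hdv0, hdve] at h2
    obtain ⟨ξ', hq, hξ'⟩ := hasDerivAt_lift_line (G := G) (x := x) (e := e) hsym
      (V := fun r : ℝ => gradE (normalMetric G x) (fun y => v (θ y)) (r • e))
      (W := fun r : ℝ => Real.sqrt (1 + fderiv ℝ (fun y => v (θ y)) (r • e)
        (gradE (normalMetric G x) (fun y => v (θ y)) (r • e))))
      (T := fun r : ℝ => chartFun z c (θ (r • e))) (h := h) hw hw2 hhx rfl
      ((hreg.contDiffAt (hI.mem_nhds (hKI (hzK x)))).differentiableAt (by simp)).hasDerivAt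
      (by simpa only [zero_smul] using hgr) hgd (by simpa only [zero_smul] using hwW.symm) hWd
      (by simp only [zero_smul, hθ0]) hTd
    have hline := (tendsto_line e).eventually hgood
    have hqe : ∀ᶠ r : ℝ in 𝓝 0, chartLift g h s z c (θ (r • e)) =
        (chartFun z c (θ (r • e)), -(Real.sqrt (1 + fderiv ℝ (fun y => v (θ y)) (r • e)
          (gradE (normalMetric G x) (fun y => v (θ y)) (r • e))))⁻¹, θ (r • e),
          (h (chartFun z c (θ (r • e))) * Real.sqrt (1 + fderiv ℝ (fun y => v (θ y)) (r • e)
          (gradE (normalMetric G x) (fun y => v (θ y)) (r • e))))⁻¹ •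
            Θ (r • e) (gradE (normalMetric G x) (fun y => v (θ y)) (r • e))) := by
      filter_upwards [hline] with r hr
      rw [hW _ hr.1 hr.2, hgrad _ hr.1 hr.2]
      rfl
    have hq' := hq.congr_of_eventuallyEq hqe
    obtain ⟨f', hf', hfC⟩ := hψx.2
    obtain ⟨Ψ', h1, h2⟩ := exists_hasDerivAt_weighted_le (k := m + 1) hf' hfC
      ((hreg.contDiffAt (hI.mem_nhds (hKI (hzK x)))).differentiableAt (by simp)).hasDerivAt hhx
      (H.eventually_mem hI hKI hreg hpos hs hx) (H.deriv_nonpos hI hKI hreg hpos hs hx)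
      (q := fun r : ℝ => chartLift g h s z c (θ (r • e)))
      (by simp only [zero_smul, hθ0]; rfl) hq'
      (hline.mono fun r hr => H.chartLift_mem hI hKI hreg hpos hs hr.1) (by positivity)
    refine ⟨Ψ', h1, h2.trans ?_⟩
    have h3 : (chartLift g h s z c x).2.2.2 = (h (chartFun z c x) * w)⁻¹ • (p • e) := by
      rw [← hgx, ← hwx]; rfl
    rw [h3, hξ']
    have he := hb e hee
    have hCγ : 0 ≤ Cγ := (norm_nonneg _).trans hγ
    have h4 := norm_lift_line_le (γ := gammaL G x e e) hN0 hw hp.le hw2 hh₀ (hh₁ _ (hzK x)) he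
      (Cγ := Cγ * C₁ * C₁) ((ContinuousLinearMap.le_opNorm₂ _ _ _).trans (by gcongr))
    have h5 := pow_le_pow_left₀ hhx.le (hh₂ _ (hzK x)) (m + 1)
    calc _ ≤ h₂ ^ (m + 1) * (C * ((1 + C₁ + (C₁ + Cγ * C₁ * C₁) / h₁) * (1 + N))) :=
          mul_le_mul h5 (mul_le_mul_of_nonneg_left h4 hC) (by positivity)
            ((pow_nonneg hhx.le _).trans h5)
      _ = _ := by ring
  · positivity
  · exact min_le_left _ _
  · simp only [hθ0]
    refine (min_le_right _ _).trans ?_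
    exact mul_le_mul (pow_le_pow_left₀ hh₀.le (hh₁ _ (hzK x)) _) hψx.1 hc₀.le (by positivity)
  · exact hCJ _ (hzK x)
  · simp only [hθ0]; exact hCH _ (hzK x)
  · have h1 : 0 ≤ Cγ := (norm_nonneg _).trans hγ
    have h2 : 0 ≤ h₂ := hhx.le.trans (hh₂ _ (hzK x))
    positivity
  · intro a b ha hb'
    rw [hG0] at ha hb'
    have := hDG a a b b ha ha hb' hb'
    have : 0 ≤ C₂ * C₁ ^ 4 := by positivity
    linarith
  · intro a b ha hb'
    rw [hG0] at ha hb'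
    have h1 := abs_le.1 (hDG a b b a ha hb' hb' ha)
    have h2 := abs_le.1 (hDG a a b b ha ha hb' hb')
    have : 0 ≤ C₂ * C₁ ^ 4 := by positivity
    exact abs_le.2 ⟨by linarith, by linarith⟩

end localEstimate

/-! ### Solutions lie in the Gårding cone -/

section cone

set_option maxSynthPendingDepth 3

open scoped Topology

theorem fderiv_fderiv_nonpos_of_isLocalMax {E : Type*} [NormedAddCommGroup E] [NormedSpace ℝ E]
    {f : E → ℝ} {x : E} (hf : ContDiffAt ℝ 2 f x) (hmax : IsLocalMax f x) (a : E) :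
    fderiv ℝ (fderiv ℝ f) x a a ≤ 0 := by
  have hl : ∀ s : ℝ, HasDerivAt (fun s : ℝ => x + s • a) a s := fun s => by
    simpa using ((hasDerivAt_id s).smul_const a).const_add x
  have hl0 : ContinuousAt (fun s : ℝ => x + s • a) 0 := (hl 0).continuousAt
  have h0 : x + (0 : ℝ) • a = x := by simp
  have h1 : ∀ᶠ s in 𝓝 (0 : ℝ), HasDerivAt (fun s : ℝ => f (x + s • a))
      (fderiv ℝ f (x + s • a) a) s := by
    have h2 := hl0.eventually (p := fun y => ContDiffAt ℝ 2 f y)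
      (by simp only [h0]; exact hf.eventually (by simp))
    filter_upwards [h2] with s hs
    exact (hs.differentiableAt (by simp)).hasFDerivAt.comp_hasDerivAt s (hl s)
  refine second_deriv_nonpos_of_isLocalMax (f := fun s : ℝ => f (x + s • a)) h1 ?_ ?_
  · have h2 : HasFDerivAt (fderiv ℝ f) (fderiv ℝ (fderiv ℝ f) x) (x + (0 : ℝ) • a) := by
      rw [h0]
      exact ((hf.fderiv_right (m := 1) le_rfl).differentiableAt one_ne_zero).hasFDerivAt
    have h3 := h2.comp_hasDerivAt (0 : ℝ) (hl 0)
    simpa using h3.clm_apply (hasDerivAt_const (0 : ℝ) a)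
  · have h2 : IsLocalMax f (x + (0 : ℝ) • a) := by rwa [h0]
    exact hl0.eventually h2

section gram

variable {E : Type*} [NormedAddCommGroup E] [NormedSpace ℝ E]

theorem det_gramMat_ne_zero {ι : Type*} [Fintype ι] [DecidableEq ι] {G : E → E →L[ℝ] E →L[ℝ] ℝ}
    {v : E → ℝ} {x : E} (hp : ∀ a, a ≠ 0 → 0 < G x a a) (f : Module.Basis ι ℝ E) :
    (gramMat G v f x).det ≠ 0 := by
  intro hdet
  obtain ⟨c, hc, h0⟩ := Matrix.exists_mulVec_eq_zero_iff.2 hdet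
  obtain ⟨a, ha⟩ : ∃ a, a = ∑ j, c j • f j := ⟨_, rfl⟩
  have h1 : ∀ i, gramB G v x (f i) a = 0 := fun i => by
    have h2 : ∑ j, gramMat G v f x i j * c j = 0 := congrFun h0 i
    rw [ha]
    simp only [map_sum, map_smul, smul_eq_mul]
    refine Eq.trans ?_ h2
    exact Finset.sum_congr rfl fun j _ => mul_comm _ _
  have h2 : gramB G v x a a = 0 := by
    have h3 : gramB G v x (∑ j, c j • f j) a = 0 := by
      rw [map_sum]
      simp [h1]
    rwa [← ha] at h3
  have h3 : G x a a + fderiv ℝ v x a * fderiv ℝ v x a = 0 := h2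
  have h4 : a = 0 := by
    by_contra hne
    nlinarith [hp a hne, mul_self_nonneg (fderiv ℝ v x a)]
  refine hc (funext fun i => ?_)
  have := Fintype.linearIndependent_iff.1 f.linearIndependent c (ha.symm.trans h4) i
  simpa using this

theorem continuousAt_matSigma_shapeMat [FiniteDimensional ℝ E] {n : ℕ}
    {G : E → E →L[ℝ] E →L[ℝ] ℝ} {v η : E → ℝ} {x : E}
    (hG : ContDiffAt ℝ 1 G x) (hp : ∀ a, a ≠ 0 → 0 < G x a a) (hv : ContDiffAt ℝ 2 v x)
    (hη : ContinuousAt η x) (f : Module.Basis (Fin n) ℝ E) (k : ℕ) :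
    ContinuousAt (fun y => matSigma ((gramMat G v f y)⁻¹ * shapeMat G v η f y) k) x := by
  have h1 : ContinuousAt G x := hG.continuousAt
  have hv1 : ContDiffAt ℝ 1 (fderiv ℝ v) x := hv.fderiv_right le_rfl
  have h2 : ContinuousAt (fderiv ℝ v) x := hv1.continuousAt
  have h3 : ContinuousAt (fderiv ℝ (fderiv ℝ v)) x :=
    (hv1.fderiv_right (m := 0) le_rfl).continuousAt
  have h4 : ContinuousAt (fderiv ℝ G) x := (hG.fderiv_right (m := 0) le_rfl).continuousAt
  have h5 : ContinuousAt (gradE G v) x := (contDiffAt_gradE hG hp hv1).continuousAt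
  have h6 : ContinuousAt (gramMat G v f) x := by
    refine continuousAt_pi.2 fun i => continuousAt_pi.2 fun j => ?_
    unfold gramMat
    exact ((h1.clm_apply continuousAt_const).clm_apply continuousAt_const).add
      ((h2.clm_apply continuousAt_const).mul (h2.clm_apply continuousAt_const))
  have h8 : ∀ a b : E, ContinuousAt (fun y => chr G y a b (gradE G v y)) x := fun a b => by
    unfold chr
    exact (((((h4.clm_apply continuousAt_const).clm_apply continuousAt_const).clm_apply h5).add
      (((h4.clm_apply continuousAt_const).clm_apply continuousAt_const).clm_apply h5)).sub
      (((h4.clm_apply h5).clm_apply continuousAt_const).clm_apply continuousAt_const)).div_const 2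
  have h9 : ContinuousAt (shapeMat G v η f) x := by
    refine continuousAt_pi.2 fun i => continuousAt_pi.2 fun j => ?_
    unfold shapeMat hessE
    refine (hη.mul ?_).sub (ContinuousAt.sub ?_ (h8 _ _))
    · exact continuousAt_pi.1 (continuousAt_pi.1 h6 i) j
    · exact (h3.clm_apply continuousAt_const).clm_apply continuousAt_const
  refine continuousAt_matSigma ?_ k
  refine ContinuousAt.mul ?_ h9
  simp only [Matrix.inv_def]
  have h10 : ContinuousAt (fun y => (gramMat G v f y).det) x :=
    (Continuous.matrix_det continuous_id).continuousAt.comp h6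
  have h11 : ContinuousAt (fun y => (gramMat G v f y).adjugate) x :=
    (Continuous.matrix_adjugate continuous_id).continuousAt.comp h6
  simp only [Ring.inverse_eq_inv']
  exact (h10.inv₀ (det_gramMat_ne_zero hp f)).smul h11

end gram

variable {n : ℕ} {M : Type*} [TopologicalSpace M]
  [ChartedSpace (EuclideanSpace ℝ (Fin n)) M]
  [IsManifold (𝓡 n) ∞ M] {g : SmoothMetric n M} {h s : ℝ → ℝ} {k : ℕ} {I K : Set ℝ}
  {ψ : ℝ → (u : M) → ℝ × TangentSpace (𝓡 n) u → ℝ} {z : M → ℝ}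
  {ν : (u : M) → ℝ × TangentSpace (𝓡 n) u} {κ : M → Fin n → ℝ}

theorem contDiffAt_height (hz : ContMDiff (𝓡 n) 𝓘(ℝ, ℝ) 3 z) (hI : IsOpen I) (hzI : ∀ u, z u ∈ I)
    (hs3 : ContDiffOn ℝ 3 s I) {c : M} {x : EuclideanSpace ℝ (Fin n)}
    (hx : x ∈ (extChartAt (𝓡 n) c).target) : ContDiffAt ℝ 3 (fun y => s (chartFun z c y)) x :=
  (hs3.contDiffAt (hI.mem_nhds (hzI _))).comp x (contDiffAt_chartFun hz hx)

/-- The length element of the graph is continuous. -/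
theorem IsSolution.continuousAt_chartLength (H : IsSolution g h k ψ K z ν κ) (hI : IsOpen I)
    (hKI : K ⊆ I) (hs3 : ContDiffOn ℝ 3 s I)
    {c : M} {x : EuclideanSpace ℝ (Fin n)} (hx : x ∈ (extChartAt (𝓡 n) c).target) :
    ContinuousAt (chartLength g s z c) x := by
  have h1 : ContDiffAt ℝ 2 (fderiv ℝ (fun y => s (chartFun z c y))) x :=
    (contDiffAt_height H.contMDiff hI (fun u => hKI (H.mem u)) hs3 hx).fderiv_right (by norm_num)
  have h2 : ContDiffAt ℝ 2 (chartMetric g c) x :=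
    ((contDiffOn_chartMetric g c).contDiffAt
      ((isOpen_extChartAt_target c).mem_nhds hx)).of_le (WithTop.coe_le_coe.2 le_top)
  have h3 := contDiffAt_gradE h2 (chartMetric_pos g hx) h1
  have h4 := h1.continuousAt.clm_apply h3.continuousAt
  exact Real.continuous_sqrt.continuousAt.comp (continuousAt_const.add h4)

/-- The curvatures `κ` themselves are chosen pointwise in an arbitrary order, but their elementary
symmetric functions are continuous. -/
theorem IsSolution.continuous_sigmaK (H : IsSolution g h k ψ K z ν κ) (hI : IsOpen I)
    (hKI : K ⊆ I) (hreg : ContDiffOn ℝ 2 h I) (hpos : ∀ t ∈ I, 0 < h t)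
    (hs : ∀ t ∈ I, HasDerivAt s (h t)⁻¹ t) (hs3 : ContDiffOn ℝ 3 s I) (j : ℕ) :
    Continuous fun u => sigmaK j (κ u) := by
  rw [continuous_iff_continuousAt]
  intro c
  have hT : IsOpen (extChartAt (𝓡 n) c).target := isOpen_extChartAt_target c
  have hx := mem_extChartAt_target (I := 𝓡 n) c
  set x := extChartAt (𝓡 n) c c
  have hζ : ContinuousAt (chartFun z c) x := (contDiffAt_chartFun H.contMDiff hx).continuousAt
  have hzI : chartFun z c x ∈ I := hKI (H.mem _)
  have h1 : ContinuousAt (fun y => matSigma ((gramMat (chartMetric g c)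
      (fun y => s (chartFun z c y)) (EuclideanSpace.basisFun (Fin n) ℝ).toBasis y)⁻¹ *
      shapeMat (chartMetric g c) (fun y => s (chartFun z c y)) (fun y => deriv h (chartFun z c y))
        (EuclideanSpace.basisFun (Fin n) ℝ).toBasis y) j) x := by
    refine continuousAt_matSigma_shapeMat ?_ (chartMetric_pos g hx) ?_ ?_ _ j
    · exact ((contDiffOn_chartMetric g c).contDiffAt (hT.mem_nhds hx)).of_le
        (WithTop.coe_le_coe.2 le_top)
    · exact (contDiffAt_height H.contMDiff hI (fun u => hKI (H.mem u)) hs3 hx).of_le (by norm_num)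
    · exact ContinuousAt.comp (f := chartFun z c)
        (((hreg.continuousOn_deriv_of_isOpen hI (by norm_num)).continuousAt (hI.mem_nhds hzI))) hζ
  have h2 : ContinuousAt (fun y => (h (chartFun z c y) * chartLength g s z c y) ^ j) x :=
    ((ContinuousAt.comp (f := chartFun z c) (hreg.continuousOn.continuousAt (hI.mem_nhds hzI))
      hζ).mul (H.continuousAt_chartLength hI hKI hs3 hx)).pow j
  have hpw : ∀ y ∈ (extChartAt (𝓡 n) c).target, 0 < h (chartFun z c y) * chartLength g s z c y :=
    fun y hy => mul_pos (hpos _ (hKI (H.mem _)))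
      (Real.sqrt_pos.2 (by linarith [(H.chart_normal hI hKI hreg hpos hs hy).1]))
  have h3 := h1.div h2 (pow_pos (hpw x hx) j).ne'
  have h4 : ContinuousAt (fun y => sigmaK j (κ ((extChartAt (𝓡 n) c).symm y))) x := by
    refine h3.congr ?_
    filter_upwards [hT.mem_nhds hx] with y hy
    rw [Pi.div_apply, (H.chart_normal hI hKI hreg hpos hs hy).2.2,
      mul_div_cancel_left₀ _ (pow_pos (hpw y hy) j).ne']
  have h5 := ContinuousAt.comp (x := c) (f := extChartAt (𝓡 n) c) h4 (continuousAt_extChartAt c)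
  refine h5.congr ?_
  filter_upwards [extChartAt_source_mem_nhds (I := 𝓡 n) c] with u hu
  simp only [Function.comp_apply]
  rw [(extChartAt (𝓡 n) c).left_inv hu]

/-- At a maximum of the height all principal curvatures are positive. -/
theorem IsSolution.curvature_pos_of_isLocalMax (H : IsSolution g h k ψ K z ν κ) (hI : IsOpen I)
    (hKI : K ⊆ I) (hreg : ContDiffOn ℝ 2 h I) (hpos : ∀ t ∈ I, 0 < h t)
    (hderiv : ∀ t ∈ I, 0 < deriv h t) (hs : ∀ t ∈ I, HasDerivAt s (h t)⁻¹ t)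
    {c : M} (hmax : IsLocalMax z c) (i : Fin n) : 0 < κ c i := by
  have hx := mem_extChartAt_target (I := 𝓡 n) c
  have hxc : (extChartAt (𝓡 n) c).symm (extChartAt (𝓡 n) c c) = c := extChartAt_to_inv c
  set x := extChartAt (𝓡 n) c c
  have hzI : chartFun z c x ∈ I := hKI (H.mem _)
  have h0 := hpos _ hzI
  have h0' := hderiv _ hzI
  have hs' : ∀ᶠ t in 𝓝 (chartFun z c x), HasDerivAt s (h t)⁻¹ t := by
    filter_upwards [hI.mem_nhds hzI] with t ht using hs t ht
  have hh : HasDerivAt h (deriv h (chartFun z c x)) (chartFun z c x) :=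
    ((hreg.contDiffAt (hI.mem_nhds hzI)).differentiableAt (by simp)).hasDerivAt
  obtain ⟨h1, -, β, h3, h4⟩ := exists_frame_of_isPrincipalCurvatures hx H.contMDiff hs' hh h0
    (H.normal _) (H.curvatures _) rfl (w := chartLength g s z c x) rfl
  have hw : 0 < chartLength g s z c x := Real.sqrt_pos.2 (by linarith)
  have hζ2 : ContDiffAt ℝ 2 (chartFun z c) x :=
    (contDiffAt_chartFun H.contMDiff hx).of_le (by norm_num)
  have hζmax : IsLocalMax (chartFun z c) x := by
    have h5 : ContinuousAt (extChartAt (𝓡 n) c).symm x :=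
      (contMDiffAt_extChartAt_symm_of_mem hx).continuousAt
    have h6 : IsLocalMax z ((extChartAt (𝓡 n) c).symm x) := by rwa [hxc]
    exact h5.eventually h6
  have hdζ : fderiv ℝ (chartFun z c) x = 0 := hζmax.fderiv_eq_zero
  have hD := fderiv_fderiv_nonpos_of_isLocalMax hζ2 hζmax (β i)
  obtain ⟨h6, h7⟩ := fderiv_fderiv_height hs' hh h0.ne' hζ2
  have hdv : fderiv ℝ (fun y => s (chartFun z c y)) x = 0 := by
    rw [h6.self_of_nhds, hdζ, smul_zero]
  have hgr : gradE (chartMetric g c) (fun y => s (chartFun z c y)) x = 0 := by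
    rw [gradE, hdv, map_zero]
  have h8 := h3 i i
  have h9 := h4 i i
  rw [if_pos rfl] at h8 h9
  rw [hxc] at h9
  rw [← h9, hessE, hgr, h7, hdζ]
  have h10 : chr (chartMetric g c) x (β i) (β i) 0 = 0 := by simp [chr]
  have h11 : 0 < gramMat (chartMetric g c) (fun y => s (chartFun z c y)) β x i i := by
    by_contra hneg
    nlinarith [sq_nonneg (h (chartFun z c x))]
  rw [h10]
  have h12 : (h (chartFun z c x))⁻¹ * fderiv ℝ (fderiv ℝ (chartFun z c)) x (β i) (β i) ≤ 0 :=
    mul_nonpos_of_nonneg_of_nonpos (by positivity) hD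
  have h13 := mul_pos h0' h11
  refine mul_pos (by positivity) ?_
  simp only [zero_apply, mul_zero]
  linarith

/-- The principal curvatures of a solution on a compact manifold lie in the Gårding cone. -/
theorem IsSolution.sigmaK_pos [CompactSpace M] (H : IsSolution g h k ψ K z ν κ) (hI : IsOpen I)
    (hKI : K ⊆ I) (hreg : ContDiffOn ℝ 2 h I) (hpos : ∀ t ∈ I, 0 < h t)
    (hderiv : ∀ t ∈ I, 0 < deriv h t)
    (hs : ∀ t ∈ I, HasDerivAt s (h t)⁻¹ t) (hs3 : ContDiffOn ℝ 3 s I)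
    (hψpos : ∀ t ∈ I, ∀ (u : M) (ν : ℝ × TangentSpace (𝓡 n) u),
      warpedInner g h t u ν ν = 1 → 0 < ψ t u ν) (hk1 : 1 ≤ k) (hkn : k ≤ n)
    (u : M) (j : ℕ) (hj : j ≤ k) : 0 < sigmaK j (κ u) := by
  have hc := H.continuous_sigmaK hI hKI hreg hpos hs hs3
  have hσ : ∀ u, 0 < sigmaK k (κ u) := fun u => by
    rw [H.equation]; exact hψpos _ (hKI (H.mem u)) u _ (H.normal u).1
  let S : Set M := {u | ∀ j ∈ Finset.Iic k, 0 < sigmaK j (κ u)}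
  have hopen : IsOpen S := by
    have : S = ⋂ j ∈ Finset.Iic k, {u | 0 < sigmaK j (κ u)} := by ext; simp [S]
    rw [this]
    exact isOpen_biInter_finset fun j _ => isOpen_lt continuous_const (hc j)
  -- by Newton's inequalities the cone is also given by weak inequalities
  have hclosed : IsClosed S := by
    have : S = ⋂ j ∈ Finset.Iic k, {u | 0 ≤ sigmaK j (κ u) ∧
        sigmaK k (κ u) ^ j ≤ sigmaK j (κ u) ^ k} := by
      ext u
      simp only [S, mem_iInter, mem_ofPred_eq]
      refine ⟨fun hu j hj => ⟨(hu j hj).le, ?_⟩, fun hu j hj => ?_⟩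
      · have := esym_pow_le_pow (s := Finset.univ) (a := κ u) (k := k) (fun j hj => by
          rw [esym_univ_eq_sigmaK]; exact hu j (Finset.mem_Iic.2 hj)) (Finset.mem_Iic.1 hj)
        rwa [esym_univ_eq_sigmaK, esym_univ_eq_sigmaK] at this
      · refine lt_of_le_of_ne (hu j hj).1 fun h0 => ?_
        have h1 := (pow_pos (hσ u) j).trans_le (hu j hj).2
        rw [← h0, zero_pow (by omega)] at h1
        exact lt_irrefl _ h1
    rw [this]
    exact isClosed_biInter fun j _ => (isClosed_le continuous_const (hc j)).inter
      (isClosed_le ((hc k).pow j) ((hc j).pow k))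
  -- At a maximum of `z` on the open complement all principal curvatures are positive.
  have hall : Sᶜ = ∅ := by
    by_contra hne
    obtain ⟨p, hp, hmax⟩ := hopen.isClosed_compl.isCompact.exists_isMaxOn
      (nonempty_iff_ne_empty.2 hne) H.contMDiff.continuous.continuousOn
    have hloc : IsLocalMax z p := by
      filter_upwards [hclosed.isOpen_compl.mem_nhds hp] with q hq using hmax hq
    refine hp fun j hj => ?_
    rw [← esym_univ_eq_sigmaK]
    refine esym_pos_of_pos (s := Finset.univ) (a := κ p) (fun i _ =>
      H.curvature_pos_of_isLocalMax hI hKI hreg hpos hderiv hs hloc i) ?_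
    rw [Finset.card_univ, Fintype.card_fin]
    exact (Finset.mem_Iic.1 hj).trans hkn
  have hu : u ∈ S := by
    by_contra hu
    have : u ∈ Sᶜ := hu
    rw [hall] at this
    exact this
  exact hu j (Finset.mem_Iic.2 hj)

end cone

/-! ### Uniform constants and the global estimate -/

section assembly

set_option maxSynthPendingDepth 3

open scoped Topology

/-- An antiderivative of `1 / h`, the conformal height. -/
theorem exists_antideriv_inv {I : Set ℝ} (hI : IsOpen I) (hconn : I.OrdConnected) {h : ℝ → ℝ}
    (hreg : ContDiffOn ℝ 2 h I) (hpos : ∀ t ∈ I, 0 < h t) {t₀ : ℝ} (ht₀ : t₀ ∈ I) :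
    ∃ s : ℝ → ℝ, (∀ t ∈ I, HasDerivAt s (h t)⁻¹ t) ∧ ContDiffOn ℝ 3 s I := by
  have hinv : ContDiffOn ℝ 2 (fun t => (h t)⁻¹) I := hreg.inv fun t ht => (hpos t ht).ne'
  have hd : ∀ t ∈ I, HasDerivAt (fun t => ∫ r in t₀..t, (h r)⁻¹) (h t)⁻¹ t := fun t ht =>
    intervalIntegral.integral_hasDerivAt_right
      ((hinv.continuousOn.mono (hconn.uIcc_subset ht₀ ht)).intervalIntegrable)
      (hinv.continuousOn.stronglyMeasurableAtFilter hI t ht)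
      (hinv.continuousOn.continuousAt (hI.mem_nhds ht))
  refine ⟨_, hd, ?_⟩
  rw [show (3 : WithTop ℕ∞) = 2 + 1 by norm_num, contDiffOn_succ_iff_deriv_of_isOpen hI]
  exact ⟨fun t ht => (hd t ht).differentiableAt.differentiableWithinAt, by simp,
    hinv.congr fun t ht => (hd t ht).deriv⟩

theorem false_of_sq_le {n : ℕ} {N A B E c : ℝ} (hA : 0 ≤ A) (hE : 0 ≤ E) (hc : 0 < c)
    (hN : 1 ≤ N) (hNB : n * (A + B) + 2 * E / c < N)
    (h : N ^ 2 ≤ n * (A + N * B) + E * (1 + N) / c) : False := by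
  have h1 : E * (1 + N) / c ≤ N * (2 * E / c) := by
    rw [mul_div_assoc', div_le_div_iff_of_pos_right hc]
    nlinarith
  have h2 : (n : ℝ) * (A + N * B) ≤ N * (n * (A + B)) := by
    have : 0 ≤ (n : ℝ) * (A * (N - 1)) := by
      have := sub_nonneg.2 hN
      positivity
    nlinarith
  nlinarith

section local_global

variable {d m : ℕ} {M : Type*} [TopologicalSpace M]
  [ChartedSpace (EuclideanSpace ℝ (Fin (d + 1))) M]
  [IsManifold (𝓡 (d + 1)) ∞ M] {g : SmoothMetric (d + 1) M} {h s : ℝ → ℝ} {I K : Set ℝ}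
  {ψ : ℝ → (u : M) → ℝ × TangentSpace (𝓡 (d + 1)) u → ℝ}

/-- For `N` large, uniformly near a point of `M` and over all solutions, the maximum points of
`log ω - N v` are critical points of `v`. -/
theorem exists_forall_isLocalMax_nhds (hI : IsOpen I) (hK : IsCompact K) (hKI : K ⊆ I)
    (hreg : ContDiffOn ℝ 2 h I) (hpos : ∀ t ∈ I, 0 < h t) (hs : ∀ t ∈ I, HasDerivAt s (h t)⁻¹ t)
    (hs3 : ContDiffOn ℝ 3 s I) (hψ : IsC1OnUnitBundle g h I ψ)
    (hψpos : ∀ t ∈ I, ∀ (u : M) (ν : ℝ × TangentSpace (𝓡 (d + 1)) u),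
      warpedInner g h t u ν ν = 1 → 0 < ψ t u ν) (c : M) :
    ∃ N₀ : ℝ, ∀ᶠ p in 𝓝 c, ∀ N ≥ N₀, ∀ (z : M → ℝ)
      (ν : (u : M) → ℝ × TangentSpace (𝓡 (d + 1)) u) (κ : M → Fin (d + 1) → ℝ),
      IsSolution g h (m + 1) ψ K z ν κ → (∀ u, ∀ j ≤ m + 1, 0 < sigmaK j (κ u)) →
      IsLocalMax (fun u => -Real.log (-(ν u).1) - N * s (z u)) p → (ν p).1 = -1 := by
  have hT : IsOpen (extChartAt (𝓡 (d + 1)) c).target := isOpen_extChartAt_target c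
  have hx₀ := mem_extChartAt_target (I := 𝓡 (d + 1)) c
  set x₀ := extChartAt (𝓡 (d + 1)) c c
  have hG : ContDiffAt ℝ ∞ (chartMetric g c) x₀ :=
    (contDiffOn_chartMetric g c).contDiffAt (hT.mem_nhds hx₀)
  have hGp : ∀ᶠ y in 𝓝 x₀, ∀ a, a ≠ 0 → 0 < chartMetric g c y a a := by
    filter_upwards [hT.mem_nhds hx₀] with y hy using chartMetric_pos g hy
  obtain ⟨C₁, hC₁, hb⟩ := exists_bound_norm_of_unit hG.continuousAt
    (Filter.Eventually.of_forall fun y => chartMetric_symm g c y) hGp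
  have hγ : ∀ᶠ x in 𝓝 x₀, ‖gammaL (chartMetric g c) x‖ < ‖gammaL (chartMetric g c) x₀‖ + 1 :=
    (contDiffAt_gammaL hG (chartMetric_pos g hx₀)).continuousAt.norm.eventually
      (gt_mem_nhds (lt_add_one _))
  obtain ⟨C₂, hC₂, hD2⟩ := exists_bound_fderiv_snd
    (contDiffAt_normalMetric hG (chartMetric_pos g hx₀))
  obtain ⟨C, c₀, hC, hc₀, hψb⟩ := exists_bounds_chartPsi hψ hψpos hreg.continuousOn hpos hK hKI hx₀
  obtain ⟨h₁, hh₀, hh₁⟩ := hK.exists_forall_le' (hreg.continuousOn.mono hKI)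
    (fun t ht => hpos t (hKI ht))
  have hd1 : ContDiffOn ℝ 1 (deriv h) I :=
    ((contDiffOn_succ_iff_deriv_of_isOpen (n := 1) hI).1 hreg).2.2
  have hd2 : ContinuousOn (deriv (deriv h)) I := hd1.continuousOn_deriv_of_isOpen hI le_rfl
  obtain ⟨h₂, hh₂⟩ := hK.exists_bound_of_continuousOn (hreg.continuousOn.mono hKI)
  obtain ⟨CH, hCH⟩ := hK.exists_bound_of_continuousOn (hd1.continuousOn.mono hKI)
  obtain ⟨CJ, hCJ⟩ := hK.exists_bound_of_continuousOn ((hd2.mul hreg.continuousOn).mono hKI)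
  set Cγ := ‖gammaL (chartMetric g c) x₀‖ + 1
  -- the error constant from the derivative of `h^k ψ`, and a lower bound for `h^k ψ`
  let E := h₂ ^ (m + 1) * (C * (1 + C₁ + (C₁ + Cγ * C₁ * C₁) / h₁))
  let c₁ := min 1 (h₁ ^ (m + 1) * c₀)
  refine ⟨max (max CH 1)
    (((d + 1 : ℕ) : ℝ) * (CJ + 2 * (2 * (C₂ * C₁ ^ 4)) + CH) + 2 * E / c₁ + 1), ?_⟩
  have hev := (continuousAt_extChartAt (I := 𝓡 (d + 1)) c).eventually
    (hb.and (hγ.and (hD2.and hψb)))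
  filter_upwards [hev, extChartAt_source_mem_nhds (I := 𝓡 (d + 1)) c]
    with p ⟨hp1, hp2, ⟨hp3, hp4⟩, hp5⟩ hps N hN z ν κ H hcone hmax
  have hN1 := (le_max_left _ _).trans hN
  have hN2 := (le_max_right _ _).trans hN
  set x := extChartAt (𝓡 (d + 1)) c p
  have hx : x ∈ (extChartAt (𝓡 (d + 1)) c).target := (extChartAt (𝓡 (d + 1)) c).map_source hps
  have hxp : (extChartAt (𝓡 (d + 1)) c).symm x = p := (extChartAt (𝓡 (d + 1)) c).left_inv hps
  have hdv : fderiv ℝ (fun y => s (chartFun z c y)) x = 0 := by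
    by_contra hne
    have hmain := H.sq_le_of_isLocalMax hI hKI hreg hpos hs hs3 hcone hx (Cγ := Cγ) (h₂ := h₂)
      (CH := CH) (CJ := CJ) hh₀ hh₁
      (fun t ht => (le_abs_self _).trans (hh₂ t ht)) hCH hCJ hC₁ hp1 hp2.le hp3 hC₂ hp4 hC hc₀ hp5
      ((le_max_left _ _).trans hN1) (by rwa [hxp]) hne
    have hzK := H.mem p
    have h1 : 0 ≤ CJ := (norm_nonneg _).trans (hCJ _ hzK)
    have h2 : 0 ≤ h₂ := (norm_nonneg _).trans (hh₂ _ hzK)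
    have h3 : 0 ≤ Cγ := by positivity
    exact false_of_sq_le (by positivity) (show 0 ≤ E by positivity) (show 0 < c₁ by positivity)
      ((le_max_right _ _).trans hN1) (by linarith) hmain
  have h1 := (H.chart_normal hI hKI hreg hpos hs hx).2.1
  have h2 : chartLength g s z c x = 1 := by
    rw [chartLength, hdv]; simp
  rw [hxp, h2] at h1
  rw [h1]
  simp

/-- The constant of `exists_forall_isLocalMax_nhds` can be chosen uniformly on `M`. -/
theorem exists_forall_isLocalMax [CompactSpace M] (hI : IsOpen I) (hK : IsCompact K)
    (hKI : K ⊆ I)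
    (hreg : ContDiffOn ℝ 2 h I) (hpos : ∀ t ∈ I, 0 < h t) (hs : ∀ t ∈ I, HasDerivAt s (h t)⁻¹ t)
    (hs3 : ContDiffOn ℝ 3 s I) (hψ : IsC1OnUnitBundle g h I ψ)
    (hψpos : ∀ t ∈ I, ∀ (u : M) (ν : ℝ × TangentSpace (𝓡 (d + 1)) u),
      warpedInner g h t u ν ν = 1 → 0 < ψ t u ν) :
    ∃ N : ℝ, 0 ≤ N ∧ ∀ (z : M → ℝ)
      (ν : (u : M) → ℝ × TangentSpace (𝓡 (d + 1)) u) (κ : M → Fin (d + 1) → ℝ),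
      IsSolution g h (m + 1) ψ K z ν κ → (∀ u, ∀ j ≤ m + 1, 0 < sigmaK j (κ u)) →
      ∀ p, IsLocalMax (fun u => -Real.log (-(ν u).1) - N * s (z u)) p → (ν p).1 = -1 := by
  let P : Set M → Prop := fun U => ∃ N₀ : ℝ, ∀ p ∈ U, ∀ N ≥ N₀, ∀ (z : M → ℝ)
      (ν : (u : M) → ℝ × TangentSpace (𝓡 (d + 1)) u) (κ : M → Fin (d + 1) → ℝ),
      IsSolution g h (m + 1) ψ K z ν κ → (∀ u, ∀ j ≤ m + 1, 0 < sigmaK j (κ u)) →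
      IsLocalMax (fun u => -Real.log (-(ν u).1) - N * s (z u)) p → (ν p).1 = -1
  obtain ⟨N₀, hN₀⟩ : P univ := by
    refine isCompact_univ.induction_on ⟨0, by simp⟩ ?_ ?_ ?_
    · rintro U V hUV ⟨N, hN⟩
      exact ⟨N, fun p hp => hN p (hUV hp)⟩
    · rintro U V ⟨N, hN⟩ ⟨N', hN'⟩
      refine ⟨max N N', ?_⟩
      rintro p (hp | hp) n hn
      · exact hN p hp n ((le_max_left _ _).trans hn)
      · exact hN' p hp n ((le_max_right _ _).trans hn)
    · intro c _
      obtain ⟨N, hN⟩ := exists_forall_isLocalMax_nhds (m := m) hI hK hKI hreg hpos hs hs3 hψ hψpos c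
      exact ⟨_, mem_nhdsWithin_of_mem_nhds hN, N, fun p hp => hp⟩
  exact ⟨max 0 N₀, le_max_left _ _, fun z ν κ H hc p => hN₀ p trivial _ (le_max_right _ _) z ν κ H hc⟩

end local_global

variable {n : ℕ} {M : Type*} [TopologicalSpace M]
  [ChartedSpace (EuclideanSpace ℝ (Fin n)) M]
  [IsManifold (𝓡 n) ∞ M] {g : SmoothMetric n M} {h s : ℝ → ℝ} {k : ℕ} {I K : Set ℝ}
  {ψ : ℝ → (u : M) → ℝ × TangentSpace (𝓡 n) u → ℝ} {z : M → ℝ}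
  {ν : (u : M) → ℝ × TangentSpace (𝓡 n) u} {κ : M → Fin n → ℝ}

theorem IsSolution.continuous_normal (H : IsSolution g h k ψ K z ν κ) (hI : IsOpen I)
    (hKI : K ⊆ I) (hreg : ContDiffOn ℝ 2 h I) (hpos : ∀ t ∈ I, 0 < h t)
    (hs : ∀ t ∈ I, HasDerivAt s (h t)⁻¹ t) (hs3 : ContDiffOn ℝ 3 s I) :
    Continuous fun u => (ν u).1 := by
  rw [continuous_iff_continuousAt]
  intro c
  have hx := mem_extChartAt_target (I := 𝓡 n) c
  have h1 := H.chart_normal hI hKI hreg hpos hs hx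
  have hw : 0 < chartLength g s z c (extChartAt (𝓡 n) c c) := Real.sqrt_pos.2 (by linarith [h1.1])
  have h2 := ((H.continuousAt_chartLength hI hKI hs3 hx).inv₀ hw.ne').neg
  have h3 := ContinuousAt.comp (x := c) (f := extChartAt (𝓡 n) c) h2 (continuousAt_extChartAt c)
  refine h3.congr ?_
  filter_upwards [extChartAt_source_mem_nhds (I := 𝓡 n) c] with u hu
  have h4 := (H.chart_normal hI hKI hreg hpos hs ((extChartAt (𝓡 n) c).map_source hu)).2.1
  rw [(extChartAt (𝓡 n) c).left_inv hu] at h4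
  rw [h4]
  rfl

theorem IsInwardUnitNormal.fst_neg {u : M} {ν : ℝ × TangentSpace (𝓡 n) u}
    (hν : IsInwardUnitNormal g h z u ν) : ν.1 < 0 := by
  have := hν.2.2
  simpa [warpedInner] using this

theorem IsInwardUnitNormal.supportFunction_eq {u : M} (ν : ℝ × TangentSpace (𝓡 n) u) :
    supportFunction g h z u ν = h (z u) * -ν.1 := by
  simp [supportFunction, warpedInner]

/-- The gradient of `z` in terms of the unit normal. -/
theorem IsInwardUnitNormal.exists_gradient {u : M} {ν : ℝ × TangentSpace (𝓡 n) u}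
    (hν : IsInwardUnitNormal g h z u ν) (h0 : 0 < h (z u)) :
    ∃ w : TangentSpace (𝓡 n) u, IsGradient g z u w ∧
      Real.sqrt (g.inner u w w) ≤ h (z u) / -ν.1 := by
  have hneg := hν.fst_neg
  obtain ⟨h1, h2, -⟩ := hν
  refine ⟨(-(h (z u) ^ 2 / ν.1)) • ν.2, fun v => ?_, ?_⟩
  · have h3 : ν.1 * (graphTangent z u v).1 + h (z u) ^ 2 * g.inner u ν.2 v = 0 := h2 v
    have h4 : g.inner u ((-(h (z u) ^ 2 / ν.1)) • ν.2) v =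
        -(h (z u) ^ 2 / ν.1) * g.inner u ν.2 v := by
      rw [map_smul]; rfl
    have h5 : (graphTangent z u v).1 = -(h (z u) ^ 2 / ν.1) * g.inner u ν.2 v := by
      have := hneg.ne
      field_simp
      linarith
    exact h4.trans h5.symm
  · have h3 : ν.1 * ν.1 + h (z u) ^ 2 * g.inner u ν.2 ν.2 = 1 := h1
    have h4 : g.inner u ((-(h (z u) ^ 2 / ν.1)) • ν.2) ((-(h (z u) ^ 2 / ν.1)) • ν.2) =
        (h (z u) ^ 2 / ν.1) ^ 2 * g.inner u ν.2 ν.2 := by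
      rw [map_smul, map_smul]
      change -(h (z u) ^ 2 / ν.1) * (-(h (z u) ^ 2 / ν.1) * g.inner u ν.2 ν.2) = _
      ring
    have hpos : 0 < -ν.1 := by linarith
    rw [h4]
    refine Real.sqrt_le_iff.2 ⟨by positivity, ?_⟩
    have h5 : h (z u) ^ 2 * g.inner u ν.2 ν.2 ≤ 1 := by nlinarith [mul_self_nonneg ν.1]
    calc (h (z u) ^ 2 / ν.1) ^ 2 * g.inner u ν.2 ν.2
        = (h (z u) / -ν.1) ^ 2 * (h (z u) ^ 2 * g.inner u ν.2 ν.2) := by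
          have := hneg.ne
          field_simp
      _ ≤ (h (z u) / -ν.1) ^ 2 * 1 := by gcongr
      _ = _ := mul_one _

/-- If the maximum points of `log ω - N v` are critical, `ω` is bounded. -/
theorem IsSolution.exp_le_normal [CompactSpace M] (H : IsSolution g h k ψ K z ν κ) (hI : IsOpen I)
    (hKI : K ⊆ I) (hreg : ContDiffOn ℝ 2 h I) (hpos : ∀ t ∈ I, 0 < h t)
    (hs : ∀ t ∈ I, HasDerivAt s (h t)⁻¹ t) (hs3 : ContDiffOn ℝ 3 s I) {N S : ℝ} (hN : 0 ≤ N)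
    (hS : ∀ t ∈ K, |s t| ≤ S)
    (hcrit : ∀ p, IsLocalMax (fun u => -Real.log (-(ν u).1) - N * s (z u)) p → (ν p).1 = -1)
    (u : M) : Real.exp (-(N * (2 * S))) ≤ -(ν u).1 := by
  have hνpos : ∀ u, 0 < -(ν u).1 := fun u => neg_pos.2 (H.normal u).fst_neg
  have hQ : Continuous (fun u => -Real.log (-(ν u).1) - N * s (z u)) := by
    have h1 := (H.continuous_normal hI hKI hreg hpos hs hs3).neg
    have h2 : Continuous fun u => s (z u) :=
      hs3.continuousOn.comp_continuous H.contMDiff.continuous fun u => hKI (H.mem u)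
    exact ((h1.log fun u => (hνpos u).ne').neg).sub (continuous_const.mul h2)
  obtain ⟨p, -, hp⟩ := isCompact_univ.exists_isMaxOn (⟨u, trivial⟩ : (univ : Set M).Nonempty)
    hQ.continuousOn
  have hp' : ∀ q, -Real.log (-(ν q).1) - N * s (z q) ≤ -Real.log (-(ν p).1) - N * s (z p) :=
    fun q => hp (mem_univ q)
  have h1 := hcrit p (Filter.Eventually.of_forall hp')
  have h2 := hp' u
  rw [h1, neg_neg, Real.log_one] at h2
  rw [← Real.le_log_iff_exp_le (hνpos u)]
  have h3 := abs_le.1 (hS _ (H.mem u))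
  have h4 := abs_le.1 (hS _ (H.mem p))
  nlinarith

end assembly

theorem lemma3p1 {n : ℕ} {M : Type*} [TopologicalSpace M]
    [ChartedSpace (EuclideanSpace ℝ (Fin n)) M]
    [IsManifold 𝓘(ℝ, EuclideanSpace ℝ (Fin n)) ∞ M] [T2Space M] [CompactSpace M]
    (g : SmoothMetric n M)
    (I : Set ℝ) (hIopen : IsOpen I) (hIconn : I.OrdConnected)
    (h : ℝ → ℝ) (hreg : ContDiffOn ℝ 2 h I) (hpos : ∀ t ∈ I, 0 < h t)
    (hderiv : ∀ t ∈ I, 0 < deriv h t)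
    (k : ℕ) (hk1 : 1 ≤ k) (hkn : k ≤ n)
    (ψ : ℝ → (u : M) → ℝ × TangentSpace 𝓘(ℝ, EuclideanSpace ℝ (Fin n)) u → ℝ)
    (hψreg : IsC1OnUnitBundle g h I ψ)
    (hψpos : ∀ t ∈ I, ∀ (u : M) (ν : ℝ × TangentSpace 𝓘(ℝ, EuclideanSpace ℝ (Fin n)) u),
      warpedInner g h t u ν ν = 1 → 0 < ψ t u ν)
    (zmin zmax : ℝ) (hzmin : zmin ∈ I) (hzmax : zmax ∈ I) :
    ∃ C τ₀ : ℝ, 0 < τ₀ ∧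
      ∀ (z : M → ℝ) (ν : (u : M) → ℝ × TangentSpace 𝓘(ℝ, EuclideanSpace ℝ (Fin n)) u),
        ContMDiff 𝓘(ℝ, EuclideanSpace ℝ (Fin n)) 𝓘(ℝ, ℝ) 3 z →
        (∀ u, zmin ≤ z u ∧ z u ≤ zmax) →
        (∀ u, IsInwardUnitNormal g h z u (ν u)) →
        (∀ u, ∃ κ : Fin n → ℝ, IsPrincipalCurvatures g h z u (ν u) κ ∧
          sigmaK k κ = ψ (z u) u (ν u)) →
        (∀ u, dtWeighted h k ψ (z u) u (ν u) ≤ 0) →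
        (∀ u, ∃ w : TangentSpace 𝓘(ℝ, EuclideanSpace ℝ (Fin n)) u,
          IsGradient g z u w ∧ Real.sqrt (g.inner u w w) ≤ C) ∧
        (∀ u, τ₀ ≤ supportFunction g h z u (ν u)) := by
  obtain ⟨s, hs, hs3⟩ := exists_antideriv_inv hIopen hIconn hreg hpos hzmin
  obtain ⟨d, rfl⟩ : ∃ d, n = d + 1 := ⟨n - 1, by omega⟩
  obtain ⟨m, rfl⟩ : ∃ m, k = m + 1 := ⟨k - 1, by omega⟩
  have hK : IsCompact (Icc zmin zmax) := isCompact_Icc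
  have hKI : Icc zmin zmax ⊆ I := hIconn.out hzmin hzmax
  obtain ⟨N, hN, hcrit⟩ := exists_forall_isLocalMax (m := m) hIopen hK hKI hreg hpos hs hs3 hψreg
    hψpos
  obtain ⟨S, hS⟩ := hK.exists_bound_of_continuousOn (hs3.continuousOn.mono hKI)
  obtain ⟨h₁, hh₀, hh₁⟩ := hK.exists_forall_le' (hreg.continuousOn.mono hKI)
    (fun t ht => hpos t (hKI ht))
  obtain ⟨h₂, hh₂⟩ := hK.exists_bound_of_continuousOn (hreg.continuousOn.mono hKI)
  refine ⟨h₂ / Real.exp (-(N * (2 * S))), h₁ * Real.exp (-(N * (2 * S))), by positivity, ?_⟩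
  intro z ν hz hzI hν hκ hdt
  choose κ hκ1 hκ2 using hκ
  have H : IsSolution g h (m + 1) ψ (Icc zmin zmax) z ν κ := ⟨hz, hzI, hν, hκ1, hκ2, hdt⟩
  have hcone := H.sigmaK_pos hIopen hKI hreg hpos hderiv hs hs3 hψpos hk1 hkn
  have hexp := H.exp_le_normal hIopen hKI hreg hpos hs hs3 hN hS (hcrit z ν κ H hcone)
  have hh₂' : ∀ u, h (z u) ≤ h₂ := fun u => (le_abs_self _).trans (hh₂ _ (hzI u))
  refine ⟨fun u => ?_, fun u => ?_⟩
  · have h0 := hpos _ (hKI (hzI u))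
    obtain ⟨w, hw1, hw2⟩ := (hν u).exists_gradient h0
    exact ⟨w, hw1, hw2.trans (div_le_div₀ (h0.le.trans (hh₂' u)) (hh₂' u) (Real.exp_pos _) (hexp u))⟩
  · rw [IsInwardUnitNormal.supportFunction_eq]
    exact mul_le_mul (hh₁ _ (hzI u)) (hexp u) (Real.exp_pos _).le (hpos _ (hKI (hzI u))).le
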